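/- **Setting.** Let $0\le\gamma\le 1$ and let $q_0:[0,\pi]\to\mathbb R$ be measurable, not almost everywhere zero, with $0\le q_0(\theta)\le C|\cos\theta|$ for some constant $C$. For $u,v\in\mathbb R^3$, $\omega\in\mathbb S^2$ put $u'=u+[(v-u)\cdot\omega]\omega$, $v'=v-[(v-u)\cdot\omega]\omega$, $\cos\theta=\frac{(u-v)\cdot\omega}{|u-v|}$, and let $$Q(F_1,F_2)(v)=\int_{\mathbb R^3}\int_{\mathbb S^2}|v-u|^\gamma q_0(\theta)\{F_1(v')F_2(u')-F_1(v)F_2(u)\}\,d\omega\,du .$$ For $\varpi,x,v\in\mathbb R^3$ let $$m_\varpi(x,v)=(2\pi)^{-3/2}e^{-|v-\varpi\times x|^2/2},\qquad \mu_\varpi(x,v)=(2\pi)^{-3/2}e^{-|v|^2/2+(\varpi\times x)\cdot v}=e^{|\varpi\times x|^2/2}m_\varpi(x,v),$$ $$L^\varpi f=-\frac1{\sqrt{m_\varpi}}\big\{Q(\mu_\varpi,\sqrt{m_\varpi}f)+Q(\sqrt{m_\varpi}f,\mu_\varpi)\big\}.$$ For each $x$ let $P_\varpi$ be the orthogonal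 projection in $L^2(\mathbb R^3_v)$ onto $\mathrm{span}\{\sqrt{\mu_\varpi},\,v_1\sqrt{\mu_\varpi},\,v_2\sqrt{\mu_\varpi},\,v_3\sqrt{\mu_\varpi},\,|v|^2\sqrt{\mu_\varpi}\}$. For an open set $\Omega\subset\mathbb R^3$ write $(f,g)_{L^2_{x,v}}=\int_{\Omega\times\mathbb R^3}fg\,dx\,dv$ and $$\|g\|_{\nu_\varpi}^2=\int_{\mathbb R^3}g(v)^2(1+|v-\varpi\times x|^2)^{\gamma/2}dv\quad\text{or}\quad \|g\|_{\nu_\varpi}^2=\int_{\Omega\times\mathbb R^3}g(x,v)^2(1+|v-\varpi\times x|^2)^{\gamma/2}dx\,dv$$ for functions $g$ of $v$ (at a given $x$) or of $(x,v)$ respectively. **Lemma (positivity of $L^\varpi$).** There is a constant $\delta_0>0$, depending only on $\gamma$ and $q_0$ (in particular independent of $x$, $\varpi$ and $\Omega$), such that for every bounded open set $\Omega\subset\mathbb R^3$, every $\varpi\in\mathbb R^3$ and every measurable $f:\Omega\times\mathbb R^3\to\mathbb R$ with $\|f\|_{\nu_\varpi}<\infty$, the function $(L^\varpi f)f$ is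 integrable on $\Omega\times\mathbb R^3$, the two quantities on the right below are finite, and $$(L^\varpi f,f)_{L^2_{x,v}}\;\ge\;\delta_0\int_{\Omega}e^{|\varpi\times x|^2/2}\,\|(I-P_\varpi)f(x,\cdot)\|_{\nu_\varpi}^2\,dx\;\ge\;\delta_0\,\|(I-P_\varpi)f\|_{\nu_\varpi}^2 .$$ -/

import Mathlib

open MeasureTheory Set

noncomputable section

namespace RotBoltzmann

/-- Euclidean space `ℝ³`. -/
abbrev V3 : Type := EuclideanSpace ℝ (Fin 3)

/-- The unit sphere `𝕊²`. -/
abbrev S2 : Type := Metric.sphere (0 : V3) 1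

/-- The surface measure `dω` on `𝕊²` (total mass `4π`). -/
def sphereMeasure : Measure S2 := (volume : Measure V3).toSphere

/-- The vector product `a × b` in `ℝ³`. -/
def cross (a b : V3) : V3 := WithLp.toLp 2 (crossProduct a.ofLp b.ofLp)

/-- Post-collisional velocity `u' = u + [(v - u) · ω] ω`. -/
def postU (u v : V3) (ω : S2) : V3 := u + inner ℝ (v - u) (ω : V3) • (ω : V3)

/-- Post-collisional velocity `v' = v - [(v - u) · ω] ω`. -/
def postV (u v : V3) (ω : S2) : V3 := v - inner ℝ (v - u) (ω : V3) • (ω : V3)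

/-- The collision kernel `B(v - u, ω) = |v - u|^γ q₀(θ)`, where `θ ∈ [0, π]` is the angle between
`u - v` and `ω`, i.e. `cos θ = (u - v) · ω / |u - v|`. -/
def collisionKernel (γ : ℝ) (q₀ : ℝ → ℝ) (u v : V3) (ω : S2) : ℝ :=
  ‖v - u‖ ^ γ * q₀ (InnerProductGeometry.angle (u - v) (ω : V3))

/-- The Boltzmann collision operator
`Q(F₁, F₂)(v) = ∫∫ B(v - u, ω) {F₁(v') F₂(u') - F₁(v) F₂(u)} dω du`. -/
def Q (γ : ℝ) (q₀ : ℝ → ℝ) (F₁ F₂ : V3 → ℝ) (v : V3) : ℝ :=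
  ∫ p : V3 × S2, collisionKernel γ q₀ p.1 v p.2 *
      (F₁ (postV p.1 v p.2) * F₂ (postU p.1 v p.2) - F₁ v * F₂ p.1)
    ∂((volume : Measure V3).prod sphereMeasure)

/-- The Grad cut-off assumption `0 ≤ q₀(θ) ≤ C |cos θ|` for a measurable angular cross section
which is not almost everywhere zero (so that there are collisions at all). -/
structure GradCutoff (q₀ : ℝ → ℝ) : Prop where
  measurable : Measurable q₀
  nonneg : ∀ θ ∈ Icc 0 Real.pi, 0 ≤ q₀ θ
  le_cos : ∃ C : ℝ, ∀ θ ∈ Icc 0 Real.pi, q₀ θ ≤ C * |Real.cos θ|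
  nontrivial : 0 < volume {θ : ℝ | θ ∈ Icc 0 Real.pi ∧ q₀ θ ≠ 0}

/-- The rotational local Maxwellian
`μ_ϖ(x, v) = (2π)^{-3/2} exp(-|v|²/2 + (ϖ × x) · v)`. -/
def muMaxwellian (ϖ x v : V3) : ℝ :=
  (1 / Real.sqrt ((2 * Real.pi) ^ 3)) * Real.exp (-(‖v‖ ^ 2 / 2) + inner ℝ (cross ϖ x) v)

/-- The shifted Maxwellian `m_ϖ(x, v) = (2π)^{-3/2} exp(-|v - ϖ × x|²/2)`. -/
def mMaxwellian (ϖ x v : V3) : ℝ :=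
  (1 / Real.sqrt ((2 * Real.pi) ^ 3)) * Real.exp (-(‖v - cross ϖ x‖ ^ 2 / 2))

/-- The two Maxwellians are related by `μ_ϖ = e^{|ϖ × x|²/2} m_ϖ`. -/
theorem muMaxwellian_eq (ϖ x v : V3) :
    muMaxwellian ϖ x v = Real.exp (‖cross ϖ x‖ ^ 2 / 2) * mMaxwellian ϖ x v := by
  unfold muMaxwellian mMaxwellian
  rw [mul_left_comm, ← Real.exp_add, norm_sub_sq_real, real_inner_comm]
  congr 2
  ring

/-- The linearized operator
`L^ϖ f = -(1/√m_ϖ) {Q(μ_ϖ, √m_ϖ f) + Q(√m_ϖ f, μ_ϖ)}`, acting in `v` at each fixed `x`. -/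
def linOp (γ : ℝ) (q₀ : ℝ → ℝ) (ϖ : V3) (f : V3 → V3 → ℝ) (x v : V3) : ℝ :=
  -(1 / Real.sqrt (mMaxwellian ϖ x v)) *
    (Q γ q₀ (muMaxwellian ϖ x) (fun w => Real.sqrt (mMaxwellian ϖ x w) * f x w) v +
      Q γ q₀ (fun w => Real.sqrt (mMaxwellian ϖ x w) * f x w) (muMaxwellian ϖ x) v)

/-- For each fixed `x`, the `L²(ℝ³_v)`-orthonormal basis
`√m`, `w₁√m`, `w₂√m`, `w₃√m`, `((|w|² - 3)/√6) √m`, with `m = m_ϖ(x, v)` and `w = v - ϖ × x`,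
of the five-dimensional space
`span {√μ_ϖ, v₁√μ_ϖ, v₂√μ_ϖ, v₃√μ_ϖ, |v|²√μ_ϖ}`.
(For a standard Gaussian `w` in `ℝ³`, `|w|²` has mean `3` and variance `6`; for fixed `x`,
`√μ_ϖ` is a constant multiple of `√m_ϖ` and `w` is a translate of `v`.) -/
def macroBasis (ϖ x : V3) (i : Fin 5) (v : V3) : ℝ :=
  (![1, (v - cross ϖ x) 0, (v - cross ϖ x) 1, (v - cross ϖ x) 2,
      (‖v - cross ϖ x‖ ^ 2 - 3) / Real.sqrt 6] : Fin 5 → ℝ) i *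
    Real.sqrt (mMaxwellian ϖ x v)

/-- The macroscopic projection `P_ϖ`: for each `x`, the orthogonal projection in `L²(ℝ³_v)` onto
`span {√μ_ϖ, v√μ_ϖ, |v|²√μ_ϖ}`. -/
def macroProj (ϖ : V3) (f : V3 → V3 → ℝ) (x v : V3) : ℝ :=
  ∑ i : Fin 5, (∫ w : V3, f x w * macroBasis ϖ x i w) * macroBasis ϖ x i v

/-- The microscopic part `(I - P_ϖ) f`. -/
def microPart (ϖ : V3) (f : V3 → V3 → ℝ) (x v : V3) : ℝ :=
  f x v - macroProj ϖ f x v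

/-- The weight `(1 + |v - ϖ × x|²)^{γ/2}` comparable with the collision frequency. -/
def nuWeight (γ : ℝ) (ϖ x v : V3) : ℝ := (1 + ‖v - cross ϖ x‖ ^ 2) ^ (γ / 2)

/-- The squared weighted norm in `v` at the point `x`:
`‖g‖²_{ν_ϖ} = ∫ g(v)² (1 + |v - ϖ × x|²)^{γ/2} dv`. -/
def nuNormSqV (γ : ℝ) (ϖ x : V3) (g : V3 → ℝ) : ℝ :=
  ∫ v : V3, g v ^ 2 * nuWeight γ ϖ x v

/-- Integrability on the phase space `Ω × ℝ³`. -/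
def IntegrableXV (Ω : Set V3) (h : V3 → V3 → ℝ) : Prop :=
  IntegrableOn (fun p : V3 × V3 => h p.1 p.2) (Ω ×ˢ univ) volume

/-- The squared weighted norm in `(x, v)`:
`‖g‖²_{ν_ϖ} = ∫_{Ω × ℝ³} g(x, v)² (1 + |v - ϖ × x|²)^{γ/2} dx dv`. -/
def nuNormSqXV (γ : ℝ) (ϖ : V3) (Ω : Set V3) (g : V3 → V3 → ℝ) : ℝ :=
  ∫ p : V3 × V3 in Ω ×ˢ univ, g p.1 p.2 ^ 2 * nuWeight γ ϖ p.1 p.2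

/-- The inner product `(f, g)_{L²_{x,v}} = ∫_{Ω × ℝ³} f g dx dv`. -/
def innerXV (Ω : Set V3) (f g : V3 → V3 → ℝ) : ℝ :=
  ∫ p : V3 × V3 in Ω ×ˢ univ, f p.1 p.2 * g p.1 p.2

end RotBoltzmann

end

open RotBoltzmann

noncomputable section

namespace RotBoltzmann

open scoped Pointwise

/-! ### The surface measure of the unit sphere -/

/-! At a fixed position `x`, translate velocities by `ϖ × x` and write `f = √M h` with `M` the
standard Gaussian. The collision rule commutes with translations and `μ_ϖ` is `e^{|ϖ × x|²/2}` times
the shifted Gaussian, so `L^ϖ` becomes `e^{|ϖ × x|²/2}` times the classical linearized operator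
(`linOp_cross_add`), and `I - P_ϖ` becomes the projection off the collision invariants
(`microPart_cross_add`). Uniformity in `x` and `ϖ` is then automatic. The quadratic form of the
classical operator is the Dirichlet form `¼ ∫ B M M_* (h(v') + h(u') - h(v) - h(u))²`
(`CollInvariant.integral_weight_collDiff_mul`), which does not see the invariants. Its coercivity is
proved constructively, in three steps.

(1) Kernel without the factor `|v - u|^γ`, with angular part `ρ` proportional to `q₀` and of total
mass one. For a symmetric averaging operator `T` (`AngularDensity.op`) the Dirichlet form is `4(‖h‖²
- ⟨Th, h⟩)`. On exponentials `e_k = exp(k·v - |k|²/2)` a reflection exchanging the directions of `u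
- v` and `k` gives a Bobylev formula: `T e_k` is the `ρ`-average over `ω` of `e_{k⊥} + e_{k∥} - 1`,
where `k⊥`, `k∥` are the parts of `k` orthogonal to and along `ω`. By iteration, the matrix elements
of `Tⁿ` between microscopic parts of exponentials are `½(1 - 3κ)ⁿ` times a traceless quadratic form
plus a cubic remainder of size `(1 - κ)ⁿ`, where `κ ≤ 1/4` is the mean of `cos²θ sin²θ`. So `‖Tⁿ h‖
≤ C_h (1 - κ)ⁿ` on the microscopic parts of a dense span, and log-convexity of `n ↦ ‖Tⁿ h‖` improves
this to `‖T h‖ ≤ (1 - κ)‖h‖`. There the constant `C_h` has disappeared, so the bound passes to the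
closure: a gap `4κ` (`AngularDensity.spectral_gap`).

(2) Factor `|v - u|^γ`. It is at least `ε^γ` off the close pairs `|v - u| < ε`, and these carry so
little Gaussian mass that their share of the form is absorbed
(`AngularDensity.exists_coercive_hard`).

(3) Weighted norm. For `|u| ≤ 1` the kernel dominates `(1 + |v|²)^{γ/2} - 2`. Solving the increment
for `h(v)`, the values at `u`, `v'`, `u'` cost only unweighted `L²` norms, thanks to a factor `cos²θ
sin²θ` in the weight, and these are controlled by (2) (`AngularDensity.exists_coercive_weight`).

Integration over `Ω` ends the proof: the exponential factor is bounded on a bounded set, which gives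
integrability, and is at least one, which gives the second inequality. -/

/-- The action of a linear isometry on the unit sphere. -/
def sphereMap (R : V3 ≃ₗᵢ[ℝ] V3) (ω : S2) : S2 :=
  ⟨R ω, by simp⟩

theorem coe_sphereMap (R : V3 ≃ₗᵢ[ℝ] V3) (ω : S2) : (sphereMap R ω : V3) = R ω := rfl

theorem continuous_sphereMap (R : V3 ≃ₗᵢ[ℝ] V3) : Continuous (sphereMap R) := by
  unfold sphereMap
  exact Continuous.subtype_mk (R.continuous.comp continuous_subtype_val) _

instance : IsFiniteMeasure sphereMeasure := by unfold sphereMeasure; infer_instance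

/-- `toSphere` measures a set by the volume of the cone over it, and a linear isometry commutes with
forming cones and preserves volume. -/
theorem measurePreserving_sphereMap (R : V3 ≃ₗᵢ[ℝ] V3) :
    MeasurePreserving (sphereMap R) sphereMeasure sphereMeasure := by
  refine ⟨(continuous_sphereMap R).measurable, ?_⟩
  ext s hs
  rw [Measure.map_apply (continuous_sphereMap R).measurable hs]
  unfold sphereMeasure
  rw [Measure.toSphere_apply' _ hs,
    Measure.toSphere_apply' _ ((continuous_sphereMap R).measurable hs)]
  congr 1
  have h : Ioo (0 : ℝ) 1 • ((fun x : S2 => (x : V3)) '' (sphereMap R ⁻¹' s)) =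
      R ⁻¹' (Ioo (0 : ℝ) 1 • ((fun x : S2 => (x : V3)) '' s)) := by
    ext x
    simp only [Set.mem_smul, mem_image, mem_preimage]
    constructor
    · rintro ⟨r, hr, _, ⟨w, hw, rfl⟩, rfl⟩
      exact ⟨r, hr, _, ⟨_, hw, rfl⟩, by simp [coe_sphereMap]⟩
    · rintro ⟨r, hr, _, ⟨w, hw, rfl⟩, hx⟩
      refine ⟨r, hr, _, ⟨sphereMap R.symm w, ?_, rfl⟩, ?_⟩
      · have : sphereMap R (sphereMap R.symm w) = w := by
          ext1; simp [coe_sphereMap]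
        rwa [this]
      · rw [coe_sphereMap, ← map_smul, hx]; simp
  rw [h]
  exact R.measurePreserving.measure_preimage_emb R.toHomeomorph.measurableEmbedding _

theorem integral_sphereMap (R : V3 ≃ₗᵢ[ℝ] V3) (F : S2 → ℝ) :
    ∫ ω, F (sphereMap R ω) ∂sphereMeasure = ∫ ω, F ω ∂sphereMeasure := by
  have h1 : Function.Injective (sphereMap R) := fun a b h => by
    have := congrArg (Subtype.val) h
    simp only [coe_sphereMap] at this
    exact Subtype.ext (R.injective this)
  have h2 : MeasurableEmbedding (sphereMap R) :=
    (continuous_sphereMap R).measurableEmbedding h1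
  exact (measurePreserving_sphereMap R).integral_comp h2 F

theorem measurePreserving_neg_sphere :
    MeasurePreserving (fun ω : S2 => -ω) sphereMeasure sphereMeasure := by
  have : (fun ω : S2 => -ω) = sphereMap (LinearIsometryEquiv.neg ℝ) := by
    ext1 ω; ext1; simp [coe_sphereMap]
  rw [this]; exact measurePreserving_sphereMap _

/-- A linear isometry exchanging two vectors of the same length, and fixing all vectors orthogonal
to both. -/
theorem exists_swap_isometry {a b : V3} (h : ‖a‖ = ‖b‖) :
    ∃ R : V3 ≃ₗᵢ[ℝ] V3, R a = b ∧ R b = a ∧ (∀ x y, inner ℝ (R x) y = inner ℝ x (R y)) ∧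
      ∀ x, inner ℝ x a = 0 → inner ℝ x b = 0 → R x = x := by
  refine ⟨(ℝ ∙ (a - b))ᗮ.reflection, Submodule.reflection_sub h, ?_, ?_, ?_⟩
  · have := congrArg (ℝ ∙ (a - b))ᗮ.reflection (Submodule.reflection_sub h)
    rw [Submodule.reflection_reflection] at this
    exact this.symm
  · intro x y
    have := LinearIsometryEquiv.inner_map_map (ℝ ∙ (a - b))ᗮ.reflection x
      ((ℝ ∙ (a - b))ᗮ.reflection y)
    rwa [Submodule.reflection_reflection] at this
  · intro x ha hb
    rw [Submodule.reflection_eq_self_iff, Submodule.mem_orthogonal_singleton_iff_inner_left,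
      inner_sub_right, ha, hb, sub_zero]

theorem measurable_angle {α : Type*} [MeasurableSpace α] {f g : α → V3} (hf : Measurable f)
    (hg : Measurable g) : Measurable (fun x => InnerProductGeometry.angle (f x) (g x)) := by
  unfold InnerProductGeometry.angle
  exact Real.measurable_arccos.comp ((hf.inner hg).div (hf.norm.mul hg.norm))

theorem angle_mem_Icc (x y : V3) : InnerProductGeometry.angle x y ∈ Icc 0 Real.pi :=
  ⟨InnerProductGeometry.angle_nonneg _ _, InnerProductGeometry.angle_le_pi _ _⟩

theorem angle_isometry (R : V3 ≃ₗᵢ[ℝ] V3) (x y : V3) :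
    InnerProductGeometry.angle (R x) (R y) = InnerProductGeometry.angle x y :=
  R.toLinearIsometry.angle_map x y

/-- The integral of a zonal function over the sphere does not depend on the axis. -/
theorem integral_angle_eq (φ : ℝ → ℝ) {a b : V3} (ha : a ≠ 0) (hb : b ≠ 0) :
    ∫ ω : S2, φ (InnerProductGeometry.angle a ω) ∂sphereMeasure =
      ∫ ω : S2, φ (InnerProductGeometry.angle b ω) ∂sphereMeasure := by
  have ha' : 0 < ‖a‖ := norm_pos_iff.2 ha
  have hb' : 0 < ‖b‖ := norm_pos_iff.2 hb
  -- Angles ignore positive scaling, so both axes are brought to the common length `‖a‖‖b‖` before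
  -- being exchanged.
  obtain ⟨R, h1, -, -, -⟩ := exists_swap_isometry (a := ‖b‖ • a) (b := ‖a‖ • b)
    (by simp [norm_smul, mul_comm])
  rw [← integral_sphereMap R (fun ω => φ (InnerProductGeometry.angle b ω))]
  congr 1; ext ω
  rw [coe_sphereMap, ← InnerProductGeometry.angle_smul_left_of_pos b (R ω) ha', ← h1,
    angle_isometry, InnerProductGeometry.angle_smul_left_of_pos _ _ hb']

/-- Exchanging the direction of the relative velocity with that of the frequency variable. -/
theorem integral_angle_swap (φ : ℝ → ℝ) (F : ℝ → ℝ) {a b : V3} (ha : a ≠ 0) (hb : b ≠ 0) :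
    ∫ ω : S2, φ (InnerProductGeometry.angle a ω) * F (inner ℝ a (ω : V3) * inner ℝ b (ω : V3))
        ∂sphereMeasure =
      ∫ ω : S2, φ (InnerProductGeometry.angle b ω) * F (inner ℝ a (ω : V3) * inner ℝ b (ω : V3))
        ∂sphereMeasure := by
  have ha' : 0 < ‖a‖ := norm_pos_iff.2 ha
  have hb' : 0 < ‖b‖ := norm_pos_iff.2 hb
  -- The reflection exchanging the rescaled vectors exchanges the two angles but leaves the product
  -- `(a·ω)(b·ω)` unchanged.
  obtain ⟨R, h1, h2, hs, -⟩ := exists_swap_isometry (a := ‖b‖ • a) (b := ‖a‖ • b)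
    (by simp [norm_smul, mul_comm])
  rw [← integral_sphereMap R (fun ω => φ (InnerProductGeometry.angle b ω) *
    F (inner ℝ a (ω : V3) * inner ℝ b (ω : V3)))]
  congr 1; ext ω
  rw [coe_sphereMap]
  congr 2
  · rw [← InnerProductGeometry.angle_smul_left_of_pos b (R ω) ha', ← h1,
      angle_isometry, InnerProductGeometry.angle_smul_left_of_pos _ _ hb']
  · have e1 : ‖b‖ * inner ℝ a (R ω) = ‖a‖ * inner ℝ b (ω : V3) := by
      rw [← real_inner_smul_left, ← real_inner_smul_left, ← hs, h1]
    have e2 : ‖a‖ * inner ℝ b (R ω) = ‖b‖ * inner ℝ a (ω : V3) := by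
      rw [← real_inner_smul_left, ← real_inner_smul_left, ← hs, h2]
    have : (‖a‖ * ‖b‖) * (inner ℝ a (R ω) * inner ℝ b (R ω)) =
        (‖a‖ * ‖b‖) * (inner ℝ a (ω : V3) * inner ℝ b (ω : V3)) := by
      linear_combination (‖a‖ * inner ℝ b (R ω)) * e1 + (‖a‖ * inner ℝ b (ω : V3)) * e2
    exact (mul_left_cancel₀ (by positivity) this).symm

/-! ### Zonal null sets -/

/-- This function is arccot, written so that the argument of `arccos` stays strictly inside `(-1,
1)`. It serves to carry null sets of a line to null sets of angles. -/
theorem differentiable_arccos_cot :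
    Differentiable ℝ (fun t : ℝ => Real.arccos (t / Real.sqrt (1 + t ^ 2))) := by
  intro t
  have h : 0 < 1 + t ^ 2 := by positivity
  have hs := Real.sqrt_pos.2 h
  have hlt : |t / Real.sqrt (1 + t ^ 2)| < 1 := by
    rw [abs_div, abs_of_pos hs, div_lt_one hs]
    apply Real.lt_sqrt_of_sq_lt
    rw [sq_abs]; linarith
  rw [abs_lt] at hlt
  refine DifferentiableAt.comp (g := Real.arccos) t (Real.differentiableAt_arccos.2 ⟨by linarith, by linarith⟩) ?_
  refine DifferentiableAt.div (by fun_prop) ?_ hs.ne'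
  exact DifferentiableAt.sqrt (by fun_prop) h.ne'

/-- The infinite cone is covered by countably many dilates of the truncated cone that defines the
surface measure. -/
theorem volume_cone_eq_zero {S : Set S2} (hS : MeasurableSet S) (h : sphereMeasure S = 0) :
    volume (Ioi (0 : ℝ) • ((fun x : S2 => (x : V3)) '' S)) = 0 := by
  unfold sphereMeasure at h
  rw [Measure.toSphere_apply' _ hS, mul_eq_zero] at h
  have h0 : volume (Ioo (0 : ℝ) 1 • ((fun x : S2 => (x : V3)) '' S)) = 0 := by
    rcases h with h | h
    · simp at h
    · exact h
  have hsub : Ioi (0 : ℝ) • ((fun x : S2 => (x : V3)) '' S) ⊆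
      ⋃ n : ℕ, ((n : ℝ) + 1) • (Ioo (0 : ℝ) 1 • ((fun x : S2 => (x : V3)) '' S)) := by
    intro x hx
    obtain ⟨r, hr, y, hy, rfl⟩ := Set.mem_smul.1 hx
    obtain ⟨n, hn⟩ := exists_nat_gt r
    have hr' : (0 : ℝ) < r := hr
    have hn1 : (0 : ℝ) < (n : ℝ) + 1 := by positivity
    refine mem_iUnion.2 ⟨n, ?_⟩
    refine Set.mem_smul_set.2 ⟨(r / ((n : ℝ) + 1)) • y, Set.smul_mem_smul ⟨by positivity, ?_⟩ hy, ?_⟩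
    · rw [div_lt_one hn1]; linarith
    · rw [smul_smul, mul_div_cancel₀ _ hn1.ne']
  refine measure_mono_null hsub (measure_iUnion_null fun n => ?_)
  rw [Measure.addHaar_smul, h0, mul_zero]

/-- If almost no direction makes an angle in `N` with a given axis, then `N` is a null set. -/
theorem volume_eq_zero_of_angle {N : Set ℝ} (hN : MeasurableSet N) (hN' : N ⊆ Ioo 0 Real.pi)
    {a : V3} (ha : ‖a‖ = 1)
    (h : sphereMeasure {ω : S2 | InnerProductGeometry.angle a ω ∈ N} = 0) :
    volume N = 0 := by
  have hang : Measurable (fun y : V3 => InnerProductGeometry.angle a y) :=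
    measurable_angle measurable_const measurable_id
  have hS : MeasurableSet {ω : S2 | InnerProductGeometry.angle a ω ∈ N} :=
    (measurable_angle measurable_const measurable_subtype_coe) hN
  have hcone := volume_cone_eq_zero hS h
  obtain ⟨C, hC⟩ : ∃ C : Set V3, C = {y | InnerProductGeometry.angle a y ∉ N} := ⟨_, rfl⟩
  have hCm : MeasurableSet C := hC ▸ (hang hN).compl
  have hCae : ∀ᵐ y : V3, y ∈ C := by
    rw [ae_iff]
    refine measure_mono_null ?_ (measure_union_null hcone (measure_singleton (0 : V3)))
    intro y hy
    simp only [hC, mem_ofPred_eq, not_not] at hy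
    by_cases hy0 : y = 0
    · right; exact hy0
    left
    have hyp := norm_pos_iff.2 hy0
    refine Set.mem_smul.2 ⟨‖y‖, hyp, (‖y‖⁻¹) • y, ⟨⟨‖y‖⁻¹ • y, by simp [norm_smul, hyp.ne']⟩, ?_, rfl⟩,
      by rw [smul_smul, mul_inv_cancel₀ hyp.ne', one_smul]⟩
    simp only [mem_ofPred_eq]
    rwa [InnerProductGeometry.angle_smul_right_of_pos _ _ (inv_pos.2 hyp)]
  -- Fubini along the lines parallel to `a`: almost every such line meets the cone of bad angles in
  -- a null set. A line off the axis is then selected.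
  have hline := (ae_ae_add_linearMap_mem_iff (LinearMap.toSpanSingleton ℝ V3 a)
    (volume : Measure ℝ) (volume : Measure V3) hCm).2 hCae
  have hproper : ∀ᵐ y : V3, y ∉ (ℝ ∙ a : Submodule ℝ V3) := by
    rw [ae_iff]
    simp only [not_not]
    refine Measure.addHaar_submodule (volume : Measure V3) (ℝ ∙ a : Submodule ℝ V3) ?_
    intro htop
    have h3 := finrank_span_singleton (K := ℝ) (v := a) (by rintro rfl; simp at ha)
    rw [htop] at h3
    simp at h3
  obtain ⟨y, hy1, hy2⟩ := (hline.and hproper).exists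
  -- the component of `y` orthogonal to the axis
  set c : ℝ := inner ℝ a y with hc
  set z : V3 := y - c • a with hz
  have haz : inner ℝ a z = 0 := by
    rw [hz, inner_sub_right, inner_smul_right, real_inner_self_eq_norm_sq, ha]; simp [hc]
  have hz0 : z ≠ 0 := by
    intro h0
    apply hy2
    rw [Submodule.mem_span_singleton]
    exact ⟨c, (sub_eq_zero.1 h0).symm⟩
  have hzp := norm_pos_iff.2 hz0
  set g : ℝ → ℝ := fun t => Real.arccos (t / Real.sqrt (1 + t ^ 2)) with hg
  -- On the chosen line, with height measured in units of `‖z‖`, the angle with `a` is the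
  -- arccotangent of the height.
  have hangle : ∀ t : ℝ, InnerProductGeometry.angle a (y + (‖z‖ * t - c) • a) = g t := by
    intro t
    have e : y + (‖z‖ * t - c) • a = z + (‖z‖ * t) • a := by rw [hz]; module
    have hn : ‖z + (‖z‖ * t) • a‖ = ‖z‖ * Real.sqrt (1 + t ^ 2) := by
      have : ‖z + (‖z‖ * t) • a‖ ^ 2 = ‖z‖ ^ 2 * (1 + t ^ 2) := by
        rw [norm_add_sq_real, inner_smul_right, real_inner_comm, haz, norm_smul, ha]
        simp [mul_pow]; ring
      rw [← Real.sqrt_sq (norm_nonneg (z + _)), this, Real.sqrt_mul (by positivity),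
        Real.sqrt_sq hzp.le]
    rw [e, InnerProductGeometry.angle, hn, inner_add_right, haz, inner_smul_right,
      real_inner_self_eq_norm_sq, ha, hg]
    congr 1
    rw [div_eq_div_iff (by positivity) (by positivity)]
    ring
  have hnull : volume {t : ℝ | g t ∈ N} = 0 := by
    have h1 : volume {s : ℝ | ¬ (y + s • a ∈ C)} = 0 := by
      have := hy1
      rw [ae_iff] at this
      exact this
    have h2 : {t : ℝ | g t ∈ N} = (fun t => ‖z‖ * t) ⁻¹' ((fun t => t + -c) ⁻¹'
        {s : ℝ | ¬ (y + s • a ∈ C)}) := by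
      ext t
      simp only [mem_ofPred_eq, mem_preimage, hC, not_not]
      rw [← sub_eq_add_neg, hangle]
    rw [h2, Real.volume_preimage_mul_left hzp.ne', measure_preimage_add_right, h1, mul_zero]
  -- Every angle of `N` is attained, at height `cot θ`; a differentiable image of a null set is
  -- null.
  have himg : N ⊆ g '' {t : ℝ | g t ∈ N} := by
    intro θ hθ
    obtain ⟨h0, hpi⟩ := hN' hθ
    have hsin := Real.sin_pos_of_pos_of_lt_pi h0 hpi
    have : g (Real.cos θ / Real.sin θ) = θ := by
      have hs : Real.sqrt (1 + (Real.cos θ / Real.sin θ) ^ 2) = 1 / Real.sin θ := by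
        rw [← Real.sqrt_sq (one_div_pos.2 hsin).le]
        congr 1
        field_simp
        nlinarith [Real.sin_sq_add_cos_sq θ]
      simp only [hg]
      rw [hs]
      have : Real.cos θ / Real.sin θ / (1 / Real.sin θ) = Real.cos θ := by field_simp
      rw [this, Real.arccos_cos h0.le hpi.le]
    exact ⟨_, by rw [mem_ofPred_eq, this]; exact hθ, this⟩
  exact measure_mono_null himg
    (addHaar_image_eq_zero_of_differentiableOn_of_addHaar_eq_zero _
      differentiable_arccos_cot.differentiableOn hnull)

/-! ### The standard Gaussian measure on `ℝ³` -/

/-- The density of the standard Gaussian. -/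
def gaussDensity (v : V3) : ℝ :=
  (1 / Real.sqrt ((2 * Real.pi) ^ 3)) * Real.exp (-(‖v‖ ^ 2 / 2))

theorem gaussDensity_pos (v : V3) : 0 < gaussDensity v := by
  unfold gaussDensity; positivity

theorem continuous_gaussDensity : Continuous gaussDensity := by
  unfold gaussDensity; fun_prop

/-- The standard Gaussian measure, with its explicit density. -/
def gauss : Measure V3 := volume.withDensity (fun v => ENNReal.ofReal (gaussDensity v))

theorem integral_gauss (F : V3 → ℝ) : ∫ v, F v ∂gauss = ∫ v, gaussDensity v * F v := by
  unfold gauss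
  rw [integral_withDensity_eq_integral_toReal_smul
    (continuous_gaussDensity.measurable.ennreal_ofReal) (by simp)]
  congr 1; ext v
  rw [ENNReal.toReal_ofReal (gaussDensity_pos v).le, smul_eq_mul]

theorem integrable_gauss_iff {F : V3 → ℝ} :
    Integrable F gauss ↔ Integrable (fun v => gaussDensity v * F v) := by
  unfold gauss
  rw [integrable_withDensity_iff_integrable_smul' (continuous_gaussDensity.measurable.ennreal_ofReal)
    (by simp)]
  refine integrable_congr (Filter.Eventually.of_forall fun v => ?_)
  simp only
  rw [ENNReal.toReal_ofReal (gaussDensity_pos v).le, smul_eq_mul]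

theorem integrable_exp_neg_sq {b : ℝ} (hb : 0 < b) :
    Integrable (fun v : V3 => Real.exp (-b * ‖v‖ ^ 2)) := by
  have h := GaussianFourier.integrable_cexp_neg_mul_sq_norm_add (V := V3) (b := (b : ℂ)) (by simpa)
    0 0
  have := h.norm
  refine this.congr (Filter.Eventually.of_forall fun v => ?_)
  simp only [Complex.norm_exp]
  congr 1
  simp [← Complex.ofReal_pow, ← Complex.ofReal_mul]

theorem integrable_exp_norm (c : ℝ) : Integrable (fun v : V3 => Real.exp (c * ‖v‖)) gauss := by
  rw [integrable_gauss_iff]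
  refine Integrable.mono' ((integrable_exp_neg_sq (b := 1 / 4) (by norm_num)).const_mul
    ((1 / Real.sqrt ((2 * Real.pi) ^ 3)) * Real.exp (c ^ 2))) ?_ ?_
  · exact (continuous_gaussDensity.mul (by fun_prop)).aestronglyMeasurable
  · refine Filter.Eventually.of_forall fun v => ?_
    rw [Real.norm_of_nonneg (mul_nonneg (gaussDensity_pos v).le (Real.exp_pos _).le)]
    unfold gaussDensity
    rw [mul_assoc, mul_assoc, ← Real.exp_add, ← Real.exp_add]
    refine mul_le_mul_of_nonneg_left (Real.exp_le_exp.2 ?_) (by positivity)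
    -- Completing the square: `c‖v‖ - ‖v‖²/2 ≤ c² - ‖v‖²/4`.
    nlinarith [sq_nonneg (‖v‖ / 2 - c)]

theorem integral_gaussDensity : ∫ v, gaussDensity v = 1 := by
  unfold gaussDensity
  rw [integral_const_mul]
  have h := GaussianFourier.integral_rexp_neg_mul_sq_norm (V := V3) (b := 1 / 2) (by norm_num)
  have h2 : ∀ v : V3, Real.exp (-(‖v‖ ^ 2 / 2)) = Real.exp (-(1 / 2) * ‖v‖ ^ 2) := fun v => by
    congr 1; ring
  simp_rw [h2]
  rw [h]
  have e : Real.pi / (1 / 2) = 2 * Real.pi := by ring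
  rw [e, finrank_euclideanSpace, Fintype.card_fin, Real.sqrt_eq_rpow, ← Real.rpow_natCast,
    ← Real.rpow_mul (by positivity)]
  have : (0 : ℝ) < (2 * Real.pi) ^ ((3 : ℕ) * (1 / 2) : ℝ) := by positivity
  rw [one_div, show ((3 : ℕ) / 2 : ℝ) = (3 : ℕ) * (1 / 2) by ring, inv_mul_cancel₀ this.ne']

instance : IsFiniteMeasure gauss := by
  have := integrable_exp_norm 0
  simp only [zero_mul, Real.exp_zero] at this
  exact (integrable_const_iff_isFiniteMeasure one_ne_zero).1 this

instance : IsProbabilityMeasure gauss := by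
  have h := integral_gauss (fun _ => 1)
  simp only [integral_const, smul_eq_mul, mul_one, integral_gaussDensity, measureReal_def] at h
  exact ⟨(ENNReal.toReal_eq_one_iff _).1 h⟩

theorem gauss_absolutelyContinuous : gauss ≪ volume := withDensity_absolutelyContinuous _ _

theorem absolutelyContinuous_gauss : (volume : Measure V3) ≪ gauss :=
  withDensity_absolutelyContinuous' (continuous_gaussDensity.measurable.ennreal_ofReal).aemeasurable
    (Filter.Eventually.of_forall fun v => by simpa using gaussDensity_pos v)

theorem memLp_of_le_exp {F : V3 → ℝ} (hF : AEStronglyMeasurable F gauss) {C c : ℝ}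
    (h : ∀ v, |F v| ≤ C * Real.exp (c * ‖v‖)) : MemLp F 2 gauss := by
  rw [memLp_two_iff_integrable_sq hF]
  refine ((integrable_exp_norm (2 * c)).const_mul (C ^ 2)).mono' (hF.pow 2)
    (Filter.Eventually.of_forall fun v => ?_)
  rw [Real.norm_eq_abs, abs_pow]
  calc |F v| ^ 2 ≤ (C * Real.exp (c * ‖v‖)) ^ 2 := by gcongr; exact h v
    _ = C ^ 2 * Real.exp (2 * c * ‖v‖) := by
      rw [mul_pow, ← Real.exp_nat_mul]; push_cast; congr 2; ring

theorem measurePreserving_gauss_isometry (R : V3 ≃ₗᵢ[ℝ] V3) : MeasurePreserving R gauss gauss := by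
  refine ⟨R.continuous.measurable, ?_⟩
  ext s hs
  rw [Measure.map_apply R.continuous.measurable hs]
  unfold gauss
  rw [withDensity_apply _ hs, withDensity_apply _ (R.continuous.measurable hs),
    ← R.measurePreserving.setLIntegral_comp_preimage hs
      (continuous_gaussDensity.measurable.ennreal_ofReal)]
  simp [gaussDensity]

theorem integral_gauss_isometry (R : V3 ≃ₗᵢ[ℝ] V3) (F : V3 → ℝ) :
    ∫ v, F (R v) ∂gauss = ∫ v, F v ∂gauss :=
  (measurePreserving_gauss_isometry R).integral_comp R.toHomeomorph.measurableEmbedding F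

theorem integral_gauss_odd {F : V3 → ℝ} (h : ∀ v, F (-v) = -F v) : ∫ v, F v ∂gauss = 0 := by
  have h1 := integral_gauss_isometry (LinearIsometryEquiv.neg ℝ) F
  simp only [LinearIsometryEquiv.coe_neg, h, integral_neg] at h1
  linarith

/-- The exponentials `exp (k · v - |k|² / 2)`. -/
def expFun (k v : V3) : ℝ := Real.exp (inner ℝ k v - ‖k‖ ^ 2 / 2)

/-- Cameron–Martin: completing the square shows that `expFun k` is the density of the Gaussian
centred at `k` with respect to `gauss`. -/
theorem integral_mul_expFun (F : V3 → ℝ) (k : V3) :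
    ∫ v, F v * expFun k v ∂gauss = ∫ v, F (v + k) ∂gauss := by
  rw [integral_gauss, integral_gauss, ← integral_add_right_eq_self _ k]
  congr 1; ext v
  unfold gaussDensity expFun
  rw [mul_comm (F (v + k)), ← mul_assoc, mul_assoc _ (Real.exp _) (Real.exp _), ← Real.exp_add]
  congr 4
  rw [norm_add_sq_real, inner_add_right, real_inner_self_eq_norm_sq, real_inner_comm]
  ring

theorem abs_expFun_le (k v : V3) : |expFun k v| ≤ 1 * Real.exp (‖k‖ * ‖v‖) := by
  unfold expFun
  rw [abs_of_pos (Real.exp_pos _), one_mul]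
  gcongr
  have := real_inner_le_norm k v
  nlinarith [sq_nonneg ‖k‖]

theorem continuous_expFun : Continuous (fun p : V3 × V3 => expFun p.1 p.2) := by
  unfold expFun; fun_prop

theorem memLp_expFun (k : V3) : MemLp (expFun k) 2 gauss :=
  memLp_of_le_exp (continuous_expFun.comp (Continuous.prodMk_right k)).aestronglyMeasurable
    (abs_expFun_le k)

theorem integral_expFun (k : V3) : ∫ v, expFun k v ∂gauss = 1 := by
  have := integral_mul_expFun (fun _ => 1) k
  simpa using this

theorem integral_expFun_mul_expFun (k l : V3) :
    ∫ v, expFun k v * expFun l v ∂gauss = Real.exp (inner ℝ k l) := by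
  rw [integral_mul_expFun]
  have : ∀ v, expFun k (v + l) = Real.exp (inner ℝ k l) * expFun k v := fun v => by
    unfold expFun
    rw [← Real.exp_add, inner_add_right]; congr 1; ring
  simp_rw [this]
  rw [integral_const_mul, integral_expFun, mul_one]

/-! ### Second and fourth moments -/

/-- Polar coordinates reduce the moments to Gamma integrals. The constant `K` need not be computed:
the case `p = 0` normalises it. -/
theorem integral_norm_rpow_gauss : ∃ K : ℝ, ∀ p : ℕ,
    ∫ v, ‖v‖ ^ p ∂gauss = K * ((2 : ℝ) ^ (((p : ℝ) + 3) / 2) * Real.Gamma (((p : ℝ) + 3) / 2)) := by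
  refine ⟨(Module.finrank ℝ V3 • volume.real (Metric.ball (0 : V3) 1)) *
    (1 / Real.sqrt ((2 * Real.pi) ^ 3)) * (1 / 2), fun p => ?_⟩
  rw [integral_gauss]
  have := integral_fun_norm_addHaar (volume : Measure V3)
    (fun r => (1 / Real.sqrt ((2 * Real.pi) ^ 3)) * Real.exp (-(r ^ 2 / 2)) * r ^ p)
  unfold gaussDensity
  rw [this]
  have h2 := integral_rpow_mul_exp_neg_mul_rpow (p := 2) (q := p + 2) (b := 1 / 2) (by norm_num)
    (by have : (0 : ℝ) ≤ p := by positivity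
        linarith) (by norm_num)
  have h3 : ∀ y : ℝ, y ^ (Module.finrank ℝ V3 - 1) • ((1 / Real.sqrt ((2 * Real.pi) ^ 3)) *
      Real.exp (-(y ^ 2 / 2)) * y ^ p) = (1 / Real.sqrt ((2 * Real.pi) ^ 3)) *
      (y ^ ((p : ℝ) + 2) * Real.exp (-(1 / 2) * y ^ (2 : ℝ))) := fun y => by
    rw [finrank_euclideanSpace, Fintype.card_fin, smul_eq_mul,
      show ((p : ℝ) + 2) = ((p + 2 : ℕ) : ℝ) by push_cast; ring, Real.rpow_natCast, Real.rpow_two,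
      show -(y ^ 2 / 2) = -(1 / 2) * y ^ 2 by ring]
    ring
  simp_rw [h3]
  rw [integral_const_mul, h2]
  have h4 : (1 / 2 : ℝ) ^ (-((p : ℝ) + 2 + 1) / 2) = 2 ^ (((p : ℝ) + 3) / 2) := by
    rw [one_div, Real.inv_rpow (by norm_num), ← Real.rpow_neg (by norm_num)]
    congr 1; ring
  rw [h4, show ((p : ℝ) + 2 + 1) / 2 = ((p : ℝ) + 3) / 2 by ring]
  simp only [nsmul_eq_mul, smul_eq_mul]
  ring

/-- The zeroth moment is one, so only the ratios matter, and `Γ(s + 1) = s Γ(s)` gives `3` and then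
`3 · 5`. -/
theorem integral_norm_sq_and_four :
    ∫ v, ‖v‖ ^ 2 ∂gauss = 3 ∧ ∫ v, ‖v‖ ^ 4 ∂gauss = 15 := by
  obtain ⟨K, hK⟩ := integral_norm_rpow_gauss
  have h0 := hK 0
  have h2 := hK 2
  have h4 := hK 4
  simp only [pow_zero, integral_const, smul_eq_mul, mul_one, probReal_univ, Nat.cast_zero,
    Nat.cast_ofNat] at h0 h2 h4
  have g5 : Real.Gamma ((2 + 3) / 2) = 3 / 2 * Real.Gamma ((0 + 3) / 2) := by
    rw [show ((2 : ℝ) + 3) / 2 = (0 + 3) / 2 + 1 by norm_num, Real.Gamma_add_one (by norm_num)]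
    norm_num
  have g7 : Real.Gamma ((4 + 3) / 2) = 5 / 2 * Real.Gamma ((2 + 3) / 2) := by
    rw [show ((4 : ℝ) + 3) / 2 = (2 + 3) / 2 + 1 by norm_num, Real.Gamma_add_one (by norm_num)]
    norm_num
  have p5 : (2 : ℝ) ^ ((2 + 3) / 2 : ℝ) = 2 * 2 ^ ((0 + 3) / 2 : ℝ) := by
    rw [show ((2 : ℝ) + 3) / 2 = (0 + 3) / 2 + 1 by norm_num, Real.rpow_add_one (by norm_num)]
    ring
  have p7 : (2 : ℝ) ^ ((4 + 3) / 2 : ℝ) = 2 * 2 ^ ((2 + 3) / 2 : ℝ) := by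
    rw [show ((4 : ℝ) + 3) / 2 = (2 + 3) / 2 + 1 by norm_num, Real.rpow_add_one (by norm_num)]
    ring
  rw [g5, p5] at h2
  rw [g7, p7, g5, p5] at h4
  constructor
  · rw [h2]; linear_combination (-3 : ℝ) * h0
  · rw [h4]; linear_combination (-15 : ℝ) * h0

/-- The standard basis vectors. -/
def stdVec (i : Fin 3) : V3 := EuclideanSpace.single i 1

theorem inner_stdVec (i : Fin 3) (v : V3) : inner ℝ v (stdVec i) = v i := by
  simp [stdVec, EuclideanSpace.inner_single_right]

theorem norm_stdVec (i : Fin 3) : ‖stdVec i‖ = 1 := by simp [stdVec]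

theorem inner_stdVec_of_ne {i j : Fin 3} (h : i ≠ j) : inner ℝ (stdVec i) (stdVec j) = 0 := by
  rw [inner_stdVec]; simp [stdVec, h.symm]

theorem norm_sq_eq (v : V3) : ‖v‖ ^ 2 = v 0 ^ 2 + v 1 ^ 2 + v 2 ^ 2 := by
  rw [EuclideanSpace.real_norm_sq_eq, Fin.sum_univ_three]

theorem abs_apply_le_norm (v : V3) (i : Fin 3) : |v i| ≤ ‖v‖ := by
  rw [← inner_stdVec]
  have := abs_real_inner_le_norm v (stdVec i)
  rwa [norm_stdVec, mul_one] at this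

/-- The reflection of the `i`-th axis preserves `gauss` and changes the sign of the integrand. -/
theorem integral_coord_mul_of_ne {i j : Fin 3} (h : i ≠ j) : ∫ v : V3, v i * v j ∂gauss = 0 := by
  obtain ⟨R, h1, -, hs, hf⟩ := exists_swap_isometry (a := stdVec i) (b := -stdVec i) (by simp)
  have hj : R (stdVec j) = stdVec j :=
    hf _ (inner_stdVec_of_ne h.symm) (by rw [inner_neg_right, inner_stdVec_of_ne h.symm, neg_zero])
  have := integral_gauss_isometry R (fun v => v i * v j)
  have e : ∀ v : V3, (R v) i * (R v) j = -(v i * v j) := fun v => by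
    rw [← inner_stdVec i, ← inner_stdVec j, hs, hs, h1, hj, inner_neg_right, inner_stdVec,
      inner_stdVec]
    ring
  simp_rw [e, integral_neg] at this
  linarith

theorem integrable_coord_sq (i : Fin 3) : Integrable (fun v : V3 => v i ^ 2) gauss := by
  have h : MemLp (fun v : V3 => v i) 2 gauss := by
    refine memLp_of_le_exp (C := 1) (c := 1) (by fun_prop) fun v => ?_
    have := Real.add_one_le_exp (1 * ‖v‖)
    linarith [abs_apply_le_norm v i]
  exact h.integrable_sq

/-- Reflections exchanging two axes make the three second moments equal, and they sum to `3`. -/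
theorem integral_coord_sq (i : Fin 3) : ∫ v : V3, v i ^ 2 ∂gauss = 1 := by
  have key : ∀ j, ∫ v : V3, v i ^ 2 ∂gauss = ∫ v : V3, v j ^ 2 ∂gauss := fun j => by
    obtain ⟨R, h1, -, hs, -⟩ := exists_swap_isometry (a := stdVec i) (b := stdVec j)
      (by simp [norm_stdVec])
    have := integral_gauss_isometry R (fun v => v i ^ 2)
    rw [← this]
    congr 1; ext v
    rw [← inner_stdVec i, hs, h1, inner_stdVec]
  have h3 := integral_norm_sq_and_four.1
  simp_rw [norm_sq_eq] at h3
  have hi : Integrable (fun v : V3 => v 0 ^ 2 + v 1 ^ 2) gauss :=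
    (integrable_coord_sq 0).add (integrable_coord_sq 1)
  rw [integral_add hi (integrable_coord_sq 2),
    integral_add (integrable_coord_sq 0) (integrable_coord_sq 1), ← key 0, ← key 1, ← key 2] at h3
  linarith

/-! ### Orthonormal collision invariants -/

/-- The collision invariants `1, v₁, v₂, v₃, (|v|² - 3)/√6`, orthonormal for the Gaussian. -/
def invariant (i : Fin 5) (v : V3) : ℝ :=
  (![1, v 0, v 1, v 2, (‖v‖ ^ 2 - 3) / Real.sqrt 6] : Fin 5 → ℝ) i

theorem continuous_invariant (i : Fin 5) : Continuous (invariant i) := by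
  unfold invariant
  fin_cases i <;> simp <;> fun_prop

theorem abs_invariant_le (i : Fin 5) (v : V3) : |invariant i v| ≤ 6 * Real.exp (1 * ‖v‖) := by
  have h0 := norm_nonneg v
  have hq := Real.quadratic_le_exp_of_nonneg h0
  have h1 := abs_apply_le_norm v
  have hs : (1 : ℝ) ≤ Real.sqrt 6 := Real.one_le_sqrt.2 (by norm_num)
  rw [one_mul]
  unfold invariant
  fin_cases i
  · simp; nlinarith
  · simp; nlinarith [h1 0, sq_nonneg ‖v‖]
  · simp; nlinarith [h1 1, sq_nonneg ‖v‖]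
  · simp; nlinarith [h1 2, sq_nonneg ‖v‖]
  · change |(‖v‖ ^ 2 - 3) / Real.sqrt 6| ≤ _
    rw [abs_div, abs_of_pos (by positivity : 0 < Real.sqrt 6)]
    refine (div_le_self (abs_nonneg _) hs).trans ?_
    rw [abs_le]; constructor <;> nlinarith [sq_nonneg ‖v‖]

theorem memLp_invariant (i : Fin 5) : MemLp (invariant i) 2 gauss :=
  memLp_of_le_exp (continuous_invariant i).aestronglyMeasurable (abs_invariant_le i)

theorem integrable_norm_pow (p : ℕ) : Integrable (fun v : V3 => ‖v‖ ^ p) gauss := by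
  refine ((integrable_exp_norm 1).const_mul (p.factorial : ℝ)).mono' (by fun_prop)
    (Filter.Eventually.of_forall fun v => ?_)
  rw [Real.norm_of_nonneg (by positivity), one_mul]
  have := Real.pow_div_factorial_le_exp ‖v‖ (norm_nonneg v) p
  rwa [div_le_iff₀' (by positivity)] at this

theorem integral_coord (i : Fin 3) : ∫ v : V3, v i ∂gauss = 0 :=
  integral_gauss_odd fun v => by simp

theorem integral_norm_sq_sub : ∫ v : V3, (‖v‖ ^ 2 - 3) / Real.sqrt 6 ∂gauss = 0 := by
  rw [integral_div, integral_sub (integrable_norm_pow 2) (integrable_const _),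
    integral_norm_sq_and_four.1]
  simp

theorem integral_coord_mul_norm_sq_sub (i : Fin 3) :
    ∫ v : V3, v i * ((‖v‖ ^ 2 - 3) / Real.sqrt 6) ∂gauss = 0 :=
  integral_gauss_odd fun v => by simp

theorem integral_norm_sq_sub_sq :
    ∫ v : V3, ((‖v‖ ^ 2 - 3) / Real.sqrt 6) * ((‖v‖ ^ 2 - 3) / Real.sqrt 6) ∂gauss = 1 := by
  have e : ∀ v : V3, ((‖v‖ ^ 2 - 3) / Real.sqrt 6) * ((‖v‖ ^ 2 - 3) / Real.sqrt 6) =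
      (‖v‖ ^ 4 - 6 * ‖v‖ ^ 2 + 9) / 6 := fun v => by
    rw [div_mul_div_comm, Real.mul_self_sqrt (by norm_num)]; ring
  simp_rw [e]
  have hi : Integrable (fun v : V3 => ‖v‖ ^ 4 - 6 * ‖v‖ ^ 2) gauss :=
    (integrable_norm_pow 4).sub ((integrable_norm_pow 2).const_mul 6)
  rw [integral_div, integral_add hi (integrable_const _), integral_sub (integrable_norm_pow 4) ((integrable_norm_pow 2).const_mul 6),
    integral_const_mul, integral_norm_sq_and_four.1, integral_norm_sq_and_four.2]
  norm_num

theorem integral_invariant_mul (i j : Fin 5) :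
    ∫ v, invariant i v * invariant j v ∂gauss = if i = j then 1 else 0 := by
  have h3 := integral_coord_mul_norm_sq_sub
  have h3' : ∀ i, ∫ v : V3, ((‖v‖ ^ 2 - 3) / Real.sqrt 6) * v i ∂gauss = 0 := fun i => by
    simp_rw [mul_comm _ (_ : ℝ)]
    exact (by simpa only [mul_comm] using h3 i)
  have hs : ∀ i : Fin 3, ∫ v : V3, v i * v i ∂gauss = 1 := fun i => by
    simp_rw [← sq]; exact integral_coord_sq i
  unfold invariant
  fin_cases i <;> fin_cases j <;>
  simp only [Fin.zero_eta, Fin.mk_one, Fin.reduceFinMk, Fin.isValue, Matrix.cons_val_zero,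
    Matrix.cons_val_one, Matrix.cons_val, one_mul, mul_one, Fin.reduceEq, if_true, if_false] <;>
  first
  | exact integral_coord _
  | exact integral_norm_sq_sub
  | exact h3 _
  | exact h3' _
  | exact hs _
  | exact integral_norm_sq_sub_sq
  | exact integral_coord_mul_of_ne (by decide)
  | simp

/-- The coefficients of `expFun k` on the collision invariants. -/
def invCoeff (i : Fin 5) (k : V3) : ℝ :=
  (![1, k 0, k 1, k 2, ‖k‖ ^ 2 / Real.sqrt 6] : Fin 5 → ℝ) i

theorem integral_invariant_mul_expFun (i : Fin 5) (k : V3) :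
    ∫ v, invariant i v * expFun k v ∂gauss = invCoeff i k := by
  rw [integral_mul_expFun]
  have hc : ∀ i : Fin 3, ∫ v : V3, (v + k) i ∂gauss = k i := fun i => by
    simp only [PiLp.add_apply]
    have hi : Integrable (fun v : V3 => v i) gauss :=
      (integrable_norm_pow 1).mono' (by fun_prop)
        (Filter.Eventually.of_forall fun v => by simpa using abs_apply_le_norm v i)
    rw [integral_add hi (integrable_const _), integral_coord]
    simp
  unfold invariant invCoeff
  fin_cases i
  · simp
  · exact hc 0
  · exact hc 1
  · exact hc 2
  · change ∫ v : V3, (‖v + k‖ ^ 2 - 3) / Real.sqrt 6 ∂gauss = ‖k‖ ^ 2 / Real.sqrt 6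
    rw [integral_div]
    congr 1
    have e : ∀ v : V3, ‖v + k‖ ^ 2 - 3 = (‖v‖ ^ 2 + 2 * inner ℝ v k) + (‖k‖ ^ 2 - 3) := fun v => by
      rw [norm_add_sq_real]; ring
    have hin : Integrable (fun v : V3 => 2 * inner ℝ v k) gauss := by
      refine ((integrable_norm_pow 1).const_mul (2 * ‖k‖)).mono' (by fun_prop)
        (Filter.Eventually.of_forall fun v => ?_)
      have := abs_real_inner_le_norm v k
      simp only [norm_mul, Real.norm_eq_abs, abs_two, pow_one]
      nlinarith
    have hi : Integrable (fun v : V3 => ‖v‖ ^ 2 + 2 * inner ℝ v k) gauss :=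
      (integrable_norm_pow 2).add hin
    simp only [e]
    rw [integral_add hi (integrable_const _),
      integral_add (integrable_norm_pow 2) hin, integral_norm_sq_and_four.1,
      integral_gauss_odd (F := fun v => 2 * inner ℝ v k) (fun v => by simp)]
    simp

/-- This is the kernel of the projection onto the invariants, evaluated on two exponentials.
Compared with the expansion of `exp(k·l)` to second order, it lacks only the traceless part of
`(k·l)²/2`. -/
theorem sum_invCoeff_mul (k l : V3) :
    ∑ i, invCoeff i k * invCoeff i l = 1 + inner ℝ k l + ‖k‖ ^ 2 * ‖l‖ ^ 2 / 6 := by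
  rw [Fin.sum_univ_five]
  simp only [invCoeff, Matrix.cons_val_zero, Matrix.cons_val_one, Matrix.cons_val,
    PiLp.inner_apply, Fin.sum_univ_three]
  rw [div_mul_div_comm, Real.mul_self_sqrt (by norm_num)]
  simp
  ring

/-! ### Exponentials separate square integrable functions -/

/-- Finite exponential moments make the moment generating function analytic in the whole plane, so
agreement at real arguments forces agreement of the characteristic functions. -/
theorem measure_ext_of_integral_exp_inner {μ ν : Measure V3} [IsFiniteMeasure μ]
    [IsFiniteMeasure ν] (hμ : ∀ k, Integrable (fun v => Real.exp (inner ℝ k v)) μ)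
    (h : ∀ k, ∫ v, Real.exp (inner ℝ k v) ∂μ = ∫ v, Real.exp (inner ℝ k v) ∂ν) : μ = ν := by
  refine Measure.ext_of_charFun (E := V3) ?_
  ext k
  have h0 : μ = 0 ↔ ν = 0 := by
    have h1 := h 0
    simp only [inner_zero_left, Real.exp_zero, integral_const, smul_eq_mul, mul_one] at h1
    rw [← Measure.measure_univ_eq_zero, ← Measure.measure_univ_eq_zero,
      ← measureReal_eq_zero_iff, ← measureReal_eq_zero_iff, h1]
  have hm : ProbabilityTheory.mgf (fun v : V3 => inner ℝ v k) μ =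
      ProbabilityTheory.mgf (fun v : V3 => inner ℝ v k) ν := by
    ext t
    have := h (t • k)
    simp only [ProbabilityTheory.mgf]
    simpa only [real_inner_smul_left, real_inner_comm k] using this
  have hu : ProbabilityTheory.integrableExpSet (fun v : V3 => inner ℝ v k) μ = univ := by
    ext t
    simp only [ProbabilityTheory.integrableExpSet, mem_univ, iff_true]
    have := hμ (t • k)
    simp only [real_inner_smul_left] at this
    change Integrable (fun v : V3 => Real.exp (t * inner ℝ v k)) μ
    simpa only [real_inner_comm k] using this
  -- `Complex.I` has real part `0`, which is interior to the domain of real exponents since that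
  -- domain is the whole line.
  have hz := ProbabilityTheory.eqOn_complexMGF_of_mgf' hm h0 (x := Complex.I) (by simp [hu])
  simp only [ProbabilityTheory.complexMGF] at hz
  rw [charFun_apply, charFun_apply]
  simpa only [mul_comm] using hz

/-- The positive and negative parts of `g` are densities of two finite measures with the same
exponential moments. These measures coincide, hence so do the two parts, which are never both
nonzero. -/
theorem ae_eq_zero_of_integral_mul_expFun {g : V3 → ℝ} (hg : MemLp g 2 gauss)
    (h : ∀ k, ∫ v, g v * expFun k v ∂gauss = 0) : g =ᵐ[gauss] 0 := by
  have hgi : Integrable g gauss := hg.integrable one_le_two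
  have hexp : ∀ k v, Real.exp (inner ℝ k v) = Real.exp (‖k‖ ^ 2 / 2) * expFun k v := fun k v => by
    unfold expFun; rw [← Real.exp_add]; congr 1; ring
  have hint : ∀ k, Integrable (fun v => g v * Real.exp (inner ℝ k v)) gauss := fun k => by
    have : Integrable (fun v => g v * expFun k v) gauss := hg.integrable_mul (memLp_expFun k)
    refine (this.const_mul (Real.exp (‖k‖ ^ 2 / 2))).congr (Filter.Eventually.of_forall fun v => ?_)
    simp only [hexp]; ring
  have h0 : ∀ k, ∫ v, g v * Real.exp (inner ℝ k v) ∂gauss = 0 := fun k => by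
    simp_rw [hexp, mul_left_comm (g _)]
    rw [integral_const_mul, h, mul_zero]
  have hmeas : AEMeasurable g gauss := hgi.1.aemeasurable
  set μ := gauss.withDensity (fun v => ENNReal.ofReal (g v)) with hμ
  set ν := gauss.withDensity (fun v => ENNReal.ofReal (-g v)) with hν
  have : IsFiniteMeasure μ := isFiniteMeasure_withDensity_ofReal hgi.2
  have : IsFiniteMeasure ν := isFiniteMeasure_withDensity_ofReal hgi.neg.2
  have hI : ∀ {φ : V3 → ℝ}, AEMeasurable φ gauss → ∀ F : V3 → ℝ,
      ∫ v, F v ∂(gauss.withDensity (fun v => ENNReal.ofReal (φ v))) = ∫ v, max (φ v) 0 * F v ∂gauss := by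
    intro φ hφ F
    rw [integral_withDensity_eq_integral_toReal_smul₀ hφ.ennreal_ofReal (by simp)]
    congr 1
  have hJ : ∀ {φ : V3 → ℝ}, AEMeasurable φ gauss → ∀ k : V3,
      Integrable (fun v => φ v * Real.exp (inner ℝ k v)) gauss →
      Integrable (fun v => max (φ v) 0 * Real.exp (inner ℝ k v)) gauss := by
    intro φ hφ k hk
    refine hk.mono ((hφ.max aemeasurable_const).mul (by fun_prop)).aestronglyMeasurable
      (Filter.Eventually.of_forall fun v => ?_)
    rw [norm_mul, norm_mul]
    gcongr
    rw [Real.norm_eq_abs, Real.norm_eq_abs, abs_of_nonneg (le_max_right _ _)]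
    exact max_le (le_abs_self _) (abs_nonneg _)
  have heq : μ = ν := by
    refine measure_ext_of_integral_exp_inner (fun k => ?_) (fun k => ?_)
    · rw [hμ, integrable_withDensity_iff_integrable_smul₀' hmeas.ennreal_ofReal (by simp)]
      exact hJ hmeas k (hint k)
    · rw [hμ, hν, hI hmeas, hI (φ := fun v => -g v) hmeas.neg, ← sub_eq_zero, ← integral_sub (hJ hmeas k (hint k))
        (hJ (φ := fun v => -g v) hmeas.neg k (by simpa using (hint k).neg))]
      refine Eq.trans ?_ (h0 k)
      congr 1; ext v
      rw [← sub_mul]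
      congr 1
      rcases le_total (g v) 0 with h | h
      · rw [max_eq_right h, max_eq_left (by linarith)]; ring
      · rw [max_eq_left h, max_eq_right (by linarith)]; ring
  have hae := (withDensity_eq_iff hmeas.ennreal_ofReal hmeas.neg.ennreal_ofReal
    (by
      rw [← lt_top_iff_ne_top]
      exact lt_of_le_of_lt (lintegral_mono fun v => ENNReal.ofReal_le_ofReal (le_abs_self _))
        (by simpa [HasFiniteIntegral, Real.enorm_eq_ofReal_abs] using hgi.2))).1 heq
  filter_upwards [hae] with v hv
  rcases le_total (g v) 0 with h | h
  · rw [ENNReal.ofReal_of_nonpos h, eq_comm, ENNReal.ofReal_eq_zero] at hv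
    simp only [Pi.neg_apply] at hv
    exact le_antisymm h (neg_nonpos.1 hv)
  · have : ENNReal.ofReal (-g v) = 0 := ENNReal.ofReal_of_nonpos (by linarith)
    simp only [Pi.neg_apply, this, ENNReal.ofReal_eq_zero] at hv
    exact le_antisymm hv h

/-! ### Pre- and post-collisional velocities -/

/-- Collision configurations `(ω, (v, u))`. -/
abbrev Coll : Type := S2 × (V3 × V3)

/-- The post-collisional velocity `v'`. -/
def collV (p : Coll) : V3 := postV p.2.2 p.2.1 p.1

/-- The post-collisional velocity `u'`. -/
def collU (p : Coll) : V3 := postU p.2.2 p.2.1 p.1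

/-- The deflection angle. -/
def collAngle (p : Coll) : ℝ := InnerProductGeometry.angle (p.2.2 - p.2.1) (p.1 : V3)

/-- The collision involution. -/
def collMap (p : Coll) : Coll := (-p.1, (collV p, collU p))

/-- Exchange of the two particles. -/
def swapMap (p : Coll) : Coll := (-p.1, (p.2.2, p.2.1))

theorem inner_sphere_self (ω : S2) : inner ℝ (ω : V3) (ω : V3) = (1 : ℝ) := by
  rw [real_inner_self_eq_norm_sq]; simp

theorem collV_add_collU (p : Coll) : collV p + collU p = p.2.1 + p.2.2 := by
  unfold collV collU postV postU; abel

theorem collU_sub_collV (p : Coll) :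
    collU p - collV p = (p.2.2 - p.2.1) - (2 * inner ℝ (p.2.2 - p.2.1) (p.1 : V3)) • (p.1 : V3) := by
  unfold collV collU postV postU
  rw [← neg_sub p.2.1 p.2.2, inner_neg_left]
  module

/-- A collision reflects the relative velocity in the plane orthogonal to `ω`. The change of sign of
`ω` in `collMap` compensates this, so that the deflection angle is preserved. -/
theorem inner_collU_sub_collV (p : Coll) :
    inner ℝ (collU p - collV p) (p.1 : V3) = -inner ℝ (p.2.2 - p.2.1) (p.1 : V3) := by
  rw [collU_sub_collV, inner_sub_left, real_inner_smul_left, inner_sphere_self]; ring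

theorem norm_collU_sub_collV (p : Coll) : ‖collU p - collV p‖ = ‖p.2.2 - p.2.1‖ := by
  rw [← sq_eq_sq₀ (norm_nonneg _) (norm_nonneg _), collU_sub_collV, norm_sub_sq_real,
    inner_smul_right, norm_smul]
  simp only [norm_eq_of_mem_sphere, mul_one, Real.norm_eq_abs, sq_abs]
  ring

theorem norm_sq_collV_add (p : Coll) :
    ‖collV p‖ ^ 2 + ‖collU p‖ ^ 2 = ‖p.2.1‖ ^ 2 + ‖p.2.2‖ ^ 2 := by
  unfold collV collU postV postU
  rw [norm_sub_sq_real, norm_add_sq_real, inner_smul_right, inner_smul_right, norm_smul,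
    inner_sub_left]
  simp only [norm_eq_of_mem_sphere, mul_one, Real.norm_eq_abs, sq_abs]
  ring

theorem collV_swapMap (p : Coll) : collV (swapMap p) = collU p := by
  unfold collV collU swapMap postV postU
  simp only [coe_neg_sphere, inner_neg_right, smul_neg, neg_smul, neg_neg]
  rw [← neg_sub p.2.1 p.2.2, inner_neg_left]
  module

theorem collU_swapMap (p : Coll) : collU (swapMap p) = collV p := by
  unfold collV collU swapMap postV postU
  simp only [coe_neg_sphere, inner_neg_right, smul_neg, neg_smul, neg_neg]
  rw [← neg_sub p.2.1 p.2.2, inner_neg_left]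
  module

theorem collV_collMap (p : Coll) : collV (collMap p) = p.2.1 := by
  have h := inner_collU_sub_collV p
  have e : collV (collMap p) =
      collV p - inner ℝ (collV p - collU p) (p.1 : V3) • (p.1 : V3) := by
    simp [collV, collMap, postV]
  rw [e, ← neg_sub (collU p), inner_neg_left, h, neg_neg]
  unfold collV postV
  rw [← neg_sub p.2.2, inner_neg_left]; module

theorem collU_collMap (p : Coll) : collU (collMap p) = p.2.2 := by
  have h1 := collV_add_collU (collMap p)
  rw [collV_collMap] at h1
  have h2 := collV_add_collU p
  have h3 : p.2.1 + collU (collMap p) = p.2.1 + p.2.2 := by rw [h1, ← h2]; rfl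
  exact add_left_cancel h3

theorem collMap_collMap (p : Coll) : collMap (collMap p) = p := by
  have h1 := collV_collMap p
  have h2 := collU_collMap p
  unfold collMap at h1 h2 ⊢
  simp only [neg_neg]
  rw [h1, h2]

theorem swapMap_swapMap (p : Coll) : swapMap (swapMap p) = p := by simp [swapMap]

theorem collAngle_swapMap (p : Coll) : collAngle (swapMap p) = collAngle p := by
  unfold collAngle swapMap
  simp only [coe_neg_sphere]
  rw [← neg_sub p.2.2 p.2.1, InnerProductGeometry.angle_neg_neg]

theorem collAngle_collMap (p : Coll) : collAngle (collMap p) = collAngle p := by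
  have h1 := inner_collU_sub_collV p
  have h2 := norm_collU_sub_collV p
  unfold collAngle collMap InnerProductGeometry.angle
  simp only [coe_neg_sphere, inner_neg_right, norm_neg]
  rw [h1, h2, neg_neg]

theorem continuous_collV : Continuous collV := by unfold collV postV; fun_prop

theorem continuous_collU : Continuous collU := by unfold collU postU; fun_prop

theorem measurable_collAngle : Measurable collAngle :=
  measurable_angle (by fun_prop) (by fun_prop)

theorem measurable_collMap : Measurable collMap :=
  (measurable_fst.neg).prodMk (continuous_collV.measurable.prodMk continuous_collU.measurable)

theorem measurable_swapMap : Measurable swapMap := by unfold swapMap; fun_prop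

/-- Both collision invariants are conserved. -/
theorem invariant_conserved (i : Fin 5) (p : Coll) :
    invariant i (collV p) + invariant i (collU p) = invariant i p.2.1 + invariant i p.2.2 := by
  have h1 := collV_add_collU p
  have h2 := norm_sq_collV_add p
  have hc : ∀ j : Fin 3, (collV p) j + (collU p) j = p.2.1 j + p.2.2 j := fun j => by
    have := congrArg (fun w : V3 => w j) h1
    simpa using this
  unfold invariant
  fin_cases i
  · rfl
  · exact hc 0
  · exact hc 1
  · exact hc 2
  · change (‖collV p‖ ^ 2 - 3) / Real.sqrt 6 + (‖collU p‖ ^ 2 - 3) / Real.sqrt 6 =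
      (‖p.2.1‖ ^ 2 - 3) / Real.sqrt 6 + (‖p.2.2‖ ^ 2 - 3) / Real.sqrt 6
    rw [← add_div, ← add_div]
    congr 1; linarith

/-! ### Invariance of the collision measure -/

/-- The measure `dω M(v) dv M(u) du` on collision configurations. -/
def collMeasure : Measure Coll := sphereMeasure.prod (gauss.prod gauss)

theorem measurePreserving_withDensity_of_comp {α : Type*} [MeasurableSpace α] {μ : Measure α}
    {f : α → α} (hf : MeasurePreserving f μ μ) {φ : α → ENNReal} (hφ : Measurable φ)
    (h : ∀ x, φ (f x) = φ x) : MeasurePreserving f (μ.withDensity φ) (μ.withDensity φ) := by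
  refine ⟨hf.measurable, ?_⟩
  ext s hs
  rw [Measure.map_apply hf.measurable hs, withDensity_apply _ hs,
    withDensity_apply _ (hf.measurable hs), ← hf.setLIntegral_comp_preimage hs hφ]
  simp_rw [h]

/-- The determinant of an involution has square one, hence absolute value one. -/
theorem measurePreserving_of_linear_involutive {E : Type*} [NormedAddCommGroup E]
    [NormedSpace ℝ E] [FiniteDimensional ℝ E] [MeasurableSpace E] [BorelSpace E] {μ : Measure E}
    [μ.IsAddHaarMeasure] (L : E →ₗ[ℝ] E) (h : ∀ x, L (L x) = x) : MeasurePreserving L μ μ := by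
  have hd : LinearMap.det L * LinearMap.det L = 1 := by
    rw [← LinearMap.det_comp]
    have : L ∘ₗ L = LinearMap.id := by ext x; exact h x
    rw [this, LinearMap.det_id]
  have h0 : LinearMap.det L ≠ 0 := fun h0 => by simp [h0] at hd
  refine ⟨L.continuous_of_finiteDimensional.measurable, ?_⟩
  rw [Measure.map_linearMap_addHaar_eq_smul_addHaar μ h0]
  have : |(LinearMap.det L)⁻¹| = 1 := by
    rcases mul_self_eq_one_iff.1 hd with h | h <;> simp [h]
  rw [this]; simp

/-- The collision at fixed `ω`, as a linear map. -/
def collLinear (ω : S2) : V3 × V3 →ₗ[ℝ] V3 × V3 where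
  toFun z := (postV z.2 z.1 ω, postU z.2 z.1 ω)
  map_add' x y := by
    ext1 <;> simp only [postV, postU, Prod.fst_add, Prod.snd_add, inner_sub_left, inner_add_left] <;>
      module
  map_smul' c x := by
    ext1 <;> simp only [postV, postU, Prod.smul_fst, Prod.smul_snd, inner_sub_left,
      real_inner_smul_left, RingHom.id_apply] <;> module

/-- At fixed `ω` the collision is a linear involution, so it preserves Lebesgue measure;
conservation of energy preserves the product of the Gaussian densities. -/
theorem measurePreserving_gauss_prod (ω : S2) :
    MeasurePreserving (fun z : V3 × V3 => (postV z.2 z.1 ω, postU z.2 z.1 ω))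
      (gauss.prod gauss) (gauss.prod gauss) := by
  have hm := continuous_gaussDensity.measurable.ennreal_ofReal
  have h0 : MeasurePreserving (collLinear ω) ((volume : Measure V3).prod volume)
      ((volume : Measure V3).prod volume) := by
    refine measurePreserving_of_linear_involutive _ fun z => ?_
    -- The collision rule is even in `ω`, so the sign change built into `collMap` drops out.
    have h := collMap_collMap (ω, z)
    unfold collMap collV collU at h
    have h2 := congrArg Prod.snd h
    simp only [postV, postU, coe_neg_sphere, inner_neg_right, smul_neg, neg_smul, neg_neg] at h2
    exact h2
  unfold gauss
  rw [prod_withDensity hm hm]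
  refine measurePreserving_withDensity_of_comp h0
    ((hm.comp measurable_fst).mul (hm.comp measurable_snd)) fun z => ?_
  rw [← ENNReal.ofReal_mul (gaussDensity_pos _).le, ← ENNReal.ofReal_mul (gaussDensity_pos _).le]
  congr 1
  have h := norm_sq_collV_add (ω, z)
  change gaussDensity (collV (ω, z)) * gaussDensity (collU (ω, z)) = _
  simp only [gaussDensity]
  rw [mul_mul_mul_comm, mul_mul_mul_comm _ (Real.exp (-(‖z.1‖ ^ 2 / 2))), ← Real.exp_add, ← Real.exp_add]
  congr 2
  simp only at h
  linarith

theorem measurePreserving_collMap : MeasurePreserving collMap collMeasure collMeasure := by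
  unfold collMeasure
  exact MeasurePreserving.skew_product (g := fun (ω : S2) (z : V3 × V3) => (postV z.2 z.1 ω, postU z.2 z.1 ω))
    measurePreserving_neg_sphere
    (continuous_collV.measurable.prodMk continuous_collU.measurable)
    (Filter.Eventually.of_forall fun ω => (measurePreserving_gauss_prod ω).map_eq)

theorem measurePreserving_swapMap : MeasurePreserving swapMap collMeasure collMeasure := by
  unfold collMeasure
  exact measurePreserving_neg_sphere.prod Measure.measurePreserving_swap

/-- `collMap` as a measurable equivalence. -/
def collEquiv : Coll ≃ᵐ Coll where
  toFun := collMap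
  invFun := collMap
  left_inv := collMap_collMap
  right_inv := collMap_collMap
  measurable_toFun := measurable_collMap
  measurable_invFun := measurable_collMap

/-- `swapMap` as a measurable equivalence. -/
def swapEquiv : Coll ≃ᵐ Coll where
  toFun := swapMap
  invFun := swapMap
  left_inv := swapMap_swapMap
  right_inv := swapMap_swapMap
  measurable_toFun := measurable_swapMap
  measurable_invFun := measurable_swapMap

theorem ae_gauss_ne (v : V3) : ∀ᵐ u ∂gauss, u - v ≠ 0 := by
  refine gauss_absolutelyContinuous.ae_le (ae_iff.2 ?_)
  have : {u : V3 | ¬ (u - v ≠ 0)} = {v} := by ext u; simp [sub_eq_zero]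
  rw [this]; exact measure_singleton v

theorem lintegral_collMeasure {F : Coll → ENNReal} (hF : Measurable F) :
    ∫⁻ p, F p ∂collMeasure = ∫⁻ v, ∫⁻ u, ∫⁻ ω, F (ω, (v, u)) ∂sphereMeasure ∂gauss ∂gauss := by
  unfold collMeasure
  rw [lintegral_prod_symm _ hF.aemeasurable, lintegral_prod]
  exact (hF.lintegral_prod_left' : Measurable fun y => ∫⁻ x, F (x, y) ∂sphereMeasure).aemeasurable

/-! ### The Dirichlet form of the collision process -/

/-- The collision increment `h(v') + h(u') - h(v) - h(u)`. -/
def collDiff (h : V3 → ℝ) (p : Coll) : ℝ := h (collV p) + h (collU p) - h p.2.1 - h p.2.2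

theorem collDiff_collMap (h : V3 → ℝ) (p : Coll) : collDiff h (collMap p) = -collDiff h p := by
  unfold collDiff
  rw [collV_collMap, collU_collMap]
  change h p.2.1 + h p.2.2 - h (collV p) - h (collU p) = _
  ring

theorem collDiff_swapMap (h : V3 → ℝ) (p : Coll) : collDiff h (swapMap p) = collDiff h p := by
  unfold collDiff
  rw [collV_swapMap, collU_swapMap]
  change h (collU p) + h (collV p) - h p.2.2 - h p.2.1 = _
  ring

/-- Measures on collision configurations which are invariant under collisions and exchanges. -/
structure CollInvariant (μ : Measure Coll) : Prop where
  coll : MeasurePreserving collMap μ μ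
  swap : MeasurePreserving swapMap μ μ

namespace CollInvariant

variable {μ : Measure Coll} (hμ : CollInvariant μ)
include hμ

theorem integral_coll (F : Coll → ℝ) : ∫ p, F (collMap p) ∂μ = ∫ p, F p ∂μ :=
  hμ.coll.integral_comp collEquiv.measurableEmbedding F

theorem integral_swap (F : Coll → ℝ) : ∫ p, F (swapMap p) ∂μ = ∫ p, F p ∂μ :=
  hμ.swap.integral_comp swapEquiv.measurableEmbedding F

theorem memLp_all {h : V3 → ℝ} (hh : MemLp (fun p : Coll => h p.2.1) 2 μ) :
    MemLp (fun p : Coll => h p.2.2) 2 μ ∧ MemLp (fun p => h (collV p)) 2 μ ∧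
      MemLp (fun p => h (collU p)) 2 μ := by
  have h2 : MemLp (fun p : Coll => h p.2.2) 2 μ := hh.comp_measurePreserving hμ.swap
  exact ⟨h2, hh.comp_measurePreserving hμ.coll, h2.comp_measurePreserving hμ.coll⟩

theorem memLp_collDiff {h : V3 → ℝ} (hh : MemLp (fun p : Coll => h p.2.1) 2 μ) :
    MemLp (collDiff h) 2 μ := by
  obtain ⟨h2, h3, h4⟩ := hμ.memLp_all hh
  exact ((h3.add h4).sub hh).sub h2

/-- The increment is even under exchange of the particles and odd under collision, so each of the
four terms of the second increment contributes the same amount `-∫ collDiff g · h(v)`. -/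
theorem integral_collDiff_mul {g h : V3 → ℝ} (hg : MemLp (fun p : Coll => g p.2.1) 2 μ)
    (hh : MemLp (fun p : Coll => h p.2.1) 2 μ) :
    ∫ p, collDiff g p * collDiff h p ∂μ = -4 * ∫ p, collDiff g p * h p.2.1 ∂μ := by
  obtain ⟨h2, h3, h4⟩ := hμ.memLp_all hh
  have hD := hμ.memLp_collDiff hg
  have e2 : ∫ p, collDiff g p * h p.2.2 ∂μ = ∫ p, collDiff g p * h p.2.1 ∂μ := by
    rw [← hμ.integral_swap fun p => collDiff g p * h p.2.1]
    simp_rw [collDiff_swapMap]; rfl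
  have e3 : ∫ p, collDiff g p * h (collV p) ∂μ = -∫ p, collDiff g p * h p.2.1 ∂μ := by
    rw [← hμ.integral_coll fun p => collDiff g p * h p.2.1, ← integral_neg]
    congr 1; ext p
    rw [collDiff_collMap, neg_mul, neg_neg]; rfl
  have e4 : ∫ p, collDiff g p * h (collU p) ∂μ = -∫ p, collDiff g p * h p.2.1 ∂μ := by
    rw [← e2, ← hμ.integral_coll fun p => collDiff g p * h p.2.2, ← integral_neg]
    congr 1; ext p
    rw [collDiff_collMap, neg_mul, neg_neg]; rfl
  have i1 : Integrable (fun p => collDiff g p * h p.2.1) μ := hD.integrable_mul hh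
  have i2 : Integrable (fun p => collDiff g p * h p.2.2) μ := hD.integrable_mul h2
  have i3 : Integrable (fun p => collDiff g p * h (collV p)) μ := hD.integrable_mul h3
  have i4 : Integrable (fun p => collDiff g p * h (collU p)) μ := hD.integrable_mul h4
  have e : ∀ p, collDiff g p * collDiff h p = collDiff g p * h (collV p) +
      collDiff g p * h (collU p) - collDiff g p * h p.2.1 - collDiff g p * h p.2.2 := fun p => by
    rw [collDiff]; simp only [collDiff]; ring
  simp_rw [e]
  have i5 : Integrable (fun p => collDiff g p * h (collV p) + collDiff g p * h (collU p)) μ :=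
    i3.add i4
  have i6 : Integrable (fun p => collDiff g p * h (collV p) + collDiff g p * h (collU p) -
    collDiff g p * h p.2.1) μ := i5.sub i1
  rw [integral_sub i6 i2, integral_sub i5 i1, integral_add i3 i4,
    e2, e3, e4]
  ring

end CollInvariant

/-- A measure with a density depending only on the relative speed and the deflection angle is
invariant. -/
theorem collInvariant_withDensity {φ : Coll → ENNReal} (hφ : Measurable φ)
    (h1 : ∀ p, φ (collMap p) = φ p) (h2 : ∀ p, φ (swapMap p) = φ p) :
    CollInvariant (collMeasure.withDensity φ) :=
  ⟨measurePreserving_withDensity_of_comp measurePreserving_collMap hφ h1,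
    measurePreserving_withDensity_of_comp measurePreserving_swapMap hφ h2⟩

/-- The collision measure with an angular density. -/
def collWeight (ρ : ℝ → ℝ) : Measure Coll :=
  collMeasure.withDensity fun p => ENNReal.ofReal (ρ (collAngle p))

theorem collAngle_mem (p : Coll) : collAngle p ∈ Icc 0 Real.pi := angle_mem_Icc _ _

/-- Integrating out `ω` gives one for every axis `u - v ≠ 0`, and the diagonal `u = v`, where there
is no axis, is null. -/
theorem measurePreserving_snd_collWeight {ρ : ℝ → ℝ} (hρ : Measurable ρ)
    (h1 : ∀ a : V3, a ≠ 0 →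
      ∫⁻ ω : S2, ENNReal.ofReal (ρ (InnerProductGeometry.angle a ω)) ∂sphereMeasure = 1) :
    MeasurePreserving (fun p : Coll => p.2) (collWeight ρ) (gauss.prod gauss) := by
  refine ⟨by fun_prop, ?_⟩
  ext s hs
  have hm : Measurable fun p => ENNReal.ofReal (ρ (collAngle p)) :=
    (hρ.comp measurable_collAngle).ennreal_ofReal
  have hms : MeasurableSet ((fun p : Coll => p.2) ⁻¹' s) := measurable_snd hs
  rw [Measure.map_apply (by fun_prop) hs]
  unfold collWeight
  rw [withDensity_apply _ hms, ← lintegral_indicator hms, lintegral_collMeasure (hm.indicator hms),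
    ← lintegral_indicator_one hs, lintegral_prod _ (measurable_one.indicator hs).aemeasurable]
  refine lintegral_congr fun v => lintegral_congr_ae ?_
  filter_upwards [ae_gauss_ne v] with u hu
  by_cases hv : (v, u) ∈ s
  · have := h1 _ hu
    simpa [Set.indicator, hv, collAngle] using this
  · simp [Set.indicator, hv]

/-! ### Normalized angular densities -/

/-- A bounded normalized angular cross section. The number `κ` is the mean of `cos² θ sin² θ`. -/
structure AngularDensity (ρ : ℝ → ℝ) (κ : ℝ) : Prop where
  measurable : Measurable ρ
  nonneg : ∀ θ ∈ Icc 0 Real.pi, 0 ≤ ρ θ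
  bounded : ∃ C, 0 ≤ C ∧ ∀ θ ∈ Icc 0 Real.pi, ρ θ ≤ C
  -- The angle with the zero vector is `π/2` by convention, so this makes the spherical integrals
  -- with axis `k = 0` vanish and the later formulas hold there too.
  half_pi : ρ (Real.pi / 2) = 0
  integral_eq_one : ∀ a : V3, a ≠ 0 →
    ∫ ω : S2, ρ (InnerProductGeometry.angle a ω) ∂sphereMeasure = 1
  pos : 0 < κ
  integral_eq : ∀ a : V3, a ≠ 0 →
    ∫ ω : S2, ρ (InnerProductGeometry.angle a ω) *
      (Real.cos (InnerProductGeometry.angle a ω) ^ 2 *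
        Real.sin (InnerProductGeometry.angle a ω) ^ 2) ∂sphereMeasure = κ

namespace AngularDensity

variable {ρ : ℝ → ℝ} {κ : ℝ} (hρ : AngularDensity ρ κ)
include hρ

theorem nonneg_angle (a b : V3) : 0 ≤ ρ (InnerProductGeometry.angle a b) :=
  hρ.nonneg _ (angle_mem_Icc a b)

theorem measurable_angle (a : V3) :
    Measurable (fun ω : S2 => ρ (InnerProductGeometry.angle a ω)) :=
  hρ.measurable.comp (RotBoltzmann.measurable_angle measurable_const measurable_subtype_coe)

theorem integrable_mul {F : S2 → ℝ} (hF : Measurable F) {C : ℝ} (hC : ∀ ω, |F ω| ≤ C) (a : V3) :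
    Integrable (fun ω : S2 => ρ (InnerProductGeometry.angle a ω) * F ω) sphereMeasure := by
  obtain ⟨B, hB0, hB⟩ := hρ.bounded
  refine Integrable.of_bound ((hρ.measurable_angle a).mul hF).aestronglyMeasurable (B * C)
    (Filter.Eventually.of_forall fun ω => ?_)
  rw [norm_mul, Real.norm_of_nonneg (hρ.nonneg_angle _ _)]
  exact mul_le_mul (hB _ (angle_mem_Icc _ _)) (hC ω) (norm_nonneg _) hB0

theorem measurable_collAngle : Measurable fun p => ρ (collAngle p) :=
  hρ.measurable.comp RotBoltzmann.measurable_collAngle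

theorem collInvariant : CollInvariant (collWeight ρ) :=
  collInvariant_withDensity hρ.measurable_collAngle.ennreal_ofReal
    (fun p => by rw [collAngle_collMap]) (fun p => by rw [collAngle_swapMap])

theorem integral_collWeight (F : Coll → ℝ) :
    ∫ p, F p ∂(collWeight ρ) = ∫ p, ρ (collAngle p) * F p ∂collMeasure := by
  unfold collWeight
  rw [integral_withDensity_eq_integral_toReal_smul hρ.measurable_collAngle.ennreal_ofReal
    (by simp)]
  congr 1; ext p
  rw [ENNReal.toReal_ofReal (hρ.nonneg _ (collAngle_mem p)), smul_eq_mul]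

theorem lintegral_eq_one {a : V3} (ha : a ≠ 0) :
    ∫⁻ ω : S2, ENNReal.ofReal (ρ (InnerProductGeometry.angle a ω)) ∂sphereMeasure = 1 := by
  rw [← ofReal_integral_eq_lintegral_ofReal, hρ.integral_eq_one a ha, ENNReal.ofReal_one]
  · simpa using hρ.integrable_mul (F := fun _ => 1) measurable_const (C := 1) (by simp) a
  · exact Filter.Eventually.of_forall fun ω => hρ.nonneg_angle _ _

theorem measurePreserving_pair :
    MeasurePreserving (fun p : Coll => p.2) (collWeight ρ) (gauss.prod gauss) :=
  measurePreserving_snd_collWeight hρ.measurable fun _ ha => hρ.lintegral_eq_one ha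

/-- With the normalised angular density, this marginal and the two symmetries make each of `v`, `u`,
`v'`, `u'` a standard Gaussian, which is why the increment is a bounded operator between `L²`
spaces. -/
theorem measurePreserving_fst : MeasurePreserving (fun p : Coll => p.2.1) (collWeight ρ) gauss :=
  MeasureTheory.measurePreserving_fst.comp hρ.measurePreserving_pair

theorem measurePreserving_snd : MeasurePreserving (fun p : Coll => p.2.2) (collWeight ρ) gauss :=
  hρ.measurePreserving_fst.comp hρ.collInvariant.swap

theorem measurePreserving_collV : MeasurePreserving collV (collWeight ρ) gauss :=
  hρ.measurePreserving_fst.comp hρ.collInvariant.coll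

theorem measurePreserving_collU : MeasurePreserving collU (collWeight ρ) gauss :=
  hρ.measurePreserving_snd.comp hρ.collInvariant.coll

/-- Pull-back of square integrable functions along the pre-collisional velocity. -/
def pull : Lp ℝ 2 gauss →L[ℝ] Lp ℝ 2 (collWeight ρ) :=
  (Lp.compMeasurePreservingₗᵢ ℝ _ hρ.measurePreserving_fst).toContinuousLinearMap

/-- The collision increment as a bounded operator. -/
def diff : Lp ℝ 2 gauss →L[ℝ] Lp ℝ 2 (collWeight ρ) :=
  (Lp.compMeasurePreservingₗᵢ ℝ _ hρ.measurePreserving_collV).toContinuousLinearMap +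
  (Lp.compMeasurePreservingₗᵢ ℝ _ hρ.measurePreserving_collU).toContinuousLinearMap -
  (Lp.compMeasurePreservingₗᵢ ℝ _ hρ.measurePreserving_fst).toContinuousLinearMap -
  (Lp.compMeasurePreservingₗᵢ ℝ _ hρ.measurePreserving_snd).toContinuousLinearMap

theorem coeFn_pull (g : Lp ℝ 2 gauss) : hρ.pull g =ᵐ[collWeight ρ] fun p => g p.2.1 :=
  Lp.coeFn_compMeasurePreserving g hρ.measurePreserving_fst

theorem coeFn_diff (g : Lp ℝ 2 gauss) : hρ.diff g =ᵐ[collWeight ρ] collDiff g := by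
  unfold diff
  simp only [sub_apply, add_apply]
  filter_upwards [Lp.coeFn_sub
      (Lp.compMeasurePreservingₗᵢ ℝ _ hρ.measurePreserving_collV g +
        Lp.compMeasurePreservingₗᵢ ℝ _ hρ.measurePreserving_collU g -
        Lp.compMeasurePreservingₗᵢ ℝ _ hρ.measurePreserving_fst g)
      (Lp.compMeasurePreservingₗᵢ ℝ _ hρ.measurePreserving_snd g),
    Lp.coeFn_sub
      (Lp.compMeasurePreservingₗᵢ ℝ _ hρ.measurePreserving_collV g +
        Lp.compMeasurePreservingₗᵢ ℝ _ hρ.measurePreserving_collU g)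
      (Lp.compMeasurePreservingₗᵢ ℝ _ hρ.measurePreserving_fst g),
    Lp.coeFn_add
      (Lp.compMeasurePreservingₗᵢ ℝ _ hρ.measurePreserving_collV g)
      (Lp.compMeasurePreservingₗᵢ ℝ _ hρ.measurePreserving_collU g),
    Lp.coeFn_compMeasurePreserving g hρ.measurePreserving_collV,
    Lp.coeFn_compMeasurePreserving g hρ.measurePreserving_collU,
    Lp.coeFn_compMeasurePreserving g hρ.measurePreserving_fst,
    Lp.coeFn_compMeasurePreserving g hρ.measurePreserving_snd] with p a1 a2 a3 a4 a5 a6 a7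
  simp only [LinearIsometry.coe_toContinuousLinearMap]
  rw [a1, Pi.sub_apply, a2, Pi.sub_apply, a3, Pi.add_apply]
  simp only [Lp.compMeasurePreservingₗᵢ_apply_coe] at *
  unfold collDiff
  simp only [Function.comp] at a4 a5 a6 a7
  exact congrArg₂ _ (congrArg₂ _ (congrArg₂ _ a4 a5) a6) a7

/-- The averaging operator whose Dirichlet form is that of the collision process. -/
def op : Lp ℝ 2 gauss →L[ℝ] Lp ℝ 2 gauss :=
  ContinuousLinearMap.id ℝ _ + (ContinuousLinearMap.adjoint hρ.pull).comp hρ.diff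

theorem memLp_fst (g : Lp ℝ 2 gauss) : MemLp (fun p : Coll => g p.2.1) 2 (collWeight ρ) :=
  (Lp.memLp g).comp_measurePreserving hρ.measurePreserving_fst

theorem inner_op (g h : Lp ℝ 2 gauss) :
    inner ℝ (hρ.op g) h = inner ℝ g h + ∫ p, collDiff g p * h p.2.1 ∂(collWeight ρ) := by
  unfold op
  rw [add_apply, inner_add_left, ContinuousLinearMap.comp_apply,
    ContinuousLinearMap.adjoint_inner_left, L2.inner_def (hρ.diff g)]
  congr 1
  refine integral_congr_ae ?_
  filter_upwards [hρ.coeFn_diff g, hρ.coeFn_pull h] with p h1 h2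
  rw [h1, h2]
  simp [mul_comm]

/-- The link between `op` and the Dirichlet form: a bound `‖op h‖ ≤ r ‖h‖` with `r < 1` at some `h`
bounds the Dirichlet form of `h` below by `4(1 - r)‖h‖²`. -/
theorem inner_op_eq (g h : Lp ℝ 2 gauss) : inner ℝ (hρ.op g) h =
    inner ℝ g h - 1 / 4 * ∫ p, collDiff g p * collDiff h p ∂(collWeight ρ) := by
  rw [inner_op, hρ.collInvariant.integral_collDiff_mul (hρ.memLp_fst g) (hρ.memLp_fst h)]
  ring

theorem op_symm (g h : Lp ℝ 2 gauss) : inner ℝ (hρ.op g) h = inner ℝ g (hρ.op h) := by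
  rw [inner_op_eq, real_inner_comm, real_inner_comm _ g, inner_op_eq]
  simp_rw [fun p => mul_comm (collDiff g p) (collDiff h p)]

end AngularDensity

/-! ### Action of the collision process on exponentials -/

/-- The component of `k` along `ω`. -/
def alongPart (k : V3) (ω : S2) : V3 := inner ℝ k (ω : V3) • (ω : V3)

/-- The component of `k` orthogonal to `ω`. -/
def orthPart (k : V3) (ω : S2) : V3 := k - inner ℝ k (ω : V3) • (ω : V3)

theorem norm_sq_alongPart (k : V3) (ω : S2) : ‖alongPart k ω‖ ^ 2 = inner ℝ k (ω : V3) ^ 2 := by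
  unfold alongPart
  rw [norm_smul, norm_eq_of_mem_sphere, mul_one, Real.norm_eq_abs, sq_abs]

theorem norm_sq_orthPart (k : V3) (ω : S2) :
    ‖orthPart k ω‖ ^ 2 = ‖k‖ ^ 2 - inner ℝ k (ω : V3) ^ 2 := by
  unfold orthPart
  rw [norm_sub_sq_real, inner_smul_right, norm_smul, norm_eq_of_mem_sphere, mul_one,
    Real.norm_eq_abs, sq_abs]
  ring

theorem norm_alongPart_le (k : V3) (ω : S2) : ‖alongPart k ω‖ ≤ ‖k‖ := by
  have h1 := norm_sq_alongPart k ω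
  have h2 := norm_sq_orthPart k ω
  exact abs_le_of_sq_le_sq' (by nlinarith [sq_nonneg ‖orthPart k ω‖]) (norm_nonneg _) |>.2

theorem norm_orthPart_le (k : V3) (ω : S2) : ‖orthPart k ω‖ ≤ ‖k‖ := by
  have h2 := norm_sq_orthPart k ω
  exact abs_le_of_sq_le_sq' (by nlinarith [sq_nonneg (inner ℝ k (ω : V3) : ℝ)])
    (norm_nonneg _) |>.2

theorem inner_eq_norm_mul_cos (k : V3) (ω : S2) :
    inner ℝ k (ω : V3) = ‖k‖ * Real.cos (InnerProductGeometry.angle k ω) := by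
  have := InnerProductGeometry.cos_angle_mul_norm_mul_norm k (ω : V3)
  rw [norm_eq_of_mem_sphere, mul_one] at this
  linarith

theorem norm_alongPart (k : V3) (ω : S2) :
    ‖alongPart k ω‖ = ‖k‖ * |Real.cos (InnerProductGeometry.angle k ω)| := by
  rw [← sq_eq_sq₀ (norm_nonneg _) (by positivity), norm_sq_alongPart, inner_eq_norm_mul_cos,
    mul_pow, mul_pow, sq_abs]

theorem norm_orthPart (k : V3) (ω : S2) :
    ‖orthPart k ω‖ = ‖k‖ * |Real.sin (InnerProductGeometry.angle k ω)| := by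
  rw [← sq_eq_sq₀ (norm_nonneg _) (by positivity), norm_sq_orthPart, inner_eq_norm_mul_cos,
    mul_pow, mul_pow, sq_abs, Real.sin_sq]
  ring

theorem continuous_alongPart (k : V3) : Continuous (alongPart k) := by unfold alongPart; fun_prop

theorem continuous_orthPart (k : V3) : Continuous (orthPart k) := by unfold orthPart; fun_prop

/-- `v'` is made of the part of `v` orthogonal to `ω` and the part of `u` along `ω`; by Pythagoras
the normalising factor splits in the same way. -/
theorem expFun_collV (k : V3) (ω : S2) (v u : V3) :
    expFun k (collV (ω, (v, u))) = expFun (orthPart k ω) v * expFun (alongPart k ω) u := by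
  unfold expFun
  rw [norm_sq_orthPart, norm_sq_alongPart, ← Real.exp_add]
  congr 1
  simp only [collV, postV, orthPart, alongPart, inner_sub_left, inner_sub_right,
    real_inner_smul_left, inner_smul_right]
  rw [real_inner_comm (ω : V3) v, real_inner_comm (ω : V3) u]
  ring

theorem expFun_collU (k : V3) (ω : S2) (v u : V3) :
    expFun k (collU (ω, (v, u))) = expFun (alongPart k ω) v * expFun (orthPart k ω) u := by
  unfold expFun
  rw [norm_sq_orthPart, norm_sq_alongPart, ← Real.exp_add]
  congr 1
  simp only [collU, postU, orthPart, alongPart, inner_sub_left, inner_add_right,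
    real_inner_smul_left, inner_smul_right]
  rw [real_inner_comm (ω : V3) v, real_inner_comm (ω : V3) u]
  ring

theorem expFun_le_of_norm_le {l : V3} {R : ℝ} (h : ‖l‖ ≤ R) (v : V3) :
    |expFun l v| ≤ Real.exp (R * ‖v‖) := by
  have := abs_expFun_le l v
  rw [one_mul] at this
  exact this.trans (Real.exp_le_exp.2 (by gcongr))

theorem ae_gauss_prod_ne : ∀ᵐ z : V3 × V3 ∂(gauss.prod gauss), z.2 - z.1 ≠ 0 := by
  have hm : Measurable fun z : V3 × V3 => z.2 - z.1 := by fun_prop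
  have hms : MeasurableSet ((fun z : V3 × V3 => z.2 - z.1) ⁻¹' {0}ᶜ) :=
    hm (measurableSet_singleton 0).compl
  exact (Measure.ae_prod_mem_iff_ae_ae_mem hms).2 (Filter.Eventually.of_forall ae_gauss_ne)

/-- Both factors are dominated by `exp(‖k‖‖·‖)` uniformly in `ω`, and this is square integrable for
`gauss`. The map `G` stands for any of the four velocities. -/
theorem integrable_weight_expFun {k : V3} {G : Coll → V3} (hG : Continuous G) {K K' : S2 → V3}
    (hK : ∀ ω, ‖K ω‖ ≤ ‖k‖) (hK' : ∀ ω, ‖K' ω‖ ≤ ‖k‖)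
    (h : ∀ ω v u, expFun k (G (ω, (v, u))) = expFun (K ω) v * expFun (K' ω) u)
    {g : V3 → ℝ} (hg : MemLp g 2 gauss) {w : Coll → ℝ} (hw : Measurable w) {C : ℝ}
    (hC : ∀ p, |w p| ≤ C) :
    Integrable (fun p => w p * (expFun k (G p) * g p.2.1)) collMeasure := by
  have hexp : MemLp (fun v : V3 => Real.exp (‖k‖ * ‖v‖)) 2 gauss :=
    memLp_of_le_exp (C := 1) (c := ‖k‖) (by fun_prop) fun v => by simp
  have h1 : Integrable (fun v => Real.exp (‖k‖ * ‖v‖) * |g v|) gauss := hexp.integrable_mul hg.abs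
  have h2 : Integrable (fun z : V3 × V3 => (Real.exp (‖k‖ * ‖z.1‖) * |g z.1|) *
      Real.exp (‖k‖ * ‖z.2‖)) (gauss.prod gauss) := h1.mul_prod (integrable_exp_norm _)
  have h3 : Integrable (fun p : Coll => (Real.exp (‖k‖ * ‖p.2.1‖) * |g p.2.1|) *
      Real.exp (‖k‖ * ‖p.2.2‖)) collMeasure := h2.comp_snd sphereMeasure
  have hgm : AEStronglyMeasurable (fun p : Coll => g p.2.1) collMeasure :=
    (hg.1.comp_fst).comp_snd
  refine (h3.const_mul C).mono' (hw.aestronglyMeasurable.mul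
    (((continuous_expFun.comp (Continuous.prodMk_right k)).comp hG).aestronglyMeasurable.mul hgm))
    (Filter.Eventually.of_forall fun p => ?_)
  have hC0 : 0 ≤ C := (abs_nonneg _).trans (hC p)
  rw [norm_mul, norm_mul]
  refine mul_le_mul (hC p) ?_ (by positivity) hC0
  rw [h p.1 p.2.1 p.2.2, norm_mul]
  simp only [Real.norm_eq_abs]
  calc |expFun (K p.1) p.2.1| * |expFun (K' p.1) p.2.2| * |g p.2.1|
      ≤ Real.exp (‖k‖ * ‖p.2.1‖) * Real.exp (‖k‖ * ‖p.2.2‖) * |g p.2.1| := by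
        gcongr
        · exact expFun_le_of_norm_le (hK _) _
        · exact expFun_le_of_norm_le (hK' _) _
    _ = _ := by ring

namespace AngularDensity

variable {ρ : ℝ → ℝ} {κ : ℝ} (hρ : AngularDensity ρ κ)
include hρ

theorem exists_abs_le : ∃ C, ∀ θ ∈ Icc 0 Real.pi, |ρ θ| ≤ C := by
  obtain ⟨C, -, hC⟩ := hρ.bounded
  exact ⟨C, fun θ hθ => by rw [abs_of_nonneg (hρ.nonneg θ hθ)]; exact hC θ hθ⟩

/-- The exchange of the directions of `u - v` and `k` in a collision integral of exponentials. -/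
theorem integral_expFun_swap {k : V3} (hk : k ≠ 0) {G : Coll → V3} (hG : Continuous G)
    {K K' : S2 → V3} (hK : ∀ ω, ‖K ω‖ ≤ ‖k‖) (hK' : ∀ ω, ‖K' ω‖ ≤ ‖k‖)
    (h : ∀ ω v u, expFun k (G (ω, (v, u))) = expFun (K ω) v * expFun (K' ω) u)
    (hF : ∀ z : V3 × V3, ∃ F : ℝ → ℝ, ∀ ω : S2,
      expFun k (G (ω, z)) = F (inner ℝ (z.2 - z.1) (ω : V3) * inner ℝ k (ω : V3)))
    {g : V3 → ℝ} (hg : MemLp g 2 gauss) :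
    ∫ p, ρ (collAngle p) * (expFun k (G p) * g p.2.1) ∂collMeasure =
      ∫ ω : S2, ρ (InnerProductGeometry.angle k ω) * ∫ v, expFun (K ω) v * g v ∂gauss
        ∂sphereMeasure := by
  obtain ⟨C, hC⟩ := hρ.exists_abs_le
  have i1 := integrable_weight_expFun hG hK hK' h hg hρ.measurable_collAngle
    (fun p => hC _ (collAngle_mem p))
  have i2 := integrable_weight_expFun hG hK hK' h hg
    (w := fun p : Coll => ρ (InnerProductGeometry.angle k p.1))
    ((hρ.measurable_angle k).comp measurable_fst) (fun p => hC _ (angle_mem_Icc _ _))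
  unfold collMeasure at i1 i2 ⊢
  rw [integral_prod_symm _ i1]
  -- At fixed velocities the exponential depends on `ω` only through `((u - v)·ω)(k·ω)`, so the axis
  -- `u - v` of the angular density may be replaced by `k`.
  have e1 : ∀ᵐ z ∂(gauss.prod gauss),
      ∫ ω : S2, ρ (collAngle (ω, z)) * (expFun k (G (ω, z)) * g z.1) ∂sphereMeasure =
      ∫ ω : S2, ρ (InnerProductGeometry.angle k ω) * (expFun k (G (ω, z)) * g z.1)
        ∂sphereMeasure := by
    filter_upwards [ae_gauss_prod_ne] with z hz
    obtain ⟨F, hF⟩ := hF z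
    have key := integral_angle_swap ρ (fun t => F t * g z.1) (a := z.2 - z.1) (b := k) hz hk
    simp only [← hF] at key
    simpa only [collAngle] using key
  -- The angular factor no longer involves the velocities. The integrals can be taken in the other
  -- order, and that over `u` equals one.
  rw [integral_congr_ae e1, ← integral_prod_symm _ i2, integral_prod _ i2]
  congr 1; ext ω
  simp only
  rw [integral_const_mul]
  congr 1
  have i3 : Integrable (fun v => expFun (K ω) v * g v) gauss :=
    (memLp_expFun _).integrable_mul hg
  have i4 : Integrable (expFun (K' ω)) gauss := (memLp_expFun _).integrable one_le_two
  have e2 : ∀ z : V3 × V3, expFun k (G (ω, z)) * g z.1 =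
      (expFun (K ω) z.1 * g z.1) * expFun (K' ω) z.2 := fun z => by
    rw [h ω z.1 z.2]; ring
  simp_rw [e2]
  rw [integral_prod_mul (fun v => expFun (K ω) v * g v) (expFun (K' ω)), integral_expFun, mul_one]

theorem collDiff_congr {h h' : V3 → ℝ} (hh : h =ᵐ[gauss] h') :
    collDiff h =ᵐ[collWeight ρ] collDiff h' := by
  filter_upwards [hρ.measurePreserving_collV.quasiMeasurePreserving.ae_eq_comp hh,
    hρ.measurePreserving_collU.quasiMeasurePreserving.ae_eq_comp hh,
    hρ.measurePreserving_fst.quasiMeasurePreserving.ae_eq_comp hh,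
    hρ.measurePreserving_snd.quasiMeasurePreserving.ae_eq_comp hh] with p h1 h2 h3 h4
  simp only [Function.comp] at h1 h2 h3 h4
  simp only [collDiff, h1, h2, h3, h4]

end AngularDensity

/-! ### Exponentials, invariants and microscopic parts in `L²` -/

/-- Exponentials as elements of `L²`. -/
def expLp (k : V3) : Lp ℝ 2 gauss := (memLp_expFun k).toLp

/-- Collision invariants as elements of `L²`. -/
def invLp (i : Fin 5) : Lp ℝ 2 gauss := (memLp_invariant i).toLp

theorem inner_expLp (k : V3) (g : Lp ℝ 2 gauss) :
    inner ℝ (expLp k) g = ∫ v, expFun k v * g v ∂gauss := by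
  rw [L2.inner_def]
  refine integral_congr_ae ?_
  filter_upwards [(memLp_expFun k).coeFn_toLp] with v hv
  rw [expLp, hv]; simp [mul_comm]

theorem inner_invLp (i : Fin 5) (g : Lp ℝ 2 gauss) :
    inner ℝ (invLp i) g = ∫ v, invariant i v * g v ∂gauss := by
  rw [L2.inner_def]
  refine integral_congr_ae ?_
  filter_upwards [(memLp_invariant i).coeFn_toLp] with v hv
  rw [invLp, hv]; simp [mul_comm]

theorem inner_expLp_expLp (k l : V3) : inner ℝ (expLp k) (expLp l) = Real.exp (inner ℝ k l) := by
  rw [inner_expLp, ← integral_expFun_mul_expFun]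
  refine integral_congr_ae ?_
  filter_upwards [(memLp_expFun l).coeFn_toLp] with v hv
  rw [expLp, hv]

theorem inner_invLp_expLp (i : Fin 5) (l : V3) : inner ℝ (invLp i) (expLp l) = invCoeff i l := by
  rw [inner_invLp, ← integral_invariant_mul_expFun]
  refine integral_congr_ae ?_
  filter_upwards [(memLp_expFun l).coeFn_toLp] with v hv
  rw [expLp, hv]

theorem inner_invLp_invLp (i j : Fin 5) :
    inner ℝ (invLp i) (invLp j) = if i = j then (1 : ℝ) else 0 := by
  rw [inner_invLp, ← integral_invariant_mul]
  refine integral_congr_ae ?_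
  filter_upwards [(memLp_invariant j).coeFn_toLp] with v hv
  rw [invLp, hv]

theorem norm_expLp_le {k : V3} {R : ℝ} (hk : ‖k‖ ≤ R) : ‖expLp k‖ ≤ Real.exp (R ^ 2) := by
  have h := real_inner_self_eq_norm_sq (expLp k)
  rw [inner_expLp_expLp, real_inner_self_eq_norm_sq] at h
  have h1 : Real.exp (‖k‖ ^ 2) ≤ Real.exp (R ^ 2) ^ 2 := by
    rw [← Real.exp_nat_mul]
    refine Real.exp_le_exp.2 ?_
    have : ‖k‖ ^ 2 ≤ R ^ 2 := by gcongr
    push_cast; nlinarith [sq_nonneg R]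
  exact abs_le_of_sq_le_sq' (h ▸ h1) (Real.exp_pos _).le |>.2

theorem measurable_inner_expLp (g : Lp ℝ 2 gauss) :
    Measurable fun k : V3 => (inner ℝ (expLp k) g : ℝ) := by
  simp_rw [inner_expLp]
  have h : StronglyMeasurable (fun p : V3 × V3 => expFun p.1 p.2 * g p.2) :=
    continuous_expFun.stronglyMeasurable.mul
      ((Lp.stronglyMeasurable g).comp_measurable measurable_snd)
  exact h.integral_prod_right.measurable

/-- The microscopic part of an exponential. -/
def microExp (k : V3) : Lp ℝ 2 gauss := expLp k - ∑ i, invCoeff i k • invLp i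

theorem inner_microExp (k : V3) (g : Lp ℝ 2 gauss) :
    inner ℝ (microExp k) g = inner ℝ (expLp k) g - ∑ i, invCoeff i k * inner ℝ (invLp i) g := by
  unfold microExp
  rw [inner_sub_left, sum_inner]
  simp_rw [real_inner_smul_left]

/-- The microscopic part of an exponential is orthogonal to the invariants, so the kernel `exp(k·l)`
loses exactly the sum in `sum_invCoeff_mul`. What remains is half the traceless quadratic form plus
terms of order three. -/
theorem inner_microExp_microExp (k l : V3) : inner ℝ (microExp k) (microExp l) =
    Real.exp (inner ℝ k l) - 1 - inner ℝ k l - ‖k‖ ^ 2 * ‖l‖ ^ 2 / 6 := by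
  have h1 : ∀ i, inner ℝ (invLp i) (microExp l) = (0 : ℝ) := fun i => by
    unfold microExp
    rw [inner_sub_right, inner_invLp_expLp, inner_sum]
    simp_rw [inner_smul_right, inner_invLp_invLp]
    simp
  rw [inner_microExp]
  simp_rw [h1]
  rw [real_inner_comm, inner_microExp, inner_expLp_expLp]
  simp_rw [inner_invLp_expLp]
  rw [sum_invCoeff_mul, real_inner_comm k l]
  simp
  ring

/-- The coefficients are constant, linear or proportional to `|k|²`, and `k` is the orthogonal sum
of its two parts. This conservation law on the frequency side lets Bobylev's formula descend to
microscopic parts. -/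
theorem invCoeff_add (k : V3) (ω : S2) (i : Fin 5) :
    invCoeff i (orthPart k ω) + invCoeff i (alongPart k ω) = invCoeff i k + invCoeff i 0 := by
  have h1 : orthPart k ω + alongPart k ω = k := by unfold orthPart alongPart; abel
  have h2 : ‖orthPart k ω‖ ^ 2 + ‖alongPart k ω‖ ^ 2 = ‖k‖ ^ 2 := by
    rw [norm_sq_orthPart, norm_sq_alongPart]; ring
  have hc : ∀ j : Fin 3, (orthPart k ω) j + (alongPart k ω) j = k j := fun j => by
    have := congrArg (fun w : V3 => w j) h1
    simpa using this
  unfold invCoeff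
  fin_cases i
  · rfl
  · simpa using hc 0
  · simpa using hc 1
  · simpa using hc 2
  · change ‖orthPart k ω‖ ^ 2 / Real.sqrt 6 + ‖alongPart k ω‖ ^ 2 / Real.sqrt 6 =
      ‖k‖ ^ 2 / Real.sqrt 6 + ‖(0 : V3)‖ ^ 2 / Real.sqrt 6
    rw [← add_div, h2]; simp

theorem microExp_zero : microExp 0 = 0 := by
  have := inner_microExp_microExp 0 0
  simp only [inner_zero_left, Real.exp_zero, norm_zero] at this
  rw [← inner_self_eq_zero (𝕜 := ℝ), this]; norm_num

namespace AngularDensity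

variable {ρ : ℝ → ℝ} {κ : ℝ} (hρ : AngularDensity ρ κ)
include hρ

theorem op_invLp (i : Fin 5) : hρ.op (invLp i) = invLp i := by
  refine ext_inner_right ℝ fun g => ?_
  rw [inner_op]
  have : ∫ p, collDiff (invLp i) p * g p.2.1 ∂(collWeight ρ) = ∫ p, (0 : ℝ) ∂(collWeight ρ) := by
    refine integral_congr_ae ?_
    filter_upwards [hρ.collDiff_congr (memLp_invariant i).coeFn_toLp] with p hp
    rw [invLp, hp]
    unfold collDiff
    rw [invariant_conserved]; ring
  rw [this]; simp

theorem integrable_angle_inner (k : V3) {K : S2 → V3} (hK : Continuous K)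
    (hK' : ∀ ω, ‖K ω‖ ≤ ‖k‖) (g : Lp ℝ 2 gauss) :
    Integrable (fun ω : S2 => ρ (InnerProductGeometry.angle k ω) * inner ℝ (expLp (K ω)) g)
      sphereMeasure :=
  hρ.integrable_mul ((measurable_inner_expLp g).comp hK.measurable)
    (C := Real.exp (‖k‖ ^ 2) * ‖g‖) (fun ω => (abs_real_inner_le_norm _ _).trans
      (mul_le_mul_of_nonneg_right (norm_expLp_le (hK' ω)) (norm_nonneg _))) k

/-- Bobylev's formula in weak form. The gain terms become exponentials in the two components of `k`;
the loss term at `u` averages to the constant `expLp 0`. -/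
theorem inner_op_expLp {k : V3} (hk : k ≠ 0) (g : Lp ℝ 2 gauss) :
    inner ℝ (hρ.op (expLp k)) g = ∫ ω : S2, ρ (InnerProductGeometry.angle k ω) *
      (inner ℝ (expLp (orthPart k ω)) g + inner ℝ (expLp (alongPart k ω)) g -
        inner ℝ (expLp 0) g) ∂sphereMeasure := by
  have hg : MemLp g 2 gauss := Lp.memLp g
  obtain ⟨C, hC⟩ := hρ.exists_abs_le
  have hm := hρ.measurable_collAngle
  have hb := fun p => hC _ (collAngle_mem p)
  have n0 : ∀ ω : S2, ‖(0 : V3)‖ ≤ ‖k‖ := fun _ => by simp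
  have hE0 : ∀ v, expFun 0 v = 1 := fun v => by simp [expFun]
  have hfst : ∀ (ω : S2) (v u : V3), expFun k ((ω, (v, u)) : Coll).2.1 =
      expFun k v * expFun 0 u := fun ω v u => by rw [hE0, mul_one]
  have hsnd : ∀ (ω : S2) (v u : V3), expFun k ((ω, (v, u)) : Coll).2.2 =
      expFun 0 v * expFun k u := fun ω v u => by rw [hE0, one_mul]
  have cf : Continuous (fun p : Coll => p.2.1) := by fun_prop
  have cs : Continuous (fun p : Coll => p.2.2) := by fun_prop
  have iV := integrable_weight_expFun continuous_collV (norm_orthPart_le k) (norm_alongPart_le k)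
    (expFun_collV k) hg hm hb
  have iU := integrable_weight_expFun continuous_collU (norm_alongPart_le k) (norm_orthPart_le k)
    (expFun_collU k) hg hm hb
  have iv := integrable_weight_expFun cf (K := fun _ => k) (K' := fun _ => 0) (fun _ => le_rfl) n0
    hfst hg hm hb
  have iu := integrable_weight_expFun cs (K := fun _ => 0) (K' := fun _ => k) n0 (fun _ => le_rfl)
    hsnd hg hm hb
  have sV := hρ.integral_expFun_swap hk continuous_collV (norm_orthPart_le k) (norm_alongPart_le k)
    (expFun_collV k) (fun z => ⟨fun t => Real.exp (inner ℝ k z.1 + t - ‖k‖ ^ 2 / 2), fun ω => by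
      unfold expFun
      congr 1
      simp only [collV, postV, inner_sub_right, inner_sub_left, inner_smul_right]
      ring⟩) hg
  have sU := hρ.integral_expFun_swap hk continuous_collU (norm_alongPart_le k) (norm_orthPart_le k)
    (expFun_collU k) (fun z => ⟨fun t => Real.exp (inner ℝ k z.2 - t - ‖k‖ ^ 2 / 2), fun ω => by
      unfold expFun
      congr 1
      simp only [collU, postU, inner_add_right, inner_sub_left, inner_smul_right]
      ring⟩) hg
  have sv := hρ.integral_expFun_swap hk cf (K := fun _ => k) (K' := fun _ => 0) (fun _ => le_rfl) n0
    hfst (fun z => ⟨fun _ => expFun k z.1, fun ω => rfl⟩) hg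
  have su := hρ.integral_expFun_swap hk cs (K := fun _ => 0) (K' := fun _ => k) n0 (fun _ => le_rfl)
    hsnd (fun z => ⟨fun _ => expFun k z.2, fun ω => rfl⟩) hg
  have jV := hρ.integrable_angle_inner k (continuous_orthPart k) (norm_orthPart_le k) g
  have jU := hρ.integrable_angle_inner k (continuous_alongPart k) (norm_alongPart_le k) g
  have jv := hρ.integrable_angle_inner k (K := fun _ => k) continuous_const (fun _ => le_rfl) g
  have ju := hρ.integrable_angle_inner k (K := fun _ => 0) continuous_const n0 g
  simp_rw [← inner_expLp] at sV sU sv su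
  have e1 : ∫ p, collDiff (expLp k) p * g p.2.1 ∂(collWeight ρ) =
      ∫ p, collDiff (expFun k) p * g p.2.1 ∂(collWeight ρ) := by
    refine integral_congr_ae ?_
    filter_upwards [hρ.collDiff_congr (memLp_expFun k).coeFn_toLp] with p hp
    rw [expLp, hp]
  have e2 : ∀ p, ρ (collAngle p) * (collDiff (expFun k) p * g p.2.1) =
      ρ (collAngle p) * (expFun k (collV p) * g p.2.1) +
      ρ (collAngle p) * (expFun k (collU p) * g p.2.1) -
      ρ (collAngle p) * (expFun k p.2.1 * g p.2.1) -
      ρ (collAngle p) * (expFun k p.2.2 * g p.2.1) := fun p => by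
    unfold collDiff; ring
  have i5 : Integrable (fun p => ρ (collAngle p) * (expFun k (collV p) * g p.2.1) +
      ρ (collAngle p) * (expFun k (collU p) * g p.2.1)) collMeasure := iV.add iU
  have i6 : Integrable (fun p => ρ (collAngle p) * (expFun k (collV p) * g p.2.1) +
      ρ (collAngle p) * (expFun k (collU p) * g p.2.1) -
      ρ (collAngle p) * (expFun k p.2.1 * g p.2.1)) collMeasure := i5.sub iv
  have j5 : Integrable (fun ω : S2 => ρ (InnerProductGeometry.angle k ω) *
      inner ℝ (expLp (orthPart k ω)) g + ρ (InnerProductGeometry.angle k ω) *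
      inner ℝ (expLp (alongPart k ω)) g) sphereMeasure := jV.add jU
  rw [inner_op, e1, hρ.integral_collWeight]
  simp_rw [e2]
  rw [integral_sub i6 iu, integral_sub i5 iv, integral_add iV iU, sV, sU, sv, su]
  simp_rw [mul_sub, mul_add]
  -- The loss term at `v` is `-expLp k`, which cancels the identity contained in `op`.
  have ec : ∫ ω : S2, ρ (InnerProductGeometry.angle k ω) * inner ℝ (expLp k) g ∂sphereMeasure =
      inner ℝ (expLp k) g := by
    rw [integral_mul_const, hρ.integral_eq_one k hk, one_mul]
  rw [integral_sub j5 ju, integral_add jV jU, ec]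
  ring

/-- `op` fixes the invariants and `expLp 0` is a combination of them, so subtracting macroscopic
parts removes the constant term of Bobylev's formula. -/
theorem inner_op_microExp (k : V3) (g : Lp ℝ 2 gauss) :
    inner ℝ (hρ.op (microExp k)) g = ∫ ω : S2, ρ (InnerProductGeometry.angle k ω) *
      (inner ℝ (microExp (orthPart k ω)) g + inner ℝ (microExp (alongPart k ω)) g)
        ∂sphereMeasure := by
  by_cases hk : k = 0
  · subst hk
    simp [microExp_zero, InnerProductGeometry.angle_zero_left, hρ.half_pi]
  have h0 : inner ℝ (expLp 0) g = ∑ i, invCoeff i 0 * inner ℝ (invLp i) g := by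
    have := inner_microExp 0 g
    rw [microExp_zero, inner_zero_left] at this
    linarith
  have e : ∀ ω : S2, ρ (InnerProductGeometry.angle k ω) *
      (inner ℝ (microExp (orthPart k ω)) g + inner ℝ (microExp (alongPart k ω)) g) =
      ρ (InnerProductGeometry.angle k ω) *
      (inner ℝ (expLp (orthPart k ω)) g + inner ℝ (expLp (alongPart k ω)) g -
        inner ℝ (expLp 0) g) - ρ (InnerProductGeometry.angle k ω) *
        ∑ i, invCoeff i k * inner ℝ (invLp i) g := fun ω => by
    rw [inner_microExp, inner_microExp, h0, ← mul_sub]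
    congr 1
    have : ∑ i, invCoeff i (orthPart k ω) * inner ℝ (invLp i) g +
        ∑ i, invCoeff i (alongPart k ω) * inner ℝ (invLp i) g =
        ∑ i, invCoeff i k * inner ℝ (invLp i) g + ∑ i, invCoeff i 0 * inner ℝ (invLp i) g := by
      rw [← Finset.sum_add_distrib, ← Finset.sum_add_distrib]
      refine Finset.sum_congr rfl fun i _ => ?_
      rw [← add_mul, ← add_mul, invCoeff_add]
    linarith
  have n0 : ∀ ω : S2, ‖(0 : V3)‖ ≤ ‖k‖ := fun _ => by simp
  have jV := hρ.integrable_angle_inner k (continuous_orthPart k) (norm_orthPart_le k) g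
  have jU := hρ.integrable_angle_inner k (continuous_alongPart k) (norm_alongPart_le k) g
  have ju := hρ.integrable_angle_inner k (K := fun _ => 0) continuous_const n0 g
  have j : Integrable (fun ω : S2 => ρ (InnerProductGeometry.angle k ω) *
      (inner ℝ (expLp (orthPart k ω)) g + inner ℝ (expLp (alongPart k ω)) g -
        inner ℝ (expLp 0) g)) sphereMeasure := by
    refine ((jV.add jU).sub ju).congr (Filter.Eventually.of_forall fun ω => ?_)
    simp only [Pi.sub_apply, Pi.add_apply]; ring
  have j1 : Integrable (fun ω : S2 => ρ (InnerProductGeometry.angle k ω) *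
      ∑ i, invCoeff i k * inner ℝ (invLp i) g) sphereMeasure :=
    hρ.integrable_mul measurable_const (fun _ => le_rfl) k
  simp_rw [e]
  rw [integral_sub j j1, ← hρ.inner_op_expLp hk, integral_mul_const, hρ.integral_eq_one k hk,
    one_mul]
  conv_lhs => rw [microExp, map_sub, map_sum]
  simp_rw [map_smul, hρ.op_invLp]
  rw [inner_sub_left, sum_inner]
  simp_rw [real_inner_smul_left]

end AngularDensity

/-! ### Spectral gap for bounded kernels -/

/-- If the iterates of a symmetric operator decay geometrically at a vector, then so does the first
one (log-convexity of `n ↦ ‖Tⁿ h‖`). -/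
theorem norm_le_of_iterate_le {H : Type*} [NormedAddCommGroup H] [InnerProductSpace ℝ H]
    (T : H →L[ℝ] H) (hT : ∀ g h, inner ℝ (T g) h = inner ℝ g (T h)) {r : ℝ} (hr : 0 ≤ r) {h : H}
    {C : ℝ} (hC : ∀ n : ℕ, ‖(T ^ n) h‖ ≤ C * r ^ n) : ‖T h‖ ≤ r * ‖h‖ := by
  by_contra! hlt
  have hTn : ∀ n, (T ^ (n + 1)) h = T ((T ^ n) h) := fun n => by
    rw [pow_succ']; rfl
  -- Symmetry and Cauchy–Schwarz: the sequence of norms is log-convex.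
  have hconv : ∀ n, ‖(T ^ (n + 1)) h‖ ^ 2 ≤ ‖(T ^ n) h‖ * ‖(T ^ (n + 2)) h‖ := fun n => by
    rw [← real_inner_self_eq_norm_sq]
    conv_lhs => rw [hTn n]
    rw [hT, ← hTn n, ← hTn (n + 1)]
    exact real_inner_le_norm _ _
  have hTh : 0 < ‖T h‖ := lt_of_le_of_lt (by positivity) hlt
  have hh : 0 < ‖h‖ := by
    rw [norm_pos_iff]; rintro rfl; simp at hTh
  set q := ‖T h‖ / ‖h‖ with hq
  have hqp : 0 < q := by positivity
  have hrq : r < q := by rw [hq, lt_div_iff₀ hh]; exact hlt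
  -- Log-convexity makes the successive ratios nondecreasing. A first ratio `q > r` would force
  -- growth at least like `qⁿ`, against the assumed bound `C rⁿ`.
  have hpos : ∀ n, 0 < ‖(T ^ n) h‖ ∧ q * ‖(T ^ n) h‖ ≤ ‖(T ^ (n + 1)) h‖ := by
    intro n
    induction n with
    | zero =>
      refine ⟨by simpa using hh, ?_⟩
      simp only [pow_zero, zero_add, pow_one]
      change q * ‖h‖ ≤ ‖T h‖
      rw [hq, div_mul_cancel₀ _ hh.ne']
    | succ n ih =>
      have h1 : 0 < ‖(T ^ (n + 1)) h‖ := lt_of_lt_of_le (mul_pos hqp ih.1) ih.2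
      refine ⟨h1, ?_⟩
      have h2 := hconv n
      have h3 : ‖(T ^ n) h‖ * (q * ‖(T ^ (n + 1)) h‖) ≤ ‖(T ^ n) h‖ * ‖(T ^ (n + 2)) h‖ := by
        refine le_trans ?_ h2
        nlinarith [ih.2]
      exact le_of_mul_le_mul_left h3 ih.1
  have hlow : ∀ n, q ^ n * ‖h‖ ≤ ‖(T ^ n) h‖ := by
    intro n
    induction n with
    | zero => simp
    | succ n ih =>
      refine le_trans ?_ (hpos n).2
      rw [pow_succ', mul_assoc]
      gcongr
  have hbdd : ∀ n : ℕ, ‖h‖ * q ^ n ≤ C * r ^ n := fun n => by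
    rw [mul_comm]; exact (hlow n).trans (hC n)
  have hrq1 : r / q < 1 := (div_lt_one hqp).2 hrq
  have hlim := (tendsto_pow_atTop_nhds_zero_of_lt_one (by positivity : 0 ≤ r / q) hrq1).const_mul C
  rw [mul_zero] at hlim
  obtain ⟨n, hn⟩ := (hlim.eventually (gt_mem_nhds hh)).exists
  have := hbdd n
  rw [div_pow, ← mul_div_assoc, div_lt_iff₀ (by positivity)] at hn
  linarith

/-- The traceless quadratic form `(k · l)² - |k|² |l|² / 3`. -/
def traceless (l k : V3) : ℝ := inner ℝ k l ^ 2 - ‖k‖ ^ 2 * ‖l‖ ^ 2 / 3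

theorem continuous_traceless (l : V3) : Continuous (traceless l) := by
  unfold traceless; fun_prop

theorem abs_traceless_le (l k : V3) : |traceless l k| ≤ ‖k‖ ^ 2 * ‖l‖ ^ 2 := by
  unfold traceless
  have h := abs_real_inner_le_norm k l
  have h2 : inner ℝ k l ^ 2 ≤ ‖k‖ ^ 2 * ‖l‖ ^ 2 := by
    rw [← sq_abs, ← mul_pow]; gcongr
  have : 0 ≤ ‖k‖ ^ 2 * ‖l‖ ^ 2 := by positivity
  rw [abs_le]; constructor <;> nlinarith [sq_nonneg (inner ℝ k l : ℝ)]

/-! ### Angular moments -/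

namespace AngularDensity

variable {ρ : ℝ → ℝ} {κ : ℝ} (hρ : AngularDensity ρ κ)
include hρ

/-- Pointwise, `cos² sin² ≤ 1/4`. The bound is needed for `0 ≤ 1 - 3κ ≤ 1 - κ`, which makes the
quadratic mode decay at least as fast as the cubic remainder. -/
theorem kappa_le : κ ≤ 1 / 4 := by
  have ha : stdVec 0 ≠ 0 := by
    intro h; have := norm_stdVec 0; rw [h, norm_zero] at this; norm_num at this
  have h1 := hρ.integral_eq (stdVec 0) ha
  have h2 := hρ.integral_eq_one (stdVec 0) ha
  have hm : Measurable fun ω : S2 => InnerProductGeometry.angle (stdVec 0) (ω : V3) :=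
    RotBoltzmann.measurable_angle measurable_const measurable_subtype_coe
  have key : ∀ t : ℝ, Real.cos t ^ 2 * Real.sin t ^ 2 ≤ 1 / 4 := fun t => by
    nlinarith [Real.sin_sq_add_cos_sq t, sq_nonneg (Real.cos t ^ 2 - Real.sin t ^ 2)]
  have h3 : ∫ ω : S2, 1 / 4 * ρ (InnerProductGeometry.angle (stdVec 0) ω) ∂sphereMeasure = 1 / 4 := by
    rw [integral_const_mul, h2, mul_one]
  rw [← h1, ← h3]
  have hcs : Measurable fun ω : S2 =>
      Real.cos (InnerProductGeometry.angle (stdVec 0) (ω : V3)) ^ 2 *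
      Real.sin (InnerProductGeometry.angle (stdVec 0) (ω : V3)) ^ 2 :=
    ((Real.measurable_cos.comp hm).pow_const 2).mul ((Real.measurable_sin.comp hm).pow_const 2)
  refine integral_mono (hρ.integrable_mul hcs (C := 1 / 4) (fun ω => ?_) _) ?_ fun ω => ?_
  · rw [abs_of_nonneg (by positivity)]; exact key _
  · have := hρ.integrable_mul (F := fun _ => 1) measurable_const (C := 1) (by simp) (stdVec 0)
    simp only [mul_one] at this
    exact this.const_mul _
  · simp only
    rw [mul_comm (1 / 4 : ℝ)]
    exact mul_le_mul_of_nonneg_left (key _) (hρ.nonneg_angle _ _)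

/-- The mean cubic growth factor is bounded by `1 - κ`. -/
theorem integral_cube_le (k : V3) :
    ∫ ω : S2, ρ (InnerProductGeometry.angle k ω) *
      (‖orthPart k ω‖ ^ 3 + ‖alongPart k ω‖ ^ 3) ∂sphereMeasure ≤ (1 - κ) * ‖k‖ ^ 3 := by
  by_cases hk : k = 0
  · subst hk
    simp [InnerProductGeometry.angle_zero_left, hρ.half_pi]
  have hm : Measurable fun ω : S2 => InnerProductGeometry.angle k (ω : V3) :=
    RotBoltzmann.measurable_angle measurable_const measurable_subtype_coe
  -- With `a = |sin t|`, `b = |cos t|` one has `a²b² = a²(1 - a)(1 + a) ≤ 2(a² - a³)`, and likewise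
  -- with `a`, `b` exchanged; adding the two gives the claim.
  have key : ∀ t : ℝ, |Real.sin t| ^ 3 + |Real.cos t| ^ 3 ≤
      1 - Real.cos t ^ 2 * Real.sin t ^ 2 := fun t => by
    have h := Real.sin_sq_add_cos_sq t
    rw [← sq_abs (Real.sin t), ← sq_abs (Real.cos t)] at h ⊢
    have ha := abs_nonneg (Real.sin t)
    have hb := abs_nonneg (Real.cos t)
    set a := |Real.sin t|
    set b := |Real.cos t|
    have ha1 : a ≤ 1 := by nlinarith
    have hb1 : b ≤ 1 := by nlinarith
    have e1 : a ^ 2 * b ^ 2 ≤ 2 * (a ^ 2 * (1 - a)) := by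
      have : b ^ 2 = (1 - a) * (1 + a) := by linarith
      rw [this]
      nlinarith [mul_nonneg (sq_nonneg a) (sub_nonneg.2 ha1),
        mul_nonneg (mul_nonneg (sq_nonneg a) (sub_nonneg.2 ha1)) (sub_nonneg.2 ha1)]
    have e2 : b ^ 2 * a ^ 2 ≤ 2 * (b ^ 2 * (1 - b)) := by
      have : a ^ 2 = (1 - b) * (1 + b) := by linarith
      rw [this]
      nlinarith [mul_nonneg (sq_nonneg b) (sub_nonneg.2 hb1),
        mul_nonneg (mul_nonneg (sq_nonneg b) (sub_nonneg.2 hb1)) (sub_nonneg.2 hb1)]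
    nlinarith
  have hc1 : ∀ t, |1 - Real.cos t ^ 2 * Real.sin t ^ 2| ≤ 1 := fun t => by
    have h := Real.sin_sq_add_cos_sq t
    have : 0 ≤ Real.cos t ^ 2 * Real.sin t ^ 2 := by positivity
    rw [abs_le]; constructor <;> nlinarith [sq_nonneg (Real.cos t ^ 2 - Real.sin t ^ 2)]
  have hcs : Measurable fun ω : S2 => Real.cos (InnerProductGeometry.angle k (ω : V3)) ^ 2 *
      Real.sin (InnerProductGeometry.angle k (ω : V3)) ^ 2 :=
    ((Real.measurable_cos.comp hm).pow_const 2).mul ((Real.measurable_sin.comp hm).pow_const 2)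
  have i0 := hρ.integrable_mul (F := fun _ => 1) measurable_const (C := 1) (by simp) k
  simp only [mul_one] at i0
  have i1 := hρ.integrable_mul hcs (C := 1) (fun ω => by
    have h := Real.sin_sq_add_cos_sq (InnerProductGeometry.angle k (ω : V3))
    rw [abs_of_nonneg (by positivity)]
    nlinarith [sq_nonneg (Real.cos (InnerProductGeometry.angle k (ω : V3)) ^ 2 -
      Real.sin (InnerProductGeometry.angle k (ω : V3)) ^ 2)]) k
  have e : (1 - κ) * ‖k‖ ^ 3 = ∫ ω : S2, (ρ (InnerProductGeometry.angle k ω) -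
      ρ (InnerProductGeometry.angle k ω) * (Real.cos (InnerProductGeometry.angle k (ω : V3)) ^ 2 *
        Real.sin (InnerProductGeometry.angle k (ω : V3)) ^ 2)) * ‖k‖ ^ 3 ∂sphereMeasure := by
    rw [integral_mul_const, integral_sub i0 i1, hρ.integral_eq_one k hk, hρ.integral_eq k hk]
  rw [e]
  refine integral_mono (hρ.integrable_mul (C := 2 * ‖k‖ ^ 3) ?_ (fun ω => ?_) _)
    ((i0.sub i1).mul_const _) fun ω => ?_
  · exact (((continuous_orthPart k).norm.pow 3).add ((continuous_alongPart k).norm.pow 3)).measurable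
  · rw [abs_of_nonneg (by positivity)]
    have h1 : ‖orthPart k ω‖ ^ 3 ≤ ‖k‖ ^ 3 := by gcongr; exact norm_orthPart_le _ _
    have h2 : ‖alongPart k ω‖ ^ 3 ≤ ‖k‖ ^ 3 := by gcongr; exact norm_alongPart_le _ _
    linarith
  · simp only
    rw [norm_orthPart, norm_alongPart, mul_pow, mul_pow, ← mul_add]
    have h1 := mul_le_mul_of_nonneg_left (key (InnerProductGeometry.angle k (ω : V3)))
      (mul_nonneg (hρ.nonneg_angle k ω) (by positivity : 0 ≤ ‖k‖ ^ 3))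
    linarith

/-- The quadratic moment of an angular density in a direction orthogonal to the axis. -/
theorem integral_orth_sq {k m : V3} (hk : k ≠ 0) (hkm : inner ℝ k m = (0 : ℝ)) :
    ∫ ω : S2, ρ (InnerProductGeometry.angle k ω) *
      (inner ℝ k (ω : V3) ^ 2 * inner ℝ m (ω : V3) ^ 2) ∂sphereMeasure =
      κ / 2 * ‖k‖ ^ 2 * ‖m‖ ^ 2 := by
  have hkp := norm_pos_iff.2 hk
  set J : V3 → ℝ := fun m => ∫ ω : S2, ρ (InnerProductGeometry.angle k ω) *
      (inner ℝ k (ω : V3) ^ 2 * inner ℝ m (ω : V3) ^ 2) ∂sphereMeasure with hJ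
  -- A reflection exchanging two vectors orthogonal to `k` fixes `k`, so the moment depends only on
  -- the length.
  have hinv : ∀ m₁ m₂ : V3, ‖m₁‖ = ‖m₂‖ → inner ℝ k m₁ = (0 : ℝ) → inner ℝ k m₂ = (0 : ℝ) →
      J m₁ = J m₂ := by
    intro m₁ m₂ hn h1 h2
    obtain ⟨R, e1, -, hs, hf⟩ := exists_swap_isometry hn
    have hRk := hf k h1 h2
    simp only [hJ]
    rw [← integral_sphereMap R fun ω => ρ (InnerProductGeometry.angle k ω) *
      (inner ℝ k (ω : V3) ^ 2 * inner ℝ m₁ (ω : V3) ^ 2)]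
    congr 1; ext ω
    rw [coe_sphereMap]
    congr 2
    · conv_lhs => rw [← hRk]
      rw [angle_isometry]
    · rw [← hs, hRk]
    · rw [← hs, e1]
  -- `m'` completes `k`, `m` to an orthogonal triple and has length `‖k‖‖m‖`. The moments along `m`
  -- and `m'` are therefore proportional, and the Gram identity expresses their sum through the
  -- component of `ω` orthogonal to `k`, whose weighted mean is `κ`.
  set m' : V3 := cross k m with hm'
  have c1 : inner ℝ k m' = (0 : ℝ) := by
    simp only [hm', cross, PiLp.inner_apply, Fin.sum_univ_three, cross_apply]
    simp; ring
  have gram : ∀ ω : V3, inner ℝ k m = (0 : ℝ) → inner ℝ m' ω ^ 2 = ‖k‖ ^ 2 * ‖m‖ ^ 2 * ‖ω‖ ^ 2 -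
      ‖k‖ ^ 2 * inner ℝ m ω ^ 2 - ‖m‖ ^ 2 * inner ℝ k ω ^ 2 := by
    intro ω h0
    have hid : inner ℝ m' ω ^ 2 = ‖k‖ ^ 2 * ‖m‖ ^ 2 * ‖ω‖ ^ 2 +
        2 * inner ℝ k m * inner ℝ m ω * inner ℝ k ω -
      ‖k‖ ^ 2 * inner ℝ m ω ^ 2 - ‖m‖ ^ 2 * inner ℝ k ω ^ 2 - ‖ω‖ ^ 2 * inner ℝ k m ^ 2 := by
      simp only [norm_sq_eq, hm', cross, PiLp.inner_apply, Fin.sum_univ_three, cross_apply]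
      simp; ring
    rw [hid, h0]; ring
  have c2 : ‖m'‖ = ‖‖k‖ • m‖ := by
    rw [← sq_eq_sq₀ (norm_nonneg _) (norm_nonneg _), norm_smul, mul_pow, norm_norm]
    simp only [norm_sq_eq] at *
    simp only [PiLp.inner_apply, Fin.sum_univ_three] at hkm
    simp at hkm
    simp only [hm', cross, cross_apply]
    simp
    linear_combination (-(k 0 * m 0 + k 1 * m 1 + k 2 * m 2)) * hkm
  have c3 : J m' = ‖k‖ ^ 2 * J m := by
    rw [hinv m' (‖k‖ • m) c2 c1 (by rw [inner_smul_right, hkm, mul_zero])]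
    simp only [hJ, real_inner_smul_left]
    rw [← integral_const_mul]
    congr 1; ext ω; ring
  have bd : ∀ (x : V3) (ω : S2), |inner ℝ k (ω : V3) ^ 2 * inner ℝ x (ω : V3) ^ 2| ≤
      ‖k‖ ^ 2 * ‖x‖ ^ 2 := fun x ω => by
    rw [abs_of_nonneg (by positivity), ← sq_abs (inner ℝ k _ : ℝ), ← sq_abs (inner ℝ x _ : ℝ)]
    have h1 := abs_real_inner_le_norm k (ω : V3)
    have h2 := abs_real_inner_le_norm x (ω : V3)
    rw [norm_eq_of_mem_sphere, mul_one] at h1 h2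
    gcongr
  have int : ∀ x : V3, Integrable (fun ω : S2 => ρ (InnerProductGeometry.angle k ω) *
      (inner ℝ k (ω : V3) ^ 2 * inner ℝ x (ω : V3) ^ 2)) sphereMeasure := fun x =>
    hρ.integrable_mul (Continuous.measurable (by fun_prop)) (bd x) k
  have sum : J m' + ‖k‖ ^ 2 * J m = ‖m‖ ^ 2 * (κ * ‖k‖ ^ 4) := by
    rw [← hρ.integral_eq k hk]
    simp only [hJ]
    rw [← integral_const_mul, ← integral_mul_const, ← integral_const_mul,
      ← integral_add (int m') ((int m).const_mul _)]
    congr 1; ext ω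
    rw [gram ω hkm, norm_eq_of_mem_sphere, inner_eq_norm_mul_cos k, Real.sin_sq]
    ring
  rw [c3] at sum
  have h2 : (0 : ℝ) < 2 * ‖k‖ ^ 2 := by positivity
  refine mul_left_cancel₀ h2.ne' ?_
  linear_combination sum

omit hρ in
/-- Odd moments orthogonal to the axis vanish. -/
theorem integral_orth_odd {k m : V3} (hkm : inner ℝ k m = (0 : ℝ)) (F : ℝ → ℝ) :
    ∫ ω : S2, ρ (InnerProductGeometry.angle k ω) *
      (F (inner ℝ k (ω : V3)) * inner ℝ m (ω : V3)) ∂sphereMeasure = 0 := by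
  obtain ⟨R, e1, -, hs, hf⟩ := exists_swap_isometry (a := m) (b := -m) (by simp)
  have hRk := hf k hkm (by rw [inner_neg_right, hkm, neg_zero])
  have h := integral_sphereMap R fun ω => ρ (InnerProductGeometry.angle k ω) *
      (F (inner ℝ k (ω : V3)) * inner ℝ m (ω : V3))
  have e : ∀ ω : S2, ρ (InnerProductGeometry.angle k (sphereMap R ω)) *
      (F (inner ℝ k (sphereMap R ω : V3)) * inner ℝ m (sphereMap R ω : V3)) =
      -(ρ (InnerProductGeometry.angle k ω) *
      (F (inner ℝ k (ω : V3)) * inner ℝ m (ω : V3))) := fun ω => by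
    rw [coe_sphereMap, ← hs, ← hs, hRk, e1, inner_neg_left]
    conv_lhs => rw [← hRk]
    rw [angle_isometry, hRk]; ring
  simp_rw [e, integral_neg] at h
  linarith

/-- Traceless quadratic forms are eigenfunctions. -/
theorem integral_traceless (l k : V3) :
    ∫ ω : S2, ρ (InnerProductGeometry.angle k ω) *
      (traceless l (orthPart k ω) + traceless l (alongPart k ω)) ∂sphereMeasure =
      (1 - 3 * κ) * traceless l k := by
  by_cases hk : k = 0
  · subst hk
    simp [InnerProductGeometry.angle_zero_left, hρ.half_pi, traceless]
  have hkp := norm_pos_iff.2 hk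
  -- Split `l = m + a k` with `m` orthogonal to `k`.
  set a : ℝ := inner ℝ k l / ‖k‖ ^ 2 with ha
  set m : V3 := l - a • k with hm
  have hal : inner ℝ k l = a * ‖k‖ ^ 2 := by rw [ha]; field_simp
  have hkm : inner ℝ k m = (0 : ℝ) := by
    rw [hm, inner_sub_right, inner_smul_right, real_inner_self_eq_norm_sq, hal]; ring
  have hl : l = m + a • k := by rw [hm]; abel
  have hmn : ‖l‖ ^ 2 = ‖m‖ ^ 2 + a ^ 2 * ‖k‖ ^ 2 := by
    rw [hl, norm_add_sq_real, inner_smul_right, real_inner_comm, hkm, norm_smul, mul_pow,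
      Real.norm_eq_abs, sq_abs]; ring
  have bk : ∀ ω : S2, |inner ℝ k (ω : V3)| ≤ ‖k‖ := fun ω => by
    have := abs_real_inner_le_norm k (ω : V3)
    rwa [norm_eq_of_mem_sphere, mul_one] at this
  have bm : ∀ ω : S2, |inner ℝ m (ω : V3)| ≤ ‖m‖ := fun ω => by
    have := abs_real_inner_le_norm m (ω : V3)
    rwa [norm_eq_of_mem_sphere, mul_one] at this
  have bc : ∀ F : ℝ → ℝ, Continuous F → ∀ G : ℝ → ℝ, Continuous G →
      Integrable (fun ω : S2 => ρ (InnerProductGeometry.angle k ω) *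
      (F (inner ℝ k (ω : V3)) * G (inner ℝ m (ω : V3)))) sphereMeasure := by
    intro F hF G hG
    have hc : Continuous fun ω : S2 => F (inner ℝ k (ω : V3)) * G (inner ℝ m (ω : V3)) :=
      (hF.comp (by fun_prop)).mul (hG.comp (by fun_prop))
    obtain ⟨C, hC⟩ := isCompact_univ.exists_bound_of_continuousOn hc.continuousOn
    exact hρ.integrable_mul hc.measurable (fun ω => hC ω (mem_univ _)) k
  have i1 := bc (fun c => c ^ 2 * (‖k‖ ^ 2 - c ^ 2)) (by fun_prop) (fun _ => 1) (by fun_prop)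
  have i2 := bc (fun c => a * c * (‖k‖ ^ 2 - 2 * c ^ 2)) (by fun_prop) (fun t => t) (by fun_prop)
  have i3 := bc (fun c => c ^ 2) (by fun_prop) (fun t => t ^ 2) (by fun_prop)
  have i0 := bc (fun _ => 1) (by fun_prop) (fun _ => 1) (by fun_prop)
  simp only [mul_one] at i0 i1
  -- The trace parts cancel by Pythagoras. After integration the mixed term is odd in `m` and
  -- vanishes; the other two give `κ(2a²|k|⁴ - |k|²|m|²)`, which is `3κ` times `traceless l k`.
  have e : ∀ ω : S2, ρ (InnerProductGeometry.angle k ω) *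
      (traceless l (orthPart k ω) + traceless l (alongPart k ω)) =
      ρ (InnerProductGeometry.angle k ω) * traceless l k -
      2 * (a ^ 2 * (ρ (InnerProductGeometry.angle k ω) *
        (inner ℝ k (ω : V3) ^ 2 * (‖k‖ ^ 2 - inner ℝ k (ω : V3) ^ 2))) +
      ρ (InnerProductGeometry.angle k ω) *
        (a * inner ℝ k (ω : V3) * (‖k‖ ^ 2 - 2 * inner ℝ k (ω : V3) ^ 2) * inner ℝ m (ω : V3)) -
      ρ (InnerProductGeometry.angle k ω) *
        (inner ℝ k (ω : V3) ^ 2 * inner ℝ m (ω : V3) ^ 2)) := fun ω => by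
    have hlω : inner ℝ (ω : V3) l = inner ℝ m (ω : V3) + a * inner ℝ k (ω : V3) := by
      rw [real_inner_comm]
      conv_lhs => rw [hl]
      rw [inner_add_left, real_inner_smul_left]
    unfold traceless
    rw [norm_sq_orthPart, norm_sq_alongPart]
    simp only [orthPart, alongPart, inner_sub_left, real_inner_smul_left]
    rw [hlω, hal]; ring
  have hsc : ∫ ω : S2, ρ (InnerProductGeometry.angle k ω) *
        (inner ℝ k (ω : V3) ^ 2 * (‖k‖ ^ 2 - inner ℝ k (ω : V3) ^ 2)) ∂sphereMeasure =
      κ * ‖k‖ ^ 4 := by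
    rw [← hρ.integral_eq k hk, ← integral_mul_const]
    congr 1; ext ω
    rw [inner_eq_norm_mul_cos k, Real.sin_sq]; ring
  have j1 := i1.const_mul (a ^ 2)
  have j2 : Integrable (fun ω : S2 => a ^ 2 * (ρ (InnerProductGeometry.angle k ω) *
        (inner ℝ k (ω : V3) ^ 2 * (‖k‖ ^ 2 - inner ℝ k (ω : V3) ^ 2))) +
      ρ (InnerProductGeometry.angle k ω) *
        (a * inner ℝ k (ω : V3) * (‖k‖ ^ 2 - 2 * inner ℝ k (ω : V3) ^ 2) * inner ℝ m (ω : V3)))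
      sphereMeasure := j1.add i2
  have j3 : Integrable (fun ω : S2 => a ^ 2 * (ρ (InnerProductGeometry.angle k ω) *
        (inner ℝ k (ω : V3) ^ 2 * (‖k‖ ^ 2 - inner ℝ k (ω : V3) ^ 2))) +
      ρ (InnerProductGeometry.angle k ω) *
        (a * inner ℝ k (ω : V3) * (‖k‖ ^ 2 - 2 * inner ℝ k (ω : V3) ^ 2) * inner ℝ m (ω : V3)) -
      ρ (InnerProductGeometry.angle k ω) *
        (inner ℝ k (ω : V3) ^ 2 * inner ℝ m (ω : V3) ^ 2))
      sphereMeasure := j2.sub i3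
  have hodd := integral_orth_odd (ρ := ρ) hkm fun c => a * c * (‖k‖ ^ 2 - 2 * c ^ 2)
  simp_rw [e]
  rw [integral_sub (i0.mul_const _) (j3.const_mul 2), integral_const_mul, integral_sub j2 i3,
    integral_add j1 i2, integral_const_mul, hsc, hodd, hρ.integral_orth_sq hk hkm,
    integral_mul_const, hρ.integral_eq_one k hk]
  unfold traceless
  rw [hal, hmn]
  ring

end AngularDensity

/-! ### Decay of the iterates and the spectral gap -/

/-- The orthogonal projection of `L²` onto the collision invariants. -/
def invProj : Lp ℝ 2 gauss →L[ℝ] Lp ℝ 2 gauss :=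
  ∑ i, (innerSL ℝ (invLp i)).smulRight (invLp i)

theorem invProj_apply (h : Lp ℝ 2 gauss) :
    invProj h = ∑ i, (inner ℝ (invLp i) h : ℝ) • invLp i := by
  simp [invProj]

theorem sub_invProj_expLp (k : V3) : expLp k - invProj (expLp k) = microExp k := by
  rw [invProj_apply, microExp]
  simp_rw [inner_invLp_expLp]

/-- A vector orthogonal to all exponentials vanishes by `ae_eq_zero_of_integral_mul_expFun`. -/
theorem span_expLp_dense : (Submodule.span ℝ (range expLp)).topologicalClosure = ⊤ := by
  rw [Submodule.topologicalClosure_eq_top_iff, Submodule.eq_bot_iff]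
  intro g hg
  rw [Submodule.mem_orthogonal] at hg
  have h0 := ae_eq_zero_of_integral_mul_expFun (Lp.memLp g) fun k => by
    have := hg _ (Submodule.subset_span ⟨k, rfl⟩)
    rw [inner_expLp] at this
    simpa only [mul_comm] using this
  exact Lp.ext (h0.trans (Lp.coeFn_zero _ _ _).symm)

theorem abs_exp_sub_quadratic_le (t : ℝ) :
    |Real.exp t - 1 - t - t ^ 2 / 2| ≤ |t| ^ 3 * Real.exp |t| := by
  have h := Complex.norm_exp_sub_sum_le_norm_mul_exp (t : ℂ) 3
  rw [Complex.norm_real, Real.norm_eq_abs] at h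
  refine le_of_eq_of_le ?_ h
  rw [← Real.norm_eq_abs, ← Complex.norm_real]
  congr 1
  simp [Finset.sum_range_succ]
  ring

theorem measurable_inner_microExp (g : Lp ℝ 2 gauss) :
    Measurable fun k : V3 => (inner ℝ (microExp k) g : ℝ) := by
  simp_rw [inner_microExp]
  refine (measurable_inner_expLp g).sub (Finset.measurable_sum _ fun i _ => ?_)
  refine Measurable.mul_const ?_ _
  unfold invCoeff
  fin_cases i <;> simp <;> fun_prop

namespace AngularDensity

variable {ρ : ℝ → ℝ} {κ : ℝ} (hρ : AngularDensity ρ κ)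
include hρ

/-- Asymptotics of the iterates of the averaging operator on exponentials. -/
theorem abs_inner_iterate_sub_le (l : V3) (n : ℕ) : ∀ k : V3, ‖k‖ ≤ ‖l‖ →
    |inner ℝ (microExp k) ((hρ.op ^ n) (microExp l)) - (1 - 3 * κ) ^ n / 2 * traceless l k| ≤
      (‖l‖ ^ 3 * Real.exp (‖l‖ ^ 2)) * (1 - κ) ^ n * ‖k‖ ^ 3 := by
  induction n with
  -- Half the traceless form is exactly the quadratic Taylor term left by the projection, so only
  -- the cubic remainder of the exponential has to be bounded.
  | zero =>
    intro k hk
    simp only [pow_zero, mul_one, one_apply_eq_self]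
    rw [inner_microExp_microExp, traceless]
    have h := abs_exp_sub_quadratic_le (inner ℝ k l)
    have hkl := abs_real_inner_le_norm k l
    have e : Real.exp (inner ℝ k l) - 1 - inner ℝ k l - ‖k‖ ^ 2 * ‖l‖ ^ 2 / 6 -
        1 / 2 * (inner ℝ k l ^ 2 - ‖k‖ ^ 2 * ‖l‖ ^ 2 / 3) =
        Real.exp (inner ℝ k l) - 1 - inner ℝ k l - inner ℝ k l ^ 2 / 2 := by ring
    rw [e]
    refine h.trans ?_
    calc |inner ℝ k l| ^ 3 * Real.exp |inner ℝ k l|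
        ≤ (‖k‖ * ‖l‖) ^ 3 * Real.exp (‖l‖ ^ 2) := by
          gcongr
          refine hkl.trans ?_
          rw [sq]; gcongr
      _ = _ := by ring
  | succ n ih =>
    intro k hk
    have hκ0 := hρ.pos
    have hκ1 := hρ.kappa_le
    set g := (hρ.op ^ n) (microExp l) with hg
    -- One factor of `op` is moved onto `microExp k` and expanded. Both components of `k` stay in
    -- the ball of radius `‖l‖`, so the induction hypothesis applies to them; the traceless form is
    -- multiplied by `1 - 3κ` and the cubic error by at most `1 - κ`.
    have hT : inner ℝ (microExp k) ((hρ.op ^ (n + 1)) (microExp l)) =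
        inner ℝ (hρ.op (microExp k)) g := by
      rw [op_symm, hg, pow_succ']; rfl
    set C := ‖l‖ ^ 3 * Real.exp (‖l‖ ^ 2) with hC
    have hC0 : 0 ≤ C * (1 - κ) ^ n :=
      mul_nonneg (by positivity) (pow_nonneg (by linarith) _)
    have mA : ∀ K : S2 → V3, Continuous K → (∀ ω, ‖K ω‖ ≤ ‖k‖) →
        Integrable (fun ω : S2 => ρ (InnerProductGeometry.angle k ω) *
          inner ℝ (microExp (K ω)) g) sphereMeasure := by
      intro K hK hKk
      refine hρ.integrable_mul ((measurable_inner_microExp g).comp hK.measurable)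
        (C := C * (1 - κ) ^ n * ‖k‖ ^ 3 + |(1 - 3 * κ) ^ n / 2| * (‖k‖ ^ 2 * ‖l‖ ^ 2)) (fun ω => ?_) k
      have h1 := ih (K ω) ((hKk ω).trans hk)
      have h2 := abs_traceless_le l (K ω)
      have h3 : ‖K ω‖ ^ 3 ≤ ‖k‖ ^ 3 := by gcongr; exact hKk ω
      have h4 : ‖K ω‖ ^ 2 * ‖l‖ ^ 2 ≤ ‖k‖ ^ 2 * ‖l‖ ^ 2 := by gcongr; exact hKk ω
      have h5 : |(1 - 3 * κ) ^ n / 2 * traceless l (K ω)| ≤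
          |(1 - 3 * κ) ^ n / 2| * (‖k‖ ^ 2 * ‖l‖ ^ 2) := by
        rw [abs_mul]
        exact mul_le_mul_of_nonneg_left (h2.trans h4) (abs_nonneg _)
      have h6 := mul_le_mul_of_nonneg_left h3 hC0
      have h7 := abs_sub_abs_le_abs_sub (inner ℝ (microExp (K ω)) g : ℝ)
        ((1 - 3 * κ) ^ n / 2 * traceless l (K ω))
      simp only [Function.comp]
      linarith
    have tA : Integrable (fun ω : S2 => ρ (InnerProductGeometry.angle k ω) *
        (traceless l (orthPart k ω) + traceless l (alongPart k ω))) sphereMeasure := by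
      have hc : Continuous fun ω => traceless l (orthPart k ω) + traceless l (alongPart k ω) :=
        ((continuous_traceless l).comp (continuous_orthPart k)).add
          ((continuous_traceless l).comp (continuous_alongPart k))
      obtain ⟨B, hB⟩ := isCompact_univ.exists_bound_of_continuousOn hc.continuousOn
      exact hρ.integrable_mul hc.measurable (fun ω => hB ω (mem_univ _)) k
    have iA : Integrable (fun ω : S2 => ρ (InnerProductGeometry.angle k ω) *
        (inner ℝ (microExp (orthPart k ω)) g + inner ℝ (microExp (alongPart k ω)) g))
        sphereMeasure := by
      refine ((mA _ (continuous_orthPart k) (norm_orthPart_le k)).add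
        (mA _ (continuous_alongPart k) (norm_alongPart_le k))).congr
        (Filter.Eventually.of_forall fun ω => ?_)
      simp only [Pi.add_apply]; ring
    have e1 : inner ℝ (hρ.op (microExp k)) g - (1 - 3 * κ) ^ (n + 1) / 2 * traceless l k =
        ∫ ω : S2, ρ (InnerProductGeometry.angle k ω) *
          (inner ℝ (microExp (orthPart k ω)) g + inner ℝ (microExp (alongPart k ω)) g) -
          (1 - 3 * κ) ^ n / 2 * (ρ (InnerProductGeometry.angle k ω) *
        (traceless l (orthPart k ω) + traceless l (alongPart k ω))) ∂sphereMeasure := by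
      rw [integral_sub iA (tA.const_mul _), integral_const_mul, hρ.integral_traceless,
        ← hρ.inner_op_microExp]
      ring
    have i3 : Integrable (fun ω : S2 => ρ (InnerProductGeometry.angle k ω) *
        (‖orthPart k ω‖ ^ 3 + ‖alongPart k ω‖ ^ 3)) sphereMeasure := by
      have hc : Continuous fun ω => ‖orthPart k ω‖ ^ 3 + ‖alongPart k ω‖ ^ 3 :=
        ((continuous_orthPart k).norm.pow 3).add ((continuous_alongPart k).norm.pow 3)
      obtain ⟨B, hB⟩ := isCompact_univ.exists_bound_of_continuousOn hc.continuousOn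
      exact hρ.integrable_mul hc.measurable (fun ω => hB ω (mem_univ _)) k
    rw [hT, e1]
    have hb : ∀ ω : S2, ‖ρ (InnerProductGeometry.angle k ω) *
          (inner ℝ (microExp (orthPart k ω)) g + inner ℝ (microExp (alongPart k ω)) g) -
          (1 - 3 * κ) ^ n / 2 * (ρ (InnerProductGeometry.angle k ω) *
        (traceless l (orthPart k ω) + traceless l (alongPart k ω)))‖ ≤
        (C * (1 - κ) ^ n) * (ρ (InnerProductGeometry.angle k ω) *
        (‖orthPart k ω‖ ^ 3 + ‖alongPart k ω‖ ^ 3)) := by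
      intro ω
      have h1 := ih _ ((norm_orthPart_le k ω).trans hk)
      have h2 := ih _ ((norm_alongPart_le k ω).trans hk)
      have h0 := hρ.nonneg_angle k ω
      have e : ρ (InnerProductGeometry.angle k ω) *
          (inner ℝ (microExp (orthPart k ω)) g + inner ℝ (microExp (alongPart k ω)) g) -
          (1 - 3 * κ) ^ n / 2 * (ρ (InnerProductGeometry.angle k ω) *
        (traceless l (orthPart k ω) + traceless l (alongPart k ω))) =
        ρ (InnerProductGeometry.angle k ω) *
        ((inner ℝ (microExp (orthPart k ω)) g - (1 - 3 * κ) ^ n / 2 * traceless l (orthPart k ω)) +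
        (inner ℝ (microExp (alongPart k ω)) g -
          (1 - 3 * κ) ^ n / 2 * traceless l (alongPart k ω))) := by ring
      rw [e, norm_mul, Real.norm_of_nonneg h0]
      have h3 := (abs_add_le _ _).trans (add_le_add h1 h2)
      calc _ ≤ ρ (InnerProductGeometry.angle k ω) * (C * (1 - κ) ^ n * ‖orthPart k ω‖ ^ 3 +
            C * (1 - κ) ^ n * ‖alongPart k ω‖ ^ 3) := mul_le_mul_of_nonneg_left h3 h0
        _ = _ := by ring
    refine (norm_integral_le_of_norm_le (i3.const_mul _)
      (Filter.Eventually.of_forall hb)).trans ?_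
    rw [integral_const_mul]
    calc _ ≤ (C * (1 - κ) ^ n) * ((1 - κ) * ‖k‖ ^ 3) :=
          mul_le_mul_of_nonneg_left (hρ.integral_cube_le k) hC0
      _ = _ := by ring

theorem op_pow_symm (n : ℕ) (g h : Lp ℝ 2 gauss) :
    inner ℝ ((hρ.op ^ n) g) h = inner ℝ g ((hρ.op ^ n) h) := by
  induction n generalizing g h with
  | zero => rfl
  | succ n ih =>
    have e1 : (hρ.op ^ (n + 1)) g = hρ.op ((hρ.op ^ n) g) := by rw [pow_succ']; rfl
    have e2 : (hρ.op ^ (n + 1)) h = (hρ.op ^ n) (hρ.op h) := by rw [pow_succ]; rfl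
    rw [e1, e2, op_symm, ih]

/-- Geometric decay of the iterates on the microscopic part of exponentials. -/
theorem exists_norm_iterate_microExp_le (l : V3) :
    ∃ C, ∀ n : ℕ, ‖(hρ.op ^ n) (microExp l)‖ ≤ C * (1 - κ) ^ n := by
  have hκ0 := hρ.pos
  have hκ1 := hρ.kappa_le
  set B := (‖l‖ ^ 3 * Real.exp (‖l‖ ^ 2)) * ‖l‖ ^ 3 + ‖l‖ ^ 2 * ‖l‖ ^ 2 with hB
  have hB0 : 0 ≤ B := by positivity
  refine ⟨Real.sqrt B, fun n => ?_⟩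
  have hr : 0 ≤ (1 - κ) ^ n := pow_nonneg (by linarith) n
  refine abs_le_of_sq_le_sq' ?_ (mul_nonneg (Real.sqrt_nonneg _) hr) |>.2
  rw [mul_pow, Real.sq_sqrt hB0, ← real_inner_self_eq_norm_sq, op_pow_symm]
  -- By symmetry `‖Tⁿx‖² = ⟨x, T²ⁿx⟩`, so the asymptotics are used at `2n` with `k = l`; `B`
  -- collects the two resulting constants.
  have e : (hρ.op ^ n) ((hρ.op ^ n) (microExp l)) = (hρ.op ^ (2 * n)) (microExp l) := by
    rw [two_mul, pow_add]; rfl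
  rw [e, ← pow_mul, mul_comm n 2]
  have h := abs_inner_iterate_sub_le hρ l (2 * n) l le_rfl
  have h2 := abs_traceless_le l l
  have h3 : (1 - 3 * κ) ^ (2 * n) ≤ (1 - κ) ^ (2 * n) :=
    pow_le_pow_left₀ (by linarith) (by linarith) _
  have h4 : 0 ≤ (1 - 3 * κ) ^ (2 * n) := pow_nonneg (by linarith) _
  have h5 := (abs_le.1 h).2
  have h6 : (1 - 3 * κ) ^ (2 * n) / 2 * traceless l l ≤
      (1 - κ) ^ (2 * n) * (‖l‖ ^ 2 * ‖l‖ ^ 2) := by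
    have h7 : traceless l l ≤ ‖l‖ ^ 2 * ‖l‖ ^ 2 := (le_abs_self _).trans h2
    have h8 : 0 ≤ ‖l‖ ^ 2 * ‖l‖ ^ 2 := by positivity
    calc _ ≤ (1 - 3 * κ) ^ (2 * n) / 2 * (‖l‖ ^ 2 * ‖l‖ ^ 2) :=
          mul_le_mul_of_nonneg_left h7 (by linarith)
      _ ≤ _ := mul_le_mul_of_nonneg_right (by linarith) h8
  rw [hB]
  linarith

/-- The averaging operator contracts the orthogonal complement of the collision invariants. -/
theorem norm_op_le (h : Lp ℝ 2 gauss) :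
    ‖hρ.op (h - invProj h)‖ ≤ (1 - κ) * ‖h - invProj h‖ := by
  have hκ1 := hρ.kappa_le
  have hspan : ∀ g ∈ Submodule.span ℝ (range expLp),
      ∃ C, ∀ n : ℕ, ‖(hρ.op ^ n) (g - invProj g)‖ ≤ C * (1 - κ) ^ n := by
    intro g hg
    induction hg using Submodule.span_induction with
    | mem x hx =>
      obtain ⟨k, rfl⟩ := hx
      rw [sub_invProj_expLp]
      exact hρ.exists_norm_iterate_microExp_le k
    | zero => exact ⟨0, fun n => by simp⟩
    | add x y _ _ hx hy =>
      obtain ⟨C, hC⟩ := hx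
      obtain ⟨D, hD⟩ := hy
      refine ⟨C + D, fun n => ?_⟩
      rw [map_add, add_sub_add_comm, map_add, add_mul]
      exact (norm_add_le _ _).trans (add_le_add (hC n) (hD n))
    | smul a x _ hx =>
      obtain ⟨C, hC⟩ := hx
      refine ⟨|a| * C, fun n => ?_⟩
      rw [map_smul, ← smul_sub, map_smul, norm_smul, mul_assoc]
      exact mul_le_mul_of_nonneg_left (hC n) (norm_nonneg _)
  -- The constant of the geometric decay depends on `g`, but the one-step inequality deduced from it
  -- does not, so it defines a closed set containing a dense one.
  have hcl : IsClosed {g : Lp ℝ 2 gauss | ‖hρ.op (g - invProj g)‖ ≤ (1 - κ) * ‖g - invProj g‖} :=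
    isClosed_le (by fun_prop) (by fun_prop)
  have hsub : (Submodule.span ℝ (range expLp) : Set (Lp ℝ 2 gauss)) ⊆
      {g : Lp ℝ 2 gauss | ‖hρ.op (g - invProj g)‖ ≤ (1 - κ) * ‖g - invProj g‖} := fun g hg => by
    obtain ⟨C, hC⟩ := hspan g hg
    exact norm_le_of_iterate_le hρ.op hρ.op_symm (by linarith) hC
  have := hcl.closure_subset_iff.2 hsub
  rw [← Submodule.topologicalClosure_coe, span_expLp_dense] at this
  exact this (mem_univ h)

/-- Spectral gap for the bounded collision kernel. -/
theorem spectral_gap {h : V3 → ℝ} (hh : MemLp h 2 gauss)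
    (horth : ∀ i, ∫ v, invariant i v * h v ∂gauss = 0) :
    4 * κ * ∫ v, h v ^ 2 ∂gauss ≤ ∫ p, collDiff h p ^ 2 ∂(collWeight ρ) := by
  set H : Lp ℝ 2 gauss := hh.toLp with hH
  have hae : H =ᵐ[gauss] h := hh.coeFn_toLp
  have hP : invProj H = 0 := by
    rw [invProj_apply]
    refine Finset.sum_eq_zero fun i _ => ?_
    have : inner ℝ (invLp i) H = (0 : ℝ) := by
      rw [inner_invLp, ← horth i]
      refine integral_congr_ae ?_
      filter_upwards [hae] with v hv
      rw [hv]
    rw [this, zero_smul]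
  have h1 := hρ.norm_op_le H
  rw [hP, sub_zero] at h1
  have h2 := (real_inner_le_norm (hρ.op H) H).trans
    (mul_le_mul_of_nonneg_right h1 (norm_nonneg _))
  -- Now `‖H‖²` minus a quarter of the Dirichlet form is at most `(1 - κ)‖H‖²`.
  rw [inner_op_eq, real_inner_self_eq_norm_sq] at h2
  have h3 : ‖H‖ ^ 2 = ∫ v, h v ^ 2 ∂gauss := by
    rw [← real_inner_self_eq_norm_sq, L2.inner_def]
    refine integral_congr_ae ?_
    filter_upwards [hae] with v hv
    rw [hv]; simp [sq]
  have h4 : ∫ p, collDiff H p * collDiff H p ∂(collWeight ρ) =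
      ∫ p, collDiff h p ^ 2 ∂(collWeight ρ) := by
    refine integral_congr_ae ?_
    filter_upwards [hρ.collDiff_congr hae] with p hp
    rw [hp, sq]
  rw [h4] at h2
  rw [← h3]
  nlinarith

end AngularDensity

/-! ### Weighted Dirichlet forms -/

namespace CollInvariant

variable {μ : Measure Coll} (hμ : CollInvariant μ)
include hμ

/-- Change of variables in an integral over collision configurations. -/
theorem integral_weight_all {a : Coll → ℝ} {h : V3 → ℝ}
    (hi : Integrable (fun p => a p * h p.2.1 ^ 2) μ) :
    (Integrable (fun p => a (swapMap p) * h p.2.2 ^ 2) μ ∧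
      ∫ p, a (swapMap p) * h p.2.2 ^ 2 ∂μ = ∫ p, a p * h p.2.1 ^ 2 ∂μ) ∧
    (Integrable (fun p => a (collMap p) * h (collV p) ^ 2) μ ∧
      ∫ p, a (collMap p) * h (collV p) ^ 2 ∂μ = ∫ p, a p * h p.2.1 ^ 2 ∂μ) ∧
    (Integrable (fun p => a (swapMap (collMap p)) * h (collU p) ^ 2) μ ∧
      ∫ p, a (swapMap (collMap p)) * h (collU p) ^ 2 ∂μ = ∫ p, a p * h p.2.1 ^ 2 ∂μ) := by
  have h1 : Integrable (fun p => a (swapMap p) * h p.2.2 ^ 2) μ :=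
    (hμ.swap.integrable_comp_emb swapEquiv.measurableEmbedding).2 hi
  have e1 := hμ.integral_swap fun p => a p * h p.2.1 ^ 2
  have h2 : Integrable (fun p => a (collMap p) * h (collV p) ^ 2) μ :=
    (hμ.coll.integrable_comp_emb collEquiv.measurableEmbedding).2 hi
  have e2 := hμ.integral_coll fun p => a p * h p.2.1 ^ 2
  have h3 : Integrable (fun p => a (swapMap (collMap p)) * h (collU p) ^ 2) μ :=
    (hμ.coll.integrable_comp_emb collEquiv.measurableEmbedding).2 h1
  have e3 := hμ.integral_coll fun p => a (swapMap p) * h p.2.2 ^ 2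
  exact ⟨⟨h1, e1⟩, ⟨h2, e2⟩, ⟨h3, e3.trans e1⟩⟩

/-- The Dirichlet form is bounded by a weighted norm. -/
theorem integral_weight_collDiff_sq_le {a : Coll → ℝ} {h : V3 → ℝ} (ha : Measurable a)
    (ha0 : ∀ p, 0 ≤ a p) (h1 : ∀ p, a (collMap p) = a p) (h2 : ∀ p, a (swapMap p) = a p)
    (hm : AEStronglyMeasurable (collDiff h) μ)
    (hi : Integrable (fun p => a p * h p.2.1 ^ 2) μ) :
    Integrable (fun p => a p * collDiff h p ^ 2) μ ∧
      ∫ p, a p * collDiff h p ^ 2 ∂μ ≤ 16 * ∫ p, a p * h p.2.1 ^ 2 ∂μ := by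
  obtain ⟨⟨i1, e1⟩, ⟨i2, e2⟩, ⟨i3, e3⟩⟩ := hμ.integral_weight_all hi
  simp only [h1, h2] at i1 e1 i2 e2 i3 e3
  -- A square of four terms costs a factor `4`, and the four resulting integrals are equal by
  -- invariance: hence `16`.
  have hb : ∀ p, a p * collDiff h p ^ 2 ≤ 4 * (a p * h p.2.1 ^ 2 + a p * h p.2.2 ^ 2 +
      (a p * h (collV p) ^ 2 + a p * h (collU p) ^ 2)) := fun p => by
    have : collDiff h p ^ 2 ≤ 4 * (h p.2.1 ^ 2 + h p.2.2 ^ 2 + (h (collV p) ^ 2 +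
        h (collU p) ^ 2)) := by
      unfold collDiff
      set x := h (collV p); set y := h (collU p); set z := h p.2.1; set t := h p.2.2
      nlinarith [sq_nonneg (x - y), sq_nonneg (x + z), sq_nonneg (x + t), sq_nonneg (y + z),
        sq_nonneg (y + t), sq_nonneg (z - t)]
    have := mul_le_mul_of_nonneg_left this (ha0 p)
    linarith
  have j1 : Integrable (fun p => a p * h p.2.1 ^ 2 + a p * h p.2.2 ^ 2) μ := hi.add i1
  have j2 : Integrable (fun p => a p * h (collV p) ^ 2 + a p * h (collU p) ^ 2) μ := i2.add i3
  have j : Integrable (fun p => 4 * (a p * h p.2.1 ^ 2 + a p * h p.2.2 ^ 2 +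
      (a p * h (collV p) ^ 2 + a p * h (collU p) ^ 2))) μ := (j1.add j2).const_mul 4
  have k : Integrable (fun p => a p * collDiff h p ^ 2) μ := by
    refine j.mono' (ha.aestronglyMeasurable.mul (hm.pow 2)) (Filter.Eventually.of_forall fun p => ?_)
    rw [Real.norm_of_nonneg (mul_nonneg (ha0 p) (sq_nonneg _))]
    exact hb p
  refine ⟨k, (integral_mono k j hb).trans (le_of_eq ?_)⟩
  rw [integral_const_mul, integral_add j1 j2, integral_add hi i1, integral_add i2 i3, e1, e2, e3]
  ring

end CollInvariant

/-! ### The relative speed, the weight, and small balls -/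

/-- The relative speed. -/
def relSpeed (p : Coll) : ℝ := ‖p.2.1 - p.2.2‖

theorem relSpeed_nonneg (p : Coll) : 0 ≤ relSpeed p := norm_nonneg _

theorem relSpeed_collMap (p : Coll) : relSpeed (collMap p) = relSpeed p := by
  unfold relSpeed collMap
  rw [norm_sub_rev, norm_collU_sub_collV, norm_sub_rev]

theorem relSpeed_swapMap (p : Coll) : relSpeed (swapMap p) = relSpeed p := by
  unfold relSpeed swapMap
  rw [norm_sub_rev]

theorem measurable_relSpeed : Measurable relSpeed := by unfold relSpeed; fun_prop

/-- The weight `(1 + |v|²)^{γ/2}`. -/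
def speedWeight (γ : ℝ) (v : V3) : ℝ := (1 + ‖v‖ ^ 2) ^ (γ / 2)

theorem one_le_speedWeight {γ : ℝ} (hγ : γ ∈ Icc (0 : ℝ) 1) (v : V3) : 1 ≤ speedWeight γ v :=
  Real.one_le_rpow (by nlinarith [sq_nonneg ‖v‖]) (by linarith [hγ.1])

theorem measurable_speedWeight (γ : ℝ) : Measurable (speedWeight γ) := by
  unfold speedWeight; fun_prop

theorem norm_rpow_le_speedWeight {γ : ℝ} (hγ : γ ∈ Icc (0 : ℝ) 1) (v : V3) :
    ‖v‖ ^ γ ≤ speedWeight γ v := by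
  unfold speedWeight
  have : ‖v‖ ^ γ = (‖v‖ ^ 2) ^ (γ / 2) := by
    rw [← Real.rpow_natCast, ← Real.rpow_mul (norm_nonneg _)]; congr 1; push_cast; ring
  rw [this]
  exact Real.rpow_le_rpow (by positivity) (by linarith) (by linarith [hγ.1])

theorem speedWeight_le {γ : ℝ} (hγ : γ ∈ Icc (0 : ℝ) 1) (v : V3) :
    speedWeight γ v ≤ 1 + ‖v‖ ^ γ := by
  unfold speedWeight
  have : ‖v‖ ^ γ = (‖v‖ ^ 2) ^ (γ / 2) := by
    rw [← Real.rpow_natCast, ← Real.rpow_mul (norm_nonneg _)]; congr 1; push_cast; ring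
  rw [this]
  have h := Real.rpow_add_le_add_rpow (zero_le_one' ℝ) (sq_nonneg ‖v‖)
    (by linarith [hγ.1] : 0 ≤ γ / 2) (by linarith [hγ.2])
  rwa [Real.one_rpow] at h

theorem rpow_le_one_add {γ : ℝ} (hγ : γ ∈ Icc (0 : ℝ) 1) {t : ℝ} (ht : 0 ≤ t) :
    t ^ γ ≤ 1 + t := by
  rcases le_total t 1 with h | h
  · exact (Real.rpow_le_one ht h hγ.1).trans (by linarith)
  · have := Real.rpow_le_rpow_of_exponent_le h hγ.2
    rw [Real.rpow_one] at this
    linarith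

/-- Subadditivity of `t ↦ t^γ` for `0 ≤ γ ≤ 1`. The variables are separated, so the bound can be
integrated against the product Gaussian. -/
theorem norm_sub_rpow_le {γ : ℝ} (hγ : γ ∈ Icc (0 : ℝ) 1) (v u : V3) :
    ‖v - u‖ ^ γ ≤ speedWeight γ v * (2 + ‖u‖) := by
  have h1 : ‖v - u‖ ^ γ ≤ ‖v‖ ^ γ + ‖u‖ ^ γ :=
    (Real.rpow_le_rpow (norm_nonneg _) (norm_sub_le v u) hγ.1).trans
      (Real.rpow_add_le_add_rpow (norm_nonneg _) (norm_nonneg _) hγ.1 hγ.2)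
  have h2 := norm_rpow_le_speedWeight hγ v
  have h3 := rpow_le_one_add hγ (norm_nonneg u)
  have h4 := one_le_speedWeight hγ v
  nlinarith [norm_nonneg u]

/-- Subtracting a vector of length at most one changes `‖v‖^γ` by at most one, and the weight
exceeds `‖v‖^γ` by at most one. -/
theorem speedWeight_le_norm_sub {γ : ℝ} (hγ : γ ∈ Icc (0 : ℝ) 1) {v u : V3} (hu : ‖u‖ ≤ 1) :
    speedWeight γ v - 2 ≤ ‖v - u‖ ^ γ := by
  have h1 : ‖v‖ ^ γ ≤ ‖v - u‖ ^ γ + ‖u‖ ^ γ := by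
    refine (Real.rpow_le_rpow (norm_nonneg _) (?_ : ‖v‖ ≤ ‖v - u‖ + ‖u‖) hγ.1).trans
      (Real.rpow_add_le_add_rpow (norm_nonneg _) (norm_nonneg _) hγ.1 hγ.2)
    simpa using norm_add_le (v - u) u
  have h2 := speedWeight_le hγ v
  have h3 := Real.rpow_le_one (norm_nonneg u) hu hγ.1
  linarith

theorem gaussDensity_le_one (v : V3) : gaussDensity v ≤ 1 := by
  unfold gaussDensity
  have h1 : Real.exp (-(‖v‖ ^ 2 / 2)) ≤ 1 := Real.exp_le_one_iff.2 (by nlinarith [sq_nonneg ‖v‖])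
  have h2 : 1 ≤ Real.sqrt ((2 * Real.pi) ^ 3) := by
    rw [Real.one_le_sqrt]
    exact one_le_pow₀ (by linarith [Real.pi_gt_three])
  have h3 : 1 / Real.sqrt ((2 * Real.pi) ^ 3) ≤ 1 := by
    rw [div_le_one (by linarith)]; exact h2
  exact mul_le_one₀ h3 (Real.exp_pos _).le h1

/-- Small balls have uniformly small Gaussian measure. -/
theorem exists_gauss_ball_le {η : ℝ} (hη : 0 < η) :
    ∃ ε : ℝ, 0 < ε ∧ ∀ v : V3, gauss.real {u | ‖v - u‖ < ε} ≤ η := by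
  set c := (volume : Measure V3).real (Metric.ball 0 1) with hc
  have hlim : Filter.Tendsto (fun ε : ℝ => ε ^ 3 * c) (nhdsWithin 0 (Ioi 0)) (nhds 0) := by
    have : Continuous fun ε : ℝ => ε ^ 3 * c := by fun_prop
    have h := this.tendsto 0
    simp only [ne_eq, OfNat.ofNat_ne_zero, not_false_eq_true, zero_pow, zero_mul] at h
    exact h.mono_left nhdsWithin_le_nhds
  obtain ⟨ε, hε, hε0⟩ := ((hlim.eventually (gt_mem_nhds hη)).and self_mem_nhdsWithin).exists
  have hε0 : 0 < ε := hε0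
  refine ⟨ε, hε0, fun v => ?_⟩
  have hs : {u : V3 | ‖v - u‖ < ε} = Metric.ball v ε := by
    ext u; rw [Metric.mem_ball, dist_comm, dist_eq_norm]; rfl
  -- The Gaussian density is at most one, so the volume of the ball is a bound independent of its
  -- centre.
  have hle : gauss (Metric.ball v ε) ≤ volume (Metric.ball v ε) := by
    unfold gauss
    rw [withDensity_apply _ measurableSet_ball]
    calc _ ≤ ∫⁻ _ in Metric.ball v ε, 1 := lintegral_mono fun u => by
          rw [← ENNReal.ofReal_one]
          exact ENNReal.ofReal_le_ofReal (gaussDensity_le_one u)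
      _ = _ := by simp
  rw [hs]
  refine le_trans ?_ hε.le
  refine (ENNReal.toReal_mono measure_ball_lt_top.ne hle).trans (le_of_eq ?_)
  rw [Measure.addHaar_ball _ _ hε0.le, ENNReal.toReal_mul, ENNReal.toReal_ofReal (by positivity),
    finrank_euclideanSpace, Fintype.card_fin]
  rfl

theorem gauss_unit_ball_pos : 0 < gauss.real {u : V3 | ‖u‖ ≤ 1} := by
  have hs : {u : V3 | ‖u‖ ≤ 1} = Metric.closedBall 0 1 := by ext u; simp
  rw [hs, measureReal_def, ENNReal.toReal_pos_iff]
  refine ⟨?_, measure_lt_top _ _⟩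
  rw [pos_iff_ne_zero]
  intro h
  have := absolutelyContinuous_gauss h
  exact (Metric.measure_closedBall_pos (volume : Measure V3) 0 one_pos).ne' this

namespace AngularDensity

variable {ρ : ℝ → ℝ} {κ : ℝ} (hρ : AngularDensity ρ κ)
include hρ

theorem integrable_pair {F : V3 × V3 → ℝ} (hF : Integrable F (gauss.prod gauss)) :
    Integrable (fun p : Coll => F p.2) (collWeight ρ) :=
  hρ.measurePreserving_pair.integrable_comp_of_integrable hF

theorem integral_pair {F : V3 × V3 → ℝ} (hF : AEStronglyMeasurable F (gauss.prod gauss)) :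
    ∫ p : Coll, F p.2 ∂(collWeight ρ) = ∫ z, F z ∂(gauss.prod gauss) := by
  rw [← hρ.measurePreserving_pair.map_eq] at hF ⊢
  rw [integral_map (by fun_prop) hF]

theorem aestronglyMeasurable_collDiff {h : V3 → ℝ} (hh : AEStronglyMeasurable h gauss) :
    AEStronglyMeasurable (collDiff h) (collWeight ρ) :=
  (((hh.comp_measurePreserving hρ.measurePreserving_collV).add
    (hh.comp_measurePreserving hρ.measurePreserving_collU)).sub
    (hh.comp_measurePreserving hρ.measurePreserving_fst)).sub
    (hh.comp_measurePreserving hρ.measurePreserving_snd)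

/-- The angular average with the additional weight `cos² θ sin² θ`. -/
theorem integral_pair_angle {F : V3 × V3 → ℝ} (hF : AEStronglyMeasurable F (gauss.prod gauss)) :
    ∫ p : Coll, (Real.cos (collAngle p) ^ 2 * Real.sin (collAngle p) ^ 2) * F p.2 ∂(collWeight ρ) =
      κ * ∫ z, F z ∂(gauss.prod gauss) := by
  -- Divided by its mean `κ`, the modified density again has mass one on every axis, so its pair
  -- marginal is again `gauss.prod gauss`.
  set ρ₂ : ℝ → ℝ := fun θ => κ⁻¹ * (ρ θ * (Real.cos θ ^ 2 * Real.sin θ ^ 2)) with hρ₂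
  have hm₂ : Measurable ρ₂ := by
    have := hρ.measurable
    rw [hρ₂]; fun_prop
  have hκ := hρ.pos
  have h0 : ∀ θ ∈ Icc 0 Real.pi, 0 ≤ ρ₂ θ := fun θ hθ => by
    have := hρ.nonneg θ hθ
    simp only [hρ₂]; positivity
  have hmp : MeasurePreserving (fun p : Coll => p.2) (collWeight ρ₂) (gauss.prod gauss) := by
    refine measurePreserving_snd_collWeight hm₂ fun a ha => ?_
    have hi : ∫ ω : S2, ρ₂ (InnerProductGeometry.angle a ω) ∂sphereMeasure = 1 := by
      simp only [hρ₂]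
      rw [integral_const_mul, hρ.integral_eq a ha, inv_mul_cancel₀ hκ.ne']
    rw [← ofReal_integral_eq_lintegral_ofReal, hi, ENNReal.ofReal_one]
    -- A non-integrable function would have integral `0`, not `1`.
    · exact not_imp_comm.1 integral_undef (by rw [hi]; norm_num)
    · exact Filter.Eventually.of_forall fun ω => h0 _ (angle_mem_Icc _ _)
  have hF2 : ∫ z, F z ∂(gauss.prod gauss) = ∫ p : Coll, F p.2 ∂(collWeight ρ₂) := by
    rw [← hmp.map_eq] at hF ⊢
    rw [integral_map (by fun_prop) hF]
  rw [hF2]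
  have hm₃ : Measurable fun p => ENNReal.ofReal (ρ₂ (collAngle p)) :=
    (hm₂.comp RotBoltzmann.measurable_collAngle).ennreal_ofReal
  unfold collWeight
  rw [integral_withDensity_eq_integral_toReal_smul hρ.measurable_collAngle.ennreal_ofReal
    (by simp), integral_withDensity_eq_integral_toReal_smul hm₃ (by simp), ← integral_const_mul]
  congr 1; ext p
  simp only [smul_eq_mul]
  rw [ENNReal.toReal_ofReal (hρ.nonneg _ (collAngle_mem p)),
    ENNReal.toReal_ofReal (h0 _ (collAngle_mem p))]
  simp only [hρ₂]
  field_simp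

omit hρ in
theorem integrable_relSpeed_mul {γ : ℝ} (hγ : γ ∈ Icc (0 : ℝ) 1) {h : V3 → ℝ}
    (hm : AEStronglyMeasurable h gauss)
    (hi : Integrable (fun v => h v ^ 2 * speedWeight γ v) gauss) :
    Integrable (fun z : V3 × V3 => ‖z.1 - z.2‖ ^ γ * h z.1 ^ 2) (gauss.prod gauss) := by
  have hu : Integrable (fun u : V3 => 2 + ‖u‖) gauss := by
    have := integrable_norm_pow 1
    simp only [pow_one] at this
    exact (integrable_const _).add this
  refine (hi.mul_prod hu).mono' ?_ (Filter.Eventually.of_forall fun z => ?_)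
  · exact (Measurable.aestronglyMeasurable (by fun_prop)).mul (hm.comp_fst.pow 2)
  · have := norm_sub_rpow_le hγ z.1 z.2
    rw [Real.norm_of_nonneg (by positivity)]
    nlinarith [mul_le_mul_of_nonneg_left this (sq_nonneg (h z.1))]

/-- Integrability and an upper bound of the Dirichlet form of a hard potential. -/
theorem integrable_collDiff_hard {γ : ℝ} (hγ : γ ∈ Icc (0 : ℝ) 1) {h : V3 → ℝ}
    (hm : AEStronglyMeasurable h gauss)
    (hi : Integrable (fun v => h v ^ 2 * speedWeight γ v) gauss) :
    Integrable (fun p => relSpeed p ^ γ * collDiff h p ^ 2) (collWeight ρ) := by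
  have hp : Integrable (fun p : Coll => relSpeed p ^ γ * h p.2.1 ^ 2) (collWeight ρ) :=
    hρ.integrable_pair (F := fun z : V3 × V3 => ‖z.1 - z.2‖ ^ γ * h z.1 ^ 2)
      (integrable_relSpeed_mul hγ hm hi)
  exact (hρ.collInvariant.integral_weight_collDiff_sq_le (a := fun p => relSpeed p ^ γ)
    (measurable_relSpeed.pow_const γ)
    (fun p => Real.rpow_nonneg (relSpeed_nonneg p) _) (fun p => by rw [relSpeed_collMap])
    (fun p => by rw [relSpeed_swapMap]) (hρ.aestronglyMeasurable_collDiff hm) hp).1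

/-- Coercivity in `L²` for hard potentials. -/
theorem exists_coercive_hard {γ : ℝ} (hγ : γ ∈ Icc (0 : ℝ) 1) :
    ∃ C : ℝ, 0 < C ∧ ∀ h : V3 → ℝ, AEStronglyMeasurable h gauss →
      Integrable (fun v => h v ^ 2 * speedWeight γ v) gauss →
      (∀ i, ∫ v, invariant i v * h v ∂gauss = 0) →
      ∫ v, h v ^ 2 ∂gauss ≤ C * ∫ p, relSpeed p ^ γ * collDiff h p ^ 2 ∂(collWeight ρ) := by
  have hκ := hρ.pos
  -- Close pairs contribute at most `16 · κ/8 = 2κ` times `‖h‖²` to the Dirichlet form, half of the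
  -- available gap `4κ`.
  obtain ⟨ε, hε, hball⟩ := exists_gauss_ball_le (η := κ / 8) (by positivity)
  have hεγ : 0 < ε ^ γ := Real.rpow_pos_of_pos hε γ
  refine ⟨(ε ^ γ)⁻¹ / (2 * κ), by positivity, fun h hm hi horth => ?_⟩
  have hsq : Integrable (fun v => h v ^ 2) gauss := by
    refine hi.mono' (hm.pow 2) (Filter.Eventually.of_forall fun v => ?_)
    rw [Real.norm_of_nonneg (sq_nonneg _)]
    nlinarith [one_le_speedWeight hγ v, sq_nonneg (h v)]
  have hLp : MemLp h 2 gauss := (memLp_two_iff_integrable_sq hm).2 hsq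
  have hgap := hρ.spectral_gap hLp horth
  set a : Coll → ℝ := fun p => if relSpeed p < ε then 1 else 0 with ha
  have ham : Measurable a :=
    Measurable.ite (measurableSet_lt measurable_relSpeed measurable_const) measurable_const
      measurable_const
  set b : V3 × V3 → ℝ := fun z => if ‖z.1 - z.2‖ < ε then 1 else 0 with hb
  have hbm : Measurable b :=
    Measurable.ite (measurableSet_lt (by fun_prop) measurable_const) measurable_const
      measurable_const
  have hsq2 : Integrable (fun z : V3 × V3 => h z.1 ^ 2) (gauss.prod gauss) := hsq.comp_fst gauss
  have hbi : Integrable (fun z : V3 × V3 => b z * h z.1 ^ 2) (gauss.prod gauss) := by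
    refine hsq2.mono' (hbm.aestronglyMeasurable.mul hsq2.1)
      (Filter.Eventually.of_forall fun z => ?_)
    rw [norm_mul, Real.norm_of_nonneg (sq_nonneg _)]
    simp only [hb]
    split_ifs <;> simp; positivity
  have hai : Integrable (fun p : Coll => a p * h p.2.1 ^ 2) (collWeight ρ) :=
    hρ.integrable_pair (F := fun z : V3 × V3 => b z * h z.1 ^ 2) hbi
  obtain ⟨i1, e1⟩ := hρ.collInvariant.integral_weight_collDiff_sq_le (a := a) ham
    (fun p => by simp only [ha]; split_ifs <;> norm_num)
    (fun p => by simp only [ha, relSpeed_collMap]) (fun p => by simp only [ha, relSpeed_swapMap])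
    (hρ.aestronglyMeasurable_collDiff hm) hai
  have e2 : ∫ p : Coll, a p * h p.2.1 ^ 2 ∂(collWeight ρ) ≤ κ / 8 * ∫ v, h v ^ 2 ∂gauss := by
    refine (hρ.integral_pair (F := fun z : V3 × V3 => b z * h z.1 ^ 2) hbi.1).trans_le ?_
    rw [integral_prod _ hbi, ← integral_const_mul]
    refine integral_mono hbi.integral_prod_left (hsq.const_mul _) fun v => ?_
    simp only
    rw [integral_mul_const]
    refine mul_le_mul_of_nonneg_right (le_of_eq_of_le ?_ (hball v)) (sq_nonneg _)
    have hs : MeasurableSet {u : V3 | ‖v - u‖ < ε} :=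
      measurableSet_lt (by fun_prop) measurable_const
    rw [← integral_indicator_one hs]
    congr 1
  have i2 := hρ.integrable_collDiff_hard hγ hm hi
  have i3 := (hρ.collInvariant.memLp_collDiff
    (hLp.comp_measurePreserving hρ.measurePreserving_fst)).integrable_sq
  -- Off the close pairs the factor `relSpeed ^ γ` is at least `ε ^ γ`; the close pairs are kept as
  -- a separate error.
  have e3 : ∫ p, collDiff h p ^ 2 ∂(collWeight ρ) ≤
      (ε ^ γ)⁻¹ * ∫ p, relSpeed p ^ γ * collDiff h p ^ 2 ∂(collWeight ρ) +
      ∫ p, a p * collDiff h p ^ 2 ∂(collWeight ρ) := by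
    rw [← integral_const_mul, ← integral_add (i2.const_mul _) i1]
    refine integral_mono i3 ((i2.const_mul _).add i1) fun p => ?_
    simp only [ha]
    have h0 := Real.rpow_nonneg (relSpeed_nonneg p) γ
    split_ifs with hlt
    · have : 0 ≤ (ε ^ γ)⁻¹ * (relSpeed p ^ γ * collDiff h p ^ 2) := by positivity
      linarith
    · have h1 : ε ^ γ ≤ relSpeed p ^ γ := Real.rpow_le_rpow hε.le (not_lt.1 hlt) hγ.1
      have h2 : 1 ≤ (ε ^ γ)⁻¹ * relSpeed p ^ γ := by
        rw [inv_mul_eq_div, le_div_iff₀ hεγ, one_mul]; exact h1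
      nlinarith [mul_le_mul_of_nonneg_right h2 (sq_nonneg (collDiff h p))]
  rw [div_mul_eq_mul_div, le_div_iff₀ (by positivity)]
  linarith

end AngularDensity

/-! ### Gain of the weight from slow partners -/

/-- The configurations with a slow second particle, weighted by the deflection. -/
def slowWeight (γ : ℝ) (p : Coll) : ℝ :=
  if ‖p.2.2‖ ≤ 1 then (Real.cos (collAngle p) ^ 2 * Real.sin (collAngle p) ^ 2) * relSpeed p ^ γ
  else 0

theorem measurable_slowWeight (γ : ℝ) : Measurable (slowWeight γ) := by
  have h1 := measurable_collAngle
  have h2 := measurable_relSpeed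
  exact Measurable.ite (measurableSet_le (by fun_prop) measurable_const) (by fun_prop)
    measurable_const

theorem slowWeight_nonneg (γ : ℝ) (p : Coll) : 0 ≤ slowWeight γ p := by
  have := Real.rpow_nonneg (relSpeed_nonneg p) γ
  unfold slowWeight; split_ifs <;> positivity

theorem cos_sq_mul_sin_sq_le (t : ℝ) :
    Real.cos t ^ 2 * Real.sin t ^ 2 ≤ 1 ∧ Real.cos t ^ 2 * Real.sin t ^ 2 ≤ |Real.cos t| ∧
      Real.cos t ^ 2 * Real.sin t ^ 2 ≤ |Real.sin t| := by
  have h1 := Real.abs_cos_le_one t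
  have h2 := Real.abs_sin_le_one t
  have h3 := abs_nonneg (Real.cos t)
  have h4 := abs_nonneg (Real.sin t)
  rw [← sq_abs (Real.cos t), ← sq_abs (Real.sin t)]
  have h5 : |Real.cos t| ^ 2 ≤ |Real.cos t| := by nlinarith
  have h6 : |Real.sin t| ^ 2 ≤ |Real.sin t| := by nlinarith
  have h7 : |Real.sin t| ^ 2 ≤ 1 := h6.trans h2
  have h8 : |Real.cos t| ^ 2 ≤ 1 := h5.trans h1
  have h9 := sq_nonneg |Real.cos t|
  have h10 := sq_nonneg |Real.sin t|
  refine ⟨?_, ?_, ?_⟩ <;> nlinarith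

theorem slowWeight_le (γ : ℝ) (p : Coll) : slowWeight γ p ≤ relSpeed p ^ γ := by
  have := Real.rpow_nonneg (relSpeed_nonneg p) γ
  unfold slowWeight
  split_ifs
  · nlinarith [(cos_sq_mul_sin_sq_le (collAngle p)).1]
  · exact this

theorem slowWeight_le_of_snd {γ : ℝ} (hγ : γ ∈ Icc (0 : ℝ) 1) (p : Coll) :
    slowWeight γ p ≤ 2 + ‖p.2.1‖ := by
  have h0 := norm_nonneg p.2.1
  unfold slowWeight
  split_ifs with h
  · have h1 := rpow_le_one_add hγ (relSpeed_nonneg p)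
    have h2 : relSpeed p ≤ ‖p.2.1‖ + ‖p.2.2‖ := norm_sub_le _ _
    have h3 := (cos_sq_mul_sin_sq_le (collAngle p)).1
    have h4 := Real.rpow_nonneg (relSpeed_nonneg p) γ
    nlinarith
  · linarith

/-- `u' - u` is the component of `v - u` along `ω`. This and the companion identity for the sine
bound large relative speeds by velocities other than `v`. -/
theorem abs_cos_mul_relSpeed (p : Coll) :
    relSpeed p * |Real.cos (collAngle p)| = ‖collU p - p.2.2‖ := by
  have h1 : collU p - p.2.2 = inner ℝ (p.2.1 - p.2.2) (p.1 : V3) • (p.1 : V3) := by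
    unfold collU postU; abel
  have h2 := inner_eq_norm_mul_cos (p.2.2 - p.2.1) p.1
  rw [h1, norm_smul, norm_eq_of_mem_sphere, mul_one, ← neg_sub p.2.2, inner_neg_left, norm_neg,
    h2, Real.norm_eq_abs, abs_mul, abs_norm, relSpeed, norm_sub_rev, collAngle]

theorem abs_sin_mul_relSpeed (p : Coll) :
    relSpeed p * |Real.sin (collAngle p)| = ‖collV p - p.2.2‖ := by
  have h1 : collV p - p.2.2 = orthPart (p.2.1 - p.2.2) p.1 := by
    unfold collV postV orthPart; abel
  have h2 : orthPart (p.2.1 - p.2.2) p.1 = -orthPart (p.2.2 - p.2.1) p.1 := by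
    unfold orthPart
    rw [← neg_sub p.2.2, inner_neg_left]; module
  rw [h1, h2, norm_neg, norm_orthPart, relSpeed, norm_sub_rev, collAngle]

/-- After the change of variables the slow particle is `u'`, and `|v - u||cos θ| = |u' - u| ≤ 1 +
|u|`. The angular factor of `slowWeight` supplies the cosine and so prevents growth in `v`. -/
theorem slowWeight_collMap_le {γ : ℝ} (hγ : γ ∈ Icc (0 : ℝ) 1) (p : Coll) :
    slowWeight γ (collMap p) ≤ 2 + ‖p.2.2‖ := by
  have h0 := norm_nonneg p.2.2
  unfold slowWeight
  rw [collAngle_collMap, relSpeed_collMap]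
  split_ifs with h
  · have h1 := rpow_le_one_add hγ (relSpeed_nonneg p)
    have h2 : relSpeed p * |Real.cos (collAngle p)| ≤ 1 + ‖p.2.2‖ := by
      rw [abs_cos_mul_relSpeed]
      exact (norm_sub_le _ _).trans (add_le_add_left h _)
    obtain ⟨h3, h4, -⟩ := cos_sq_mul_sin_sq_le (collAngle p)
    have h5 : 0 ≤ Real.cos (collAngle p) ^ 2 * Real.sin (collAngle p) ^ 2 := by positivity
    have h6 := relSpeed_nonneg p
    nlinarith [mul_le_mul_of_nonneg_left h1 h5, mul_le_mul_of_nonneg_right h4 h6]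
  · linarith

/-- Here the slow particle is `v'`, and the sine in the angular factor gives `|v - u||sin θ| = |v' -
u| ≤ 1 + |u|`. -/
theorem slowWeight_collMap_swapMap_le {γ : ℝ} (hγ : γ ∈ Icc (0 : ℝ) 1) (p : Coll) :
    slowWeight γ (collMap (swapMap p)) ≤ 2 + ‖p.2.2‖ := by
  have h0 := norm_nonneg p.2.2
  unfold slowWeight
  rw [collAngle_collMap, relSpeed_collMap, collAngle_swapMap, relSpeed_swapMap]
  split_ifs with h
  · have h' : ‖collV p‖ ≤ 1 := by rw [← collU_swapMap]; exact h
    have h1 := rpow_le_one_add hγ (relSpeed_nonneg p)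
    have h2 : relSpeed p * |Real.sin (collAngle p)| ≤ 1 + ‖p.2.2‖ := by
      rw [abs_sin_mul_relSpeed]
      exact (norm_sub_le _ _).trans (add_le_add_left h' _)
    obtain ⟨h3, -, h4⟩ := cos_sq_mul_sin_sq_le (collAngle p)
    have h5 : 0 ≤ Real.cos (collAngle p) ^ 2 * Real.sin (collAngle p) ^ 2 := by positivity
    have h6 := relSpeed_nonneg p
    nlinarith [mul_le_mul_of_nonneg_left h1 h5, mul_le_mul_of_nonneg_right h4 h6]
  · linarith

theorem integrable_two_add_norm : Integrable (fun u : V3 => 2 + ‖u‖) gauss := by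
  have := integrable_norm_pow 1
  simp only [pow_one] at this
  exact (integrable_const _).add this

theorem integrable_sq_of_weight {γ : ℝ} (hγ : γ ∈ Icc (0 : ℝ) 1) {h : V3 → ℝ}
    (hm : AEStronglyMeasurable h gauss)
    (hi : Integrable (fun v => h v ^ 2 * speedWeight γ v) gauss) :
    Integrable (fun v => h v ^ 2) gauss := by
  refine hi.mono' (hm.pow 2) (Filter.Eventually.of_forall fun v => ?_)
  rw [Real.norm_of_nonneg (sq_nonneg _)]
  nlinarith [one_le_speedWeight hγ v, sq_nonneg (h v)]

namespace AngularDensity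

variable {ρ : ℝ → ℝ} {κ : ℝ} (hρ : AngularDensity ρ κ)
include hρ

/-- A weight growing only in `u` costs a fixed Gaussian moment times the unweighted norm of `h`,
because the pair marginal is a product. -/
theorem integral_weight_le {a : Coll → ℝ} {h : V3 → ℝ} (ha : Measurable a) (ha0 : ∀ p, 0 ≤ a p)
    (hle : ∀ p, a p ≤ 2 + ‖p.2.2‖) (hm : AEStronglyMeasurable h gauss)
    (hsq : Integrable (fun v => h v ^ 2) gauss) :
    Integrable (fun p : Coll => a p * h p.2.1 ^ 2) (collWeight ρ) ∧
      ∫ p : Coll, a p * h p.2.1 ^ 2 ∂(collWeight ρ) ≤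
        (∫ u, (2 + ‖u‖) ∂gauss) * ∫ v, h v ^ 2 ∂gauss := by
  have hF : Integrable (fun z : V3 × V3 => h z.1 ^ 2 * (2 + ‖z.2‖)) (gauss.prod gauss) :=
    hsq.mul_prod integrable_two_add_norm
  have hG : Integrable (fun p : Coll => h p.2.1 ^ 2 * (2 + ‖p.2.2‖)) (collWeight ρ) :=
    hρ.integrable_pair (F := fun z : V3 × V3 => h z.1 ^ 2 * (2 + ‖z.2‖)) hF
  have hb : ∀ p : Coll, a p * h p.2.1 ^ 2 ≤ h p.2.1 ^ 2 * (2 + ‖p.2.2‖) := fun p => by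
    rw [mul_comm]
    exact mul_le_mul_of_nonneg_left (hle p) (sq_nonneg _)
  have hm1 : AEStronglyMeasurable (fun p : Coll => h p.2.1) (collWeight ρ) :=
    hm.comp_measurePreserving hρ.measurePreserving_fst
  have hi : Integrable (fun p : Coll => a p * h p.2.1 ^ 2) (collWeight ρ) := by
    refine hG.mono' (ha.aestronglyMeasurable.mul (hm1.pow 2))
      (Filter.Eventually.of_forall fun p => ?_)
    rw [Real.norm_of_nonneg (mul_nonneg (ha0 p) (sq_nonneg _))]
    exact hb p
  refine ⟨hi, (integral_mono hi hG hb).trans_eq ?_⟩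
  rw [hρ.integral_pair (F := fun z : V3 × V3 => h z.1 ^ 2 * (2 + ‖z.2‖)) hF.1,
    integral_prod_mul (fun v => h v ^ 2) fun u => 2 + ‖u‖, mul_comm]

/-- The angular average of `cos² sin²` gives `κ`, and on `‖u‖ ≤ 1` the relative speed dominates the
desired weight minus `2`. -/
theorem integral_slowWeight_ge {γ : ℝ} (hγ : γ ∈ Icc (0 : ℝ) 1) {h : V3 → ℝ}
    (hm : AEStronglyMeasurable h gauss)
    (hi : Integrable (fun v => h v ^ 2 * speedWeight γ v) gauss) :
    Integrable (fun p : Coll => slowWeight γ p * h p.2.1 ^ 2) (collWeight ρ) ∧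
    κ * gauss.real {u : V3 | ‖u‖ ≤ 1} *
      (∫ v, h v ^ 2 * speedWeight γ v ∂gauss - 2 * ∫ v, h v ^ 2 ∂gauss) ≤
      ∫ p : Coll, slowWeight γ p * h p.2.1 ^ 2 ∂(collWeight ρ) := by
  have hκ := hρ.pos
  set s : Set V3 := {u : V3 | ‖u‖ ≤ 1} with hs
  have hsm : MeasurableSet s := measurableSet_le (by fun_prop) measurable_const
  have hsq := integrable_sq_of_weight hγ hm hi
  have hm1 : AEStronglyMeasurable (fun p : Coll => h p.2.1) (collWeight ρ) :=
    hm.comp_measurePreserving hρ.measurePreserving_fst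
  have hA : Integrable (fun z : V3 × V3 => ‖z.1 - z.2‖ ^ γ * h z.1 ^ 2) (gauss.prod gauss) :=
    integrable_relSpeed_mul hγ hm hi
  have hA1 : Integrable (fun p : Coll => relSpeed p ^ γ * h p.2.1 ^ 2) (collWeight ρ) :=
    hρ.integrable_pair (F := fun z : V3 × V3 => ‖z.1 - z.2‖ ^ γ * h z.1 ^ 2) hA
  have h1 : Integrable (fun p : Coll => slowWeight γ p * h p.2.1 ^ 2) (collWeight ρ) := by
    refine hA1.mono' ((measurable_slowWeight γ).aestronglyMeasurable.mul (hm1.pow 2))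
      (Filter.Eventually.of_forall fun p => ?_)
    rw [Real.norm_of_nonneg (mul_nonneg (slowWeight_nonneg γ p) (sq_nonneg _))]
    exact mul_le_mul_of_nonneg_right (slowWeight_le γ p) (sq_nonneg _)
  refine ⟨h1, ?_⟩
  set F : V3 × V3 → ℝ := fun z => (s.indicator 1 z.2) * (‖z.1 - z.2‖ ^ γ * h z.1 ^ 2) with hF
  have hind : Measurable fun z : V3 × V3 => s.indicator (1 : V3 → ℝ) z.2 :=
    (measurable_one.indicator hsm).comp measurable_snd
  have hFi : Integrable F (gauss.prod gauss) := by
    refine hA.mono' (hind.aestronglyMeasurable.mul hA.1) (Filter.Eventually.of_forall fun z => ?_)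
    rw [Real.norm_of_nonneg]
    · simp only [hF, Set.indicator, Pi.one_apply]
      split_ifs
      · simp
      · simp; positivity
    · simp only [hF, Set.indicator, Pi.one_apply]
      split_ifs <;> simp; positivity
  have e1 : ∫ p : Coll, slowWeight γ p * h p.2.1 ^ 2 ∂(collWeight ρ) =
      κ * ∫ z, F z ∂(gauss.prod gauss) := by
    rw [← hρ.integral_pair_angle hFi.1]
    congr 1; ext p
    simp only [hF, slowWeight, Set.indicator, hs, mem_ofPred_eq, Pi.one_apply, relSpeed]
    split_ifs <;> ring
  rw [e1, mul_assoc]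
  refine mul_le_mul_of_nonneg_left ?_ hκ.le
  have hG : Integrable (fun z : V3 × V3 =>
      (h z.1 ^ 2 * speedWeight γ z.1 - 2 * h z.1 ^ 2) * s.indicator 1 z.2) (gauss.prod gauss) :=
    (hi.sub (hsq.const_mul 2)).mul_prod
      ((integrable_const (1 : ℝ)).indicator hsm)
  refine le_trans (le_of_eq ?_) (integral_mono hG hFi fun z => ?_)
  · rw [integral_prod_mul (fun v => h v ^ 2 * speedWeight γ v - 2 * h v ^ 2) (s.indicator 1),
      integral_sub hi (hsq.const_mul 2), integral_const_mul, integral_indicator_one hsm, mul_comm]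
  · simp only [hF, Set.indicator, Pi.one_apply, hs, mem_ofPred_eq]
    split_ifs with hz
    · have := speedWeight_le_norm_sub hγ (v := z.1) hz
      nlinarith [mul_le_mul_of_nonneg_left this (sq_nonneg (h z.1))]
    · simp

/-- Coercivity in the weighted norm for hard potentials. -/
theorem exists_coercive_weight {γ : ℝ} (hγ : γ ∈ Icc (0 : ℝ) 1) :
    ∃ C : ℝ, 0 < C ∧ ∀ h : V3 → ℝ, AEStronglyMeasurable h gauss →
      Integrable (fun v => h v ^ 2 * speedWeight γ v) gauss →
      (∀ i, ∫ v, invariant i v * h v ∂gauss = 0) →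
      ∫ v, h v ^ 2 * speedWeight γ v ∂gauss ≤
        C * ∫ p, relSpeed p ^ γ * collDiff h p ^ 2 ∂(collWeight ρ) := by
  obtain ⟨C₀, hC₀, hco⟩ := hρ.exists_coercive_hard hγ
  have hκ := hρ.pos
  have hM := gauss_unit_ball_pos
  set m : ℝ := κ * gauss.real {u : V3 | ‖u‖ ≤ 1} with hm_def
  have hm0 : 0 < m := mul_pos hκ hM
  set K : ℝ := ∫ u : V3, (2 + ‖u‖) ∂gauss with hK
  have hK0 : 0 ≤ K := integral_nonneg fun u => by simp only [Pi.zero_apply]; positivity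
  refine ⟨m⁻¹ * 4 * (1 + 3 * K * C₀) + 2 * C₀, by positivity, fun h hm hi horth => ?_⟩
  have hL := hco h hm hi horth
  have hsq := integrable_sq_of_weight hγ hm hi
  obtain ⟨i0, e0⟩ := hρ.integral_slowWeight_ge hγ hm hi
  have iD := hρ.integrable_collDiff_hard hγ hm hi
  have hAm := measurable_slowWeight γ
  have hA0 := slowWeight_nonneg γ
  have hc : Measurable collMap := measurePreserving_collMap.measurable
  have hsw : Measurable swapMap := measurePreserving_swapMap.measurable
  obtain ⟨i1, e1⟩ := hρ.integral_weight_le (a := fun p => slowWeight γ (swapMap p))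
    (hAm.comp hsw) (fun p => hA0 _) (fun p => slowWeight_le_of_snd hγ (swapMap p)) hm hsq
  obtain ⟨i2, e2⟩ := hρ.integral_weight_le (a := fun p => slowWeight γ (collMap p))
    (hAm.comp hc) (fun p => hA0 _) (slowWeight_collMap_le hγ) hm hsq
  obtain ⟨i3, e3⟩ := hρ.integral_weight_le (a := fun p => slowWeight γ (collMap (swapMap p)))
    (hAm.comp (hc.comp hsw)) (fun p => hA0 _) (slowWeight_collMap_swapMap_le hγ) hm hsq
  -- The weight multiplying `h²` at `u`, `v'` or `u'` is pulled back to `v` by the matching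
  -- symmetry, where the three preceding bounds apply.
  obtain ⟨⟨j1, f1⟩, -, -⟩ := hρ.collInvariant.integral_weight_all
    (a := fun p => slowWeight γ (swapMap p)) i1
  obtain ⟨-, ⟨j2, f2⟩, -⟩ := hρ.collInvariant.integral_weight_all
    (a := fun p => slowWeight γ (collMap p)) i2
  obtain ⟨-, -, ⟨j3, f3⟩⟩ := hρ.collInvariant.integral_weight_all
    (a := fun p => slowWeight γ (collMap (swapMap p))) i3
  simp only [swapMap_swapMap, collMap_collMap] at j1 f1 j2 f2 j3 f3
  have s1 : Integrable (fun p : Coll => relSpeed p ^ γ * collDiff h p ^ 2 +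
      slowWeight γ p * h p.2.2 ^ 2) (collWeight ρ) := iD.add j1
  have s2 : Integrable (fun p : Coll => slowWeight γ p * h (collV p) ^ 2 +
      slowWeight γ p * h (collU p) ^ 2) (collWeight ρ) := j2.add j3
  have s3 : Integrable (fun p : Coll => (relSpeed p ^ γ * collDiff h p ^ 2 +
      slowWeight γ p * h p.2.2 ^ 2) + (slowWeight γ p * h (collV p) ^ 2 +
      slowWeight γ p * h (collU p) ^ 2)) (collWeight ρ) := s1.add s2
  -- Solve the increment for `h(v) = h(v') + h(u') - h(u) - collDiff h` and square.
  have key := integral_mono i0 (s3.const_mul 4) fun p => by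
    show slowWeight γ p * h p.2.1 ^ 2 ≤ 4 * ((relSpeed p ^ γ * collDiff h p ^ 2 +
      slowWeight γ p * h p.2.2 ^ 2) + (slowWeight γ p * h (collV p) ^ 2 +
      slowWeight γ p * h (collU p) ^ 2))
    have t1 : h p.2.1 ^ 2 ≤ 4 * (collDiff h p ^ 2 + h p.2.2 ^ 2 + (h (collV p) ^ 2 +
        h (collU p) ^ 2)) := by
      have e : h p.2.1 = h (collV p) + h (collU p) - h p.2.2 - collDiff h p := by
        unfold collDiff; ring
      rw [e]
      set x := h (collV p); set y := h (collU p); set z := h p.2.2; set t := collDiff h p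
      nlinarith [sq_nonneg (x - y), sq_nonneg (x + z), sq_nonneg (x + t), sq_nonneg (y + z),
        sq_nonneg (y + t), sq_nonneg (z - t)]
    have t2 := mul_le_mul_of_nonneg_left t1 (hA0 p)
    have t3 := mul_le_mul_of_nonneg_right (slowWeight_le γ p) (sq_nonneg (collDiff h p))
    linarith
  rw [integral_const_mul, integral_add s1 s2, integral_add iD j1, integral_add j2 j3, f1, f2, f3]
    at key
  set D := ∫ p, relSpeed p ^ γ * collDiff h p ^ 2 ∂(collWeight ρ)
  set X := ∫ v, h v ^ 2 * speedWeight γ v ∂gauss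
  set Y := ∫ v, h v ^ 2 ∂gauss
  have k1 : m * (X - 2 * Y) ≤ 4 * (D + 3 * K * Y) := by linarith
  have k2 : X - 2 * Y ≤ m⁻¹ * (4 * (D + 3 * K * Y)) := by
    rw [inv_mul_eq_div, le_div_iff₀ hm0]; linarith
  -- The unweighted norms left on the right are controlled by the `L²` coercivity already proved.
  have k3 : 3 * K * Y ≤ 3 * K * (C₀ * D) := mul_le_mul_of_nonneg_left hL (by positivity)
  have k4 : m⁻¹ * (4 * (D + 3 * K * Y)) ≤ m⁻¹ * (4 * (D + 3 * K * (C₀ * D))) :=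
    mul_le_mul_of_nonneg_left (by linarith) (by positivity)
  calc X ≤ m⁻¹ * (4 * (D + 3 * K * (C₀ * D))) + 2 * (C₀ * D) := by linarith
    _ = _ := by ring

end AngularDensity

/-! ### The microscopic part -/

/-- The component of `h` orthogonal to the collision invariants in `L²(gauss)`. -/
def gaussMicro (h : V3 → ℝ) (v : V3) : ℝ :=
  h v - ∑ i, (∫ w, h w * invariant i w ∂gauss) * invariant i v

/-- Invariants have zero increment. Coercivity, proved on their orthogonal complement, therefore
applies to the microscopic part of any `h` with the same Dirichlet form. -/
theorem collDiff_gaussMicro (h : V3 → ℝ) (p : Coll) : collDiff (gaussMicro h) p = collDiff h p := by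
  have : ∑ i, (∫ w, h w * invariant i w ∂gauss) * invariant i (collV p) +
      ∑ i, (∫ w, h w * invariant i w ∂gauss) * invariant i (collU p) =
      ∑ i, (∫ w, h w * invariant i w ∂gauss) * invariant i p.2.1 +
      ∑ i, (∫ w, h w * invariant i w ∂gauss) * invariant i p.2.2 := by
    simp_rw [← Finset.sum_add_distrib, ← mul_add, invariant_conserved]
  unfold collDiff gaussMicro
  linarith

theorem aestronglyMeasurable_gaussMicro {h : V3 → ℝ} (hm : AEStronglyMeasurable h gauss) :
    AEStronglyMeasurable (gaussMicro h) gauss :=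
  hm.sub (Continuous.aestronglyMeasurable (continuous_finsetSum _ fun i _ =>
    continuous_const.mul (continuous_invariant i)))

theorem integrable_invariant_sq_weight {γ : ℝ} (hγ : γ ∈ Icc (0 : ℝ) 1) (i : Fin 5) :
    Integrable (fun v => invariant i v ^ 2 * speedWeight γ v) gauss := by
  refine ((integrable_exp_norm 3).const_mul 72).mono'
    (((continuous_invariant i).pow 2).measurable.mul (measurable_speedWeight γ)).aestronglyMeasurable
    (Filter.Eventually.of_forall fun v => ?_)
  have h1 := abs_invariant_le i v
  have h2 : speedWeight γ v ≤ 2 * Real.exp ‖v‖ := by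
    have := speedWeight_le hγ v
    have := rpow_le_one_add hγ (norm_nonneg v)
    have := Real.add_one_le_exp ‖v‖
    have := norm_nonneg v
    linarith
  have h3 := one_le_speedWeight hγ v
  rw [Real.norm_of_nonneg (by positivity), ← sq_abs]
  calc |invariant i v| ^ 2 * speedWeight γ v
      ≤ (6 * Real.exp (1 * ‖v‖)) ^ 2 * (2 * Real.exp ‖v‖) := by gcongr
    _ = 72 * (Real.exp (1 * ‖v‖) * Real.exp (1 * ‖v‖) * Real.exp ‖v‖) := by ring
    _ = 72 * Real.exp (3 * ‖v‖) := by
      rw [← Real.exp_add, ← Real.exp_add]; congr 2; ring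

/-- Bessel's inequality for one unit vector, from `∫ (h - c · invariant i)² ≥ 0`. -/
theorem integral_mul_invariant_sq_le {h : V3 → ℝ} (hh : MemLp h 2 gauss) (i : Fin 5) :
    (∫ w, h w * invariant i w ∂gauss) ^ 2 ≤ ∫ w, h w ^ 2 ∂gauss := by
  set c := ∫ w, h w * invariant i w ∂gauss with hc
  have i1 : Integrable (fun w => h w ^ 2) gauss := hh.integrable_sq
  have i2 : Integrable (fun w => 2 * c * (h w * invariant i w)) gauss :=
    (hh.integrable_mul (memLp_invariant i)).const_mul _
  have i3 : Integrable (fun w => c ^ 2 * (invariant i w * invariant i w)) gauss :=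
    ((memLp_invariant i).integrable_mul (memLp_invariant i)).const_mul _
  have i4 : Integrable (fun w => h w ^ 2 - 2 * c * (h w * invariant i w)) gauss := i1.sub i2
  have h0 : 0 ≤ ∫ w, (h w - c * invariant i w) ^ 2 ∂gauss := integral_nonneg fun w => sq_nonneg _
  have e : ∀ w, (h w - c * invariant i w) ^ 2 = h w ^ 2 - 2 * c * (h w * invariant i w) +
      c ^ 2 * (invariant i w * invariant i w) := fun w => by ring
  simp_rw [e] at h0
  rw [integral_add i4 i3, integral_sub i1 i2, integral_const_mul, integral_const_mul,
    integral_invariant_mul, ← hc, if_pos rfl] at h0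
  linarith

theorem integral_invariant_mul_gaussMicro {h : V3 → ℝ} (hh : MemLp h 2 gauss) (j : Fin 5) :
    ∫ v, invariant j v * gaussMicro h v ∂gauss = 0 := by
  have i1 : Integrable (fun v => h v * invariant j v) gauss :=
    hh.integrable_mul (memLp_invariant j)
  have i2 : ∀ i ∈ Finset.univ, Integrable (fun v => (∫ w, h w * invariant i w ∂gauss) *
      (invariant i v * invariant j v)) gauss := fun i _ =>
    ((memLp_invariant i).integrable_mul (memLp_invariant j)).const_mul _
  have e : ∀ v, invariant j v * gaussMicro h v = h v * invariant j v -
      ∑ i, (∫ w, h w * invariant i w ∂gauss) * (invariant i v * invariant j v) := fun v => by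
    unfold gaussMicro
    rw [mul_sub, Finset.mul_sum, mul_comm]
    congr 1
    exact Finset.sum_congr rfl fun i _ => by ring
  simp_rw [e]
  rw [integral_sub i1 (integrable_finsetSum _ i2), integral_finsetSum _ i2]
  simp_rw [integral_const_mul, integral_invariant_mul]
  simp

theorem exists_gaussMicro_weight_le {γ : ℝ} (hγ : γ ∈ Icc (0 : ℝ) 1) :
    ∃ C : ℝ, 0 < C ∧ ∀ h : V3 → ℝ, AEStronglyMeasurable h gauss →
      Integrable (fun v => h v ^ 2 * speedWeight γ v) gauss →
      Integrable (fun v => gaussMicro h v ^ 2 * speedWeight γ v) gauss ∧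
        ∫ v, gaussMicro h v ^ 2 * speedWeight γ v ∂gauss ≤
          C * ∫ v, h v ^ 2 * speedWeight γ v ∂gauss := by
  set S : ℝ := ∑ i, ∫ v, invariant i v ^ 2 * speedWeight γ v ∂gauss with hS
  have hw : ∀ v, 0 ≤ speedWeight γ v := fun v => zero_le_one.trans (one_le_speedWeight hγ v)
  have hS0 : 0 ≤ S := Finset.sum_nonneg fun i _ =>
    integral_nonneg fun v => mul_nonneg (sq_nonneg _) (hw v)
  -- `(x - s)² ≤ 2x² + 2s²`, and the square of the sum `s` of five terms costs a factor `5`.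
  refine ⟨2 + 10 * S, by positivity, fun h hm hi => ?_⟩
  have hsq := integrable_sq_of_weight hγ hm hi
  have hLp : MemLp h 2 gauss := (memLp_two_iff_integrable_sq hm).2 hsq
  set Y := ∫ v, h v ^ 2 ∂gauss with hY
  have hYX : Y ≤ ∫ v, h v ^ 2 * speedWeight γ v ∂gauss := integral_mono hsq hi fun v =>
    le_mul_of_one_le_right (sq_nonneg _) (one_le_speedWeight hγ v)
  have i1 : Integrable (fun v => ∑ i, invariant i v ^ 2 * speedWeight γ v) gauss :=
    integrable_finsetSum _ fun i _ => integrable_invariant_sq_weight hγ i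
  have i2 : Integrable (fun v => 2 * (h v ^ 2 * speedWeight γ v) +
      10 * Y * ∑ i, invariant i v ^ 2 * speedWeight γ v) gauss :=
    (hi.const_mul 2).add (i1.const_mul _)
  have hb : ∀ v, gaussMicro h v ^ 2 * speedWeight γ v ≤ 2 * (h v ^ 2 * speedWeight γ v) +
      10 * Y * ∑ i, invariant i v ^ 2 * speedWeight γ v := fun v => by
    rw [← Finset.sum_mul]
    set s := ∑ i, (∫ w, h w * invariant i w ∂gauss) * invariant i v with hs
    have h1 : s ^ 2 ≤ 5 * ∑ i, ((∫ w, h w * invariant i w ∂gauss) * invariant i v) ^ 2 := by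
      simpa using sq_sum_le_card_mul_sum_sq (s := (Finset.univ : Finset (Fin 5)))
        (f := fun i => (∫ w, h w * invariant i w ∂gauss) * invariant i v)
    have h2 : ∑ i, ((∫ w, h w * invariant i w ∂gauss) * invariant i v) ^ 2 ≤
        Y * ∑ i, invariant i v ^ 2 := by
      rw [Finset.mul_sum]
      refine Finset.sum_le_sum fun i _ => ?_
      rw [mul_pow]
      exact mul_le_mul_of_nonneg_right (integral_mul_invariant_sq_le hLp i) (sq_nonneg _)
    have h3 : gaussMicro h v ^ 2 ≤ 2 * h v ^ 2 + 10 * (Y * ∑ i, invariant i v ^ 2) := by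
      have : gaussMicro h v = h v - s := rfl
      rw [this]
      nlinarith [sq_nonneg (h v + s)]
    have := mul_le_mul_of_nonneg_right h3 (hw v)
    linarith
  have hmm := aestronglyMeasurable_gaussMicro hm
  have i3 : Integrable (fun v => gaussMicro h v ^ 2 * speedWeight γ v) gauss := by
    refine i2.mono' ((hmm.pow 2).mul (measurable_speedWeight γ).aestronglyMeasurable)
      (Filter.Eventually.of_forall fun v => ?_)
    rw [Real.norm_of_nonneg (mul_nonneg (sq_nonneg _) (hw v))]
    exact hb v
  refine ⟨i3, (integral_mono i3 i2 hb).trans ?_⟩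
  rw [integral_add (hi.const_mul 2) (i1.const_mul _), integral_const_mul, integral_const_mul,
    integral_finsetSum _ fun i _ => integrable_invariant_sq_weight hγ i, ← hS]
  nlinarith [mul_le_mul_of_nonneg_right hYX hS0]

/-! ### The weak form -/

namespace CollInvariant

variable {μ : Measure Coll} (hμ : CollInvariant μ)
include hμ

theorem withDensity {φ : Coll → ENNReal} (hφ : Measurable φ)
    (h1 : ∀ p, φ (collMap p) = φ p) (h2 : ∀ p, φ (swapMap p) = φ p) :
    CollInvariant (μ.withDensity φ) :=
  ⟨measurePreserving_withDensity_of_comp hμ.coll hφ h1,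
    measurePreserving_withDensity_of_comp hμ.swap hφ h2⟩

/-- The weighted weak form of the collision operator. -/
theorem integral_weight_collDiff_mul {a : Coll → ℝ} {h : V3 → ℝ} (ha : Measurable a)
    (ha0 : ∀ p, 0 ≤ a p) (h1 : ∀ p, a (collMap p) = a p) (h2 : ∀ p, a (swapMap p) = a p)
    (hm : AEStronglyMeasurable (fun p : Coll => h p.2.1) μ)
    (hi : Integrable (fun p => a p * h p.2.1 ^ 2) μ) :
    Integrable (fun p => a p * (h (collV p) * h p.2.1)) μ ∧
    Integrable (fun p => a p * (h (collU p) * h p.2.1)) μ ∧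
    Integrable (fun p => a p * (h p.2.2 * h p.2.1)) μ ∧
    ∫ p, a p * collDiff h p ^ 2 ∂μ = -4 * ∫ p, a p * (collDiff h p * h p.2.1) ∂μ := by
  have ham : Measurable fun p => ENNReal.ofReal (a p) := ha.ennreal_ofReal
  -- An invariant weight can be absorbed into the measure, which reduces the claim to the unweighted
  -- weak form.
  have hν : CollInvariant (μ.withDensity fun p => ENNReal.ofReal (a p)) :=
    hμ.withDensity ham (fun p => by rw [h1]) fun p => by rw [h2]
  have hint : ∀ F : Coll → ℝ, Integrable F (μ.withDensity fun p => ENNReal.ofReal (a p)) ↔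
      Integrable (fun p => a p * F p) μ := fun F => by
    rw [integrable_withDensity_iff_integrable_smul' ham (by simp)]
    refine integrable_congr (Filter.Eventually.of_forall fun p => ?_)
    simp only [ENNReal.toReal_ofReal (ha0 p), smul_eq_mul]
  have hval : ∀ F : Coll → ℝ, ∫ p, F p ∂(μ.withDensity fun p => ENNReal.ofReal (a p)) =
      ∫ p, a p * F p ∂μ := fun F => by
    rw [integral_withDensity_eq_integral_toReal_smul ham (by simp)]
    congr 1; ext p
    rw [ENNReal.toReal_ofReal (ha0 p), smul_eq_mul]
  have hL : MemLp (fun p : Coll => h p.2.1) 2 (μ.withDensity fun p => ENNReal.ofReal (a p)) :=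
    (memLp_two_iff_integrable_sq (hm.mono_ac (withDensity_absolutelyContinuous _ _))).2
      ((hint _).2 hi)
  obtain ⟨m2, m3, m4⟩ := hν.memLp_all hL
  have e := hν.integral_collDiff_mul hL hL
  simp only [← sq] at e
  rw [hval, hval] at e
  exact ⟨(hint _).1 (m3.integrable_mul hL), (hint _).1 (m4.integrable_mul hL),
    (hint _).1 (m2.integrable_mul hL), e⟩

end CollInvariant

/-! ### The Grad cut-off cross section -/

theorem GradCutoff.apply_half_pi {q₀ : ℝ → ℝ} (hq : GradCutoff q₀) : q₀ (Real.pi / 2) = 0 := by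
  obtain ⟨C, hC⟩ := hq.le_cos
  have hmem : Real.pi / 2 ∈ Icc 0 Real.pi := ⟨by positivity, by linarith [Real.pi_pos]⟩
  have := hC _ hmem
  rw [Real.cos_pi_div_two, abs_zero, mul_zero] at this
  exact le_antisymm this (hq.nonneg _ hmem)

theorem GradCutoff.exists_bound {q₀ : ℝ → ℝ} (hq : GradCutoff q₀) :
    ∃ C, 0 ≤ C ∧ ∀ θ ∈ Icc 0 Real.pi, q₀ θ ≤ C := by
  obtain ⟨C, hC⟩ := hq.le_cos
  refine ⟨|C|, abs_nonneg _, fun θ hθ => (hC θ hθ).trans ?_⟩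
  have h1 := Real.abs_cos_le_one θ
  have h2 := abs_nonneg (Real.cos θ)
  have h3 := le_abs_self C
  have h4 := abs_nonneg C
  nlinarith

/-- A nontrivial cross section has a nontrivial integral over the sphere. -/
theorem GradCutoff.integral_pos {q₀ : ℝ → ℝ} (hq : GradCutoff q₀) (e : V3) (he : ‖e‖ = 1) :
    0 < ∫ ω : S2, q₀ (InnerProductGeometry.angle e ω) *
      (Real.cos (InnerProductGeometry.angle e ω) ^ 2 *
        Real.sin (InnerProductGeometry.angle e ω) ^ 2) ∂sphereMeasure := by
  have hang : Measurable fun ω : S2 => InnerProductGeometry.angle e (ω : V3) :=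
    measurable_angle measurable_const measurable_subtype_coe
  set F : S2 → ℝ := fun ω => q₀ (InnerProductGeometry.angle e ω) *
      (Real.cos (InnerProductGeometry.angle e ω) ^ 2 *
        Real.sin (InnerProductGeometry.angle e ω) ^ 2) with hF
  have hFm : Measurable F := by
    have := hq.measurable
    rw [hF]; fun_prop
  have h0 : ∀ ω, 0 ≤ F ω := fun ω =>
    mul_nonneg (hq.nonneg _ (angle_mem_Icc _ _)) (by positivity)
  obtain ⟨C, hC0, hC⟩ := hq.exists_bound
  have hFi : Integrable F sphereMeasure := by
    refine (integrable_const C).mono' hFm.aestronglyMeasurable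
      (Filter.Eventually.of_forall fun ω => ?_)
    rw [Real.norm_of_nonneg (h0 ω)]
    have h1 := hC _ (angle_mem_Icc e (ω : V3))
    have h2 := (cos_sq_mul_sin_sq_le (InnerProductGeometry.angle e (ω : V3))).1
    have h3 := hq.nonneg _ (angle_mem_Icc e (ω : V3))
    simp only [hF]
    nlinarith
  refine lt_of_le_of_ne (integral_nonneg h0) fun hz => ?_
  have hae := (integral_eq_zero_iff_of_nonneg h0 hFi).1 hz.symm
  -- Away from `0`, `π/2` and `π` the trigonometric factor is nonzero, so a vanishing integral would
  -- make almost every direction miss `N`. Then `N` would be null, against nontriviality of `q₀`.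
  set N : Set ℝ := {θ | q₀ θ ≠ 0} ∩ (Ioo 0 Real.pi \ {Real.pi / 2}) with hN
  have hNm : MeasurableSet N :=
    (hq.measurable (measurableSet_singleton 0).compl).inter
      (measurableSet_Ioo.diff (measurableSet_singleton _))
  have hN0 : volume N = 0 := by
    refine volume_eq_zero_of_angle hNm (fun θ hθ => hθ.2.1) he ?_
    refine measure_mono_null (fun ω hω => ?_) (ae_iff.1 hae)
    obtain ⟨hq', hmem, hne⟩ := hω
    have hs : 0 < Real.sin (InnerProductGeometry.angle e (ω : V3)) :=
      Real.sin_pos_of_pos_of_lt_pi hmem.1 hmem.2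
    have hc : Real.cos (InnerProductGeometry.angle e (ω : V3)) ≠ 0 := fun hc => hne (by
      rw [mem_singleton_iff]
      refine Real.injOn_cos ⟨hmem.1.le, hmem.2.le⟩ ⟨by positivity, by linarith [Real.pi_pos]⟩ ?_
      rw [hc, Real.cos_pi_div_two])
    have hq'' : q₀ (InnerProductGeometry.angle e (ω : V3)) ≠ 0 := hq'
    simp only [mem_ofPred_eq, hF, Pi.zero_apply]
    exact mul_ne_zero hq'' (mul_ne_zero (pow_ne_zero _ hc) (pow_ne_zero _ hs.ne'))
  refine hq.nontrivial.ne' ?_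
  refine measure_mono_null (t := N ∪ ({0, Real.pi / 2, Real.pi} : Set ℝ)) (fun θ hθ => ?_)
    (measure_union_null hN0 ((Set.toFinite _).measure_zero _))
  obtain ⟨⟨ha, hb⟩, hne⟩ := hθ
  simp only [hN, mem_union, mem_inter_iff, mem_ofPred_eq, mem_sdiff, mem_Ioo, mem_singleton_iff,
    mem_insert_iff]
  rcases ha.eq_or_lt with h | h
  · right; left; exact h.symm
  · rcases hb.eq_or_lt with h' | h'
    · right; right; right; exact h'
    · by_cases h'' : θ = Real.pi / 2
      · right; right; left; exact h''
      · left; exact ⟨hne, ⟨h, h'⟩, h''⟩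

/-- Divide by the mass `b` of `q₀` on one axis; rotational symmetry covers all axes. Positivity of
`b` follows since it dominates the positive integral with the factor `cos² sin²`. -/
theorem GradCutoff.exists_angularDensity {q₀ : ℝ → ℝ} (hq : GradCutoff q₀) :
    ∃ b κ : ℝ, 0 < b ∧ AngularDensity (fun θ => b⁻¹ * q₀ θ) κ := by
  set e : V3 := stdVec 0 with he_def
  have he : ‖e‖ = 1 := norm_stdVec 0
  have he0 : e ≠ 0 := norm_ne_zero_iff.1 (by rw [he]; norm_num)
  have hκ := hq.integral_pos e he
  set k := ∫ ω : S2, q₀ (InnerProductGeometry.angle e ω) *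
      (Real.cos (InnerProductGeometry.angle e ω) ^ 2 *
        Real.sin (InnerProductGeometry.angle e ω) ^ 2) ∂sphereMeasure with hk
  set b := ∫ ω : S2, q₀ (InnerProductGeometry.angle e ω) ∂sphereMeasure with hb
  obtain ⟨C, hC0, hC⟩ := hq.exists_bound
  have hang : Measurable fun ω : S2 => InnerProductGeometry.angle e (ω : V3) :=
    measurable_angle measurable_const measurable_subtype_coe
  have hqi : Integrable (fun ω : S2 => q₀ (InnerProductGeometry.angle e ω)) sphereMeasure := by
    refine (integrable_const C).mono' (hq.measurable.comp hang).aestronglyMeasurable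
      (Filter.Eventually.of_forall fun ω => ?_)
    rw [Real.norm_of_nonneg (hq.nonneg _ (angle_mem_Icc _ _))]
    exact hC _ (angle_mem_Icc _ _)
  have hb0 : 0 < b := by
    refine lt_of_lt_of_le hκ (integral_mono_of_nonneg (Filter.Eventually.of_forall fun ω =>
      mul_nonneg (hq.nonneg _ (angle_mem_Icc _ _)) (by positivity)) hqi
      (Filter.Eventually.of_forall fun ω => ?_))
    exact mul_le_of_le_one_right (hq.nonneg _ (angle_mem_Icc _ _)) (cos_sq_mul_sin_sq_le _).1
  refine ⟨b, b⁻¹ * k, hb0, ?_⟩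
  constructor
  · exact hq.measurable.const_mul _
  · exact fun θ hθ => mul_nonneg (inv_nonneg.2 hb0.le) (hq.nonneg θ hθ)
  · exact ⟨b⁻¹ * C, by positivity, fun θ hθ => mul_le_mul_of_nonneg_left (hC θ hθ) (by positivity)⟩
  · rw [hq.apply_half_pi, mul_zero]
  · intro a ha
    rw [integral_angle_eq (fun θ => b⁻¹ * q₀ θ) ha he0, integral_const_mul, ← hb,
      inv_mul_cancel₀ hb0.ne']
  · positivity
  · intro a ha
    rw [integral_angle_eq (fun θ => b⁻¹ * q₀ θ * (Real.cos θ ^ 2 * Real.sin θ ^ 2)) ha he0]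
    simp_rw [mul_assoc]
    rw [integral_const_mul]

/-! ### The linearized operator with respect to the Gaussian -/

/-- The collision kernel as a function on collision configurations. -/
def kernel (γ : ℝ) (q₀ : ℝ → ℝ) (p : Coll) : ℝ := relSpeed p ^ γ * q₀ (collAngle p)

theorem GradCutoff.kernel_nonneg {q₀ : ℝ → ℝ} (hq : GradCutoff q₀) (γ : ℝ) (p : Coll) :
    0 ≤ kernel γ q₀ p :=
  mul_nonneg (Real.rpow_nonneg (relSpeed_nonneg p) _) (hq.nonneg _ (collAngle_mem p))

theorem GradCutoff.measurable_kernel {q₀ : ℝ → ℝ} (hq : GradCutoff q₀) (γ : ℝ) :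
    Measurable (kernel γ q₀) :=
  (measurable_relSpeed.pow_const γ).mul (hq.measurable.comp measurable_collAngle)

theorem kernel_collMap (γ : ℝ) (q₀ : ℝ → ℝ) (p : Coll) :
    kernel γ q₀ (collMap p) = kernel γ q₀ p := by
  rw [kernel, relSpeed_collMap, collAngle_collMap, kernel]

theorem kernel_swapMap (γ : ℝ) (q₀ : ℝ → ℝ) (p : Coll) :
    kernel γ q₀ (swapMap p) = kernel γ q₀ p := by
  rw [kernel, relSpeed_swapMap, collAngle_swapMap, kernel]

theorem collInvariant_collMeasure : CollInvariant collMeasure :=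
  ⟨measurePreserving_collMap, measurePreserving_swapMap⟩

/-- The configuration with velocities `v`, `u` and axis `ω`, as a function of `v` and `(u, ω)`. -/
def config (z : V3 × (V3 × S2)) : Coll := (z.2.2, (z.1, z.2.1))

theorem measurableEmbedding_config : MeasurableEmbedding config :=
  (MeasurableEquiv.prodAssoc.symm.trans
    (MeasurableEquiv.prodComm (α := V3 × V3) (β := S2))).measurableEmbedding

theorem measurePreserving_config :
    MeasurePreserving config (gauss.prod (gauss.prod sphereMeasure)) collMeasure :=
  Measure.measurePreserving_swap.comp
    ((measurePreserving_prodAssoc gauss gauss sphereMeasure).symm MeasurableEquiv.prodAssoc)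

theorem quasiMeasurePreserving_fst_collMeasure :
    Measure.QuasiMeasurePreserving (fun p : Coll => p.2.1) collMeasure gauss :=
  Measure.quasiMeasurePreserving_fst.comp Measure.quasiMeasurePreserving_snd

/-- The part of the linearized operator with the increment `h(u') - h(u)`, in the Gaussian gauge. -/
def gainDiffU (γ : ℝ) (q₀ : ℝ → ℝ) (h : V3 → ℝ) (v : V3) : ℝ :=
  ∫ z : V3 × S2, kernel γ q₀ (config (v, z)) * (h (collU (config (v, z))) - h z.1)
    ∂(gauss.prod sphereMeasure)

/-- The part of the linearized operator with the increment `h(v') - h(v)`, in the Gaussian gauge. -/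
def gainDiffV (γ : ℝ) (q₀ : ℝ → ℝ) (h : V3 → ℝ) (v : V3) : ℝ :=
  ∫ z : V3 × S2, kernel γ q₀ (config (v, z)) * (h (collV (config (v, z))) - h v)
    ∂(gauss.prod sphereMeasure)

/-- The coercivity for the normalised angular density, rescaled by its mass `b` and applied to the
microscopic part, together with the upper bound that separates the variables in `|v - u|^γ`. -/
theorem exists_kernel_bounds {γ : ℝ} (hγ : γ ∈ Icc (0 : ℝ) 1) {q₀ : ℝ → ℝ} (hq : GradCutoff q₀) :
    ∃ C δ : ℝ, 0 < C ∧ 0 < δ ∧ ∀ h : V3 → ℝ, AEStronglyMeasurable h gauss →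
      Integrable (fun v => h v ^ 2 * speedWeight γ v) gauss →
      Integrable (fun p : Coll => kernel γ q₀ p * h p.2.1 ^ 2) collMeasure ∧
      ∫ p : Coll, kernel γ q₀ p * h p.2.1 ^ 2 ∂collMeasure ≤
        C * ∫ v, h v ^ 2 * speedWeight γ v ∂gauss ∧
      δ * ∫ v, gaussMicro h v ^ 2 * speedWeight γ v ∂gauss ≤
        ∫ p : Coll, kernel γ q₀ p * collDiff h p ^ 2 ∂collMeasure := by
  obtain ⟨b, κ, hb, hρ⟩ := hq.exists_angularDensity
  obtain ⟨C, hC, hco⟩ := hρ.exists_coercive_weight hγ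
  obtain ⟨_, _, hmic⟩ := exists_gaussMicro_weight_le hγ
  set K : ℝ := ∫ u : V3, (2 + ‖u‖) ∂gauss with hK
  have hK0 : 0 ≤ K := integral_nonneg fun u => by simp only [Pi.zero_apply]; positivity
  have hval : ∀ F : Coll → ℝ, ∫ p, kernel γ q₀ p * F p ∂collMeasure =
      b * ∫ p, relSpeed p ^ γ * F p ∂(collWeight fun θ => b⁻¹ * q₀ θ) := fun F => by
    rw [hρ.integral_collWeight, ← integral_const_mul]
    congr 1; ext p
    unfold kernel
    field_simp
  have hint : ∀ F : Coll → ℝ,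
      Integrable (fun p => relSpeed p ^ γ * F p) (collWeight fun θ => b⁻¹ * q₀ θ) →
      Integrable (fun p => kernel γ q₀ p * F p) collMeasure := fun F hF => by
    unfold collWeight at hF
    rw [integrable_withDensity_iff_integrable_smul' hρ.measurable_collAngle.ennreal_ofReal
      (by simp)] at hF
    refine (hF.const_mul b).congr (Filter.Eventually.of_forall fun p => ?_)
    simp only [smul_eq_mul]
    rw [ENNReal.toReal_ofReal (hρ.nonneg _ (collAngle_mem p)), kernel]
    field_simp
  -- The summand `1` only serves to make the constant visibly positive.
  refine ⟨b * K + 1, b / C, by positivity, by positivity, fun h hm hi => ?_⟩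
  have hF : Integrable (fun z : V3 × V3 => ‖z.1 - z.2‖ ^ γ * h z.1 ^ 2) (gauss.prod gauss) :=
    AngularDensity.integrable_relSpeed_mul hγ hm hi
  have hp := hρ.integrable_pair (F := fun z : V3 × V3 => ‖z.1 - z.2‖ ^ γ * h z.1 ^ 2) hF
  have hX : 0 ≤ ∫ v, h v ^ 2 * speedWeight γ v ∂gauss := integral_nonneg fun v =>
    mul_nonneg (sq_nonneg _) (zero_le_one.trans (one_le_speedWeight hγ v))
  refine ⟨hint (fun p => h p.2.1 ^ 2) hp, ?_, ?_⟩
  · rw [hval fun p => h p.2.1 ^ 2]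
    have e1 := hρ.integral_pair (F := fun z : V3 × V3 => ‖z.1 - z.2‖ ^ γ * h z.1 ^ 2) hF.1
    have e2 : ∫ z : V3 × V3, ‖z.1 - z.2‖ ^ γ * h z.1 ^ 2 ∂(gauss.prod gauss) ≤
        (∫ v, h v ^ 2 * speedWeight γ v ∂gauss) * K := by
      rw [hK, ← integral_prod_mul (fun v => h v ^ 2 * speedWeight γ v) fun u => 2 + ‖u‖]
      refine integral_mono hF (hi.mul_prod integrable_two_add_norm) fun z => ?_
      have := norm_sub_rpow_le hγ z.1 z.2
      nlinarith [mul_le_mul_of_nonneg_left this (sq_nonneg (h z.1))]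
    have e3 : ∫ p : Coll, relSpeed p ^ γ * h p.2.1 ^ 2 ∂(collWeight fun θ => b⁻¹ * q₀ θ) ≤
        (∫ v, h v ^ 2 * speedWeight γ v ∂gauss) * K := le_of_eq_of_le e1 e2
    have := mul_le_mul_of_nonneg_left e3 hb.le
    linarith
  · have hLp : MemLp h 2 gauss :=
      (memLp_two_iff_integrable_sq hm).2 (integrable_sq_of_weight hγ hm hi)
    have h1 := hco (gaussMicro h) (aestronglyMeasurable_gaussMicro hm) (hmic h hm hi).1
      (integral_invariant_mul_gaussMicro hLp)
    simp only [collDiff_gaussMicro] at h1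
    rw [hval fun p => collDiff h p ^ 2, div_mul_eq_mul_div, div_le_iff₀ hC]
    nlinarith [mul_le_mul_of_nonneg_left h1 hb.le]

/-- Boundedness and coercivity of the linearized operator in the Gaussian gauge. -/
theorem exists_gainDiff_bounds {γ : ℝ} (hγ : γ ∈ Icc (0 : ℝ) 1) {q₀ : ℝ → ℝ}
    (hq : GradCutoff q₀) :
    ∃ C δ : ℝ, 0 < C ∧ 0 < δ ∧ ∀ h : V3 → ℝ, AEStronglyMeasurable h gauss →
      Integrable (fun v => h v ^ 2 * speedWeight γ v) gauss →
      Integrable (fun v => (gainDiffU γ q₀ h v + gainDiffV γ q₀ h v) * h v) gauss ∧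
      ∫ v, ‖(gainDiffU γ q₀ h v + gainDiffV γ q₀ h v) * h v‖ ∂gauss ≤
        C * ∫ v, h v ^ 2 * speedWeight γ v ∂gauss ∧
      δ * ∫ v, gaussMicro h v ^ 2 * speedWeight γ v ∂gauss ≤
        -∫ v, (gainDiffU γ q₀ h v + gainDiffV γ q₀ h v) * h v ∂gauss := by
  obtain ⟨C, δ, hC, hδ, H⟩ := exists_kernel_bounds hγ hq
  -- Each of the two pieces has norm at most `2C` by weighted Young inequalities; the `4` dividing
  -- `δ` is the factor of the weak form.
  refine ⟨4 * C, δ / 4, by positivity, by positivity, fun h hm hi => ?_⟩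
  obtain ⟨hK, hKle, hco⟩ := H h hm hi
  have hm1 : AEStronglyMeasurable (fun p : Coll => h p.2.1) collMeasure :=
    hm.comp_quasiMeasurePreserving quasiMeasurePreserving_fst_collMeasure
  have hk0 := hq.kernel_nonneg γ
  obtain ⟨iV, iU, i2, e⟩ := collInvariant_collMeasure.integral_weight_collDiff_mul
    (hq.measurable_kernel γ) hk0 (kernel_collMap γ q₀) (kernel_swapMap γ q₀) hm1 hK
  obtain ⟨⟨j1, f1⟩, ⟨j2, f2⟩, ⟨j3, f3⟩⟩ := collInvariant_collMeasure.integral_weight_all hK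
  simp only [kernel_swapMap, kernel_collMap] at j1 f1 j2 f2 j3 f3
  -- The increment is split as in the two collision integrals of the linearized operator, so each
  -- piece must be integrable by itself. Square integrability against the kernel provides this.
  set G₁ : Coll → ℝ := fun p => kernel γ q₀ p * (h (collU p) - h p.2.2) * h p.2.1 with hG₁
  set G₂ : Coll → ℝ := fun p => kernel γ q₀ p * (h (collV p) - h p.2.1) * h p.2.1 with hG₂
  have g1 : Integrable G₁ collMeasure := by
    refine (iU.sub i2).congr (Filter.Eventually.of_forall fun p => ?_)
    simp only [hG₁, Pi.sub_apply]; ring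
  have g2 : Integrable G₂ collMeasure := by
    refine (iV.sub hK).congr (Filter.Eventually.of_forall fun p => ?_)
    simp only [hG₂, Pi.sub_apply]; ring
  have n1 : ∫ p, ‖G₁ p‖ ∂collMeasure ≤ 2 * (C * ∫ v, h v ^ 2 * speedWeight γ v ∂gauss) := by
    have s1 : Integrable (fun p => (1 / 2) * (kernel γ q₀ p * h (collU p) ^ 2) +
        (1 / 2) * (kernel γ q₀ p * h p.2.2 ^ 2)) collMeasure :=
      (j3.const_mul _).add (j1.const_mul _)
    refine (integral_mono g1.norm (s1.add hK) fun p => ?_).trans ?_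
    · simp only [hG₁, norm_mul, Real.norm_eq_abs, abs_of_nonneg (hk0 p), Pi.add_apply]
      have h1 : |h (collU p) - h p.2.2| * |h p.2.1| ≤
          1 / 2 * h (collU p) ^ 2 + 1 / 2 * h p.2.2 ^ 2 + h p.2.1 ^ 2 := by
        rw [← abs_mul, abs_le]
        set x := h (collU p); set y := h p.2.2; set z := h p.2.1
        constructor <;> nlinarith [sq_nonneg (x + z), sq_nonneg (x - z), sq_nonneg (y + z),
          sq_nonneg (y - z)]
      have := mul_le_mul_of_nonneg_left h1 (hk0 p)
      linarith
    · have e1 : ∫ p, (fun p => (1 / 2) * (kernel γ q₀ p * h (collU p) ^ 2) +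
          (1 / 2) * (kernel γ q₀ p * h p.2.2 ^ 2)) p + kernel γ q₀ p * h p.2.1 ^ 2 ∂collMeasure =
          2 * ∫ p : Coll, kernel γ q₀ p * h p.2.1 ^ 2 ∂collMeasure := by
        rw [integral_add s1 hK, integral_add (j3.const_mul _) (j1.const_mul _), integral_const_mul,
          integral_const_mul, f1, f3]
        ring
      refine le_of_eq_of_le e1 (by linarith)
  have n2 : ∫ p, ‖G₂ p‖ ∂collMeasure ≤ 2 * (C * ∫ v, h v ^ 2 * speedWeight γ v ∂gauss) := by
    have s1 : Integrable (fun p : Coll => (1 / 2) * (kernel γ q₀ p * h (collV p) ^ 2) +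
        (3 / 2) * (kernel γ q₀ p * h p.2.1 ^ 2)) collMeasure :=
      (j2.const_mul _).add (hK.const_mul _)
    refine (integral_mono g2.norm s1 fun p => ?_).trans ?_
    · simp only [hG₂, norm_mul, Real.norm_eq_abs, abs_of_nonneg (hk0 p)]
      have h1 : |h (collV p) - h p.2.1| * |h p.2.1| ≤
          1 / 2 * h (collV p) ^ 2 + 3 / 2 * h p.2.1 ^ 2 := by
        rw [← abs_mul, abs_le]
        set x := h (collV p); set z := h p.2.1
        constructor <;> nlinarith [sq_nonneg (x + z), sq_nonneg (x - z), sq_nonneg z]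
      have := mul_le_mul_of_nonneg_left h1 (hk0 p)
      linarith
    · rw [integral_add (j2.const_mul _) (hK.const_mul _), integral_const_mul,
        integral_const_mul, f2]
      linarith
  have c1 : Integrable (fun z => G₁ (config z)) (gauss.prod (gauss.prod sphereMeasure)) :=
    measurePreserving_config.integrable_comp_of_integrable g1
  have c2 : Integrable (fun z => G₂ (config z)) (gauss.prod (gauss.prod sphereMeasure)) :=
    measurePreserving_config.integrable_comp_of_integrable g2
  have hcomp : ∀ F : Coll → ℝ, ∫ z, F (config z) ∂(gauss.prod (gauss.prod sphereMeasure)) =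
      ∫ p, F p ∂collMeasure := fun F =>
    measurePreserving_config.integral_comp measurableEmbedding_config F
  have hfib : ∀ v, (gainDiffU γ q₀ h v + gainDiffV γ q₀ h v) * h v =
      ∫ z, G₁ (config (v, z)) ∂(gauss.prod sphereMeasure) +
      ∫ z, G₂ (config (v, z)) ∂(gauss.prod sphereMeasure) := fun v => by
    rw [add_mul, gainDiffU, gainDiffV, ← integral_mul_const, ← integral_mul_const]
    rfl
  have hfi := c1.integral_prod_left.add c2.integral_prod_left
  have hfi' : Integrable (fun v => (gainDiffU γ q₀ h v + gainDiffV γ q₀ h v) * h v) gauss :=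
    hfi.congr (Filter.Eventually.of_forall fun v => (hfib v).symm)
  refine ⟨hfi', ?_, ?_⟩
  · have m1 := c1.integral_norm_prod_left
    have m2 := c2.integral_norm_prod_left
    refine (integral_mono hfi'.norm (m1.add m2) fun v => ?_).trans ?_
    · simp only [hfib, Pi.add_apply]
      exact (norm_add_le _ _).trans
        (add_le_add (norm_integral_le_integral_norm _) (norm_integral_le_integral_norm _))
    · have a1 : ∫ v, ((∫ z, ‖G₁ (config (v, z))‖ ∂(gauss.prod sphereMeasure)) +
          ∫ z, ‖G₂ (config (v, z))‖ ∂(gauss.prod sphereMeasure)) ∂gauss =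
          ∫ p, ‖G₁ p‖ ∂collMeasure + ∫ p, ‖G₂ p‖ ∂collMeasure := by
        rw [integral_add m1 m2, ← integral_prod _ c1.norm, ← integral_prod _ c2.norm,
          hcomp fun p => ‖G₁ p‖, hcomp fun p => ‖G₂ p‖]
      refine le_of_eq_of_le a1 (by linarith)
  · have a1 : ∫ v, (gainDiffU γ q₀ h v + gainDiffV γ q₀ h v) * h v ∂gauss =
        ∫ p, kernel γ q₀ p * (collDiff h p * h p.2.1) ∂collMeasure := by
      simp_rw [hfib]
      rw [integral_add c1.integral_prod_left c2.integral_prod_left, ← integral_prod _ c1,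
        ← integral_prod _ c2, hcomp G₁, hcomp G₂, ← integral_add g1 g2]
      congr 1; ext p
      simp only [hG₁, hG₂, collDiff]; ring
    rw [a1]
    linarith

/-! ### The linearized operator at a fixed position -/

theorem integral_gauss_prod_sphere (F : V3 × S2 → ℝ) :
    ∫ z, F z ∂(gauss.prod sphereMeasure) =
      ∫ z, gaussDensity z.1 * F z ∂((volume : Measure V3).prod sphereMeasure) := by
  have hm : Measurable fun z : V3 × S2 => ENNReal.ofReal (gaussDensity z.1) :=
    (continuous_gaussDensity.measurable.comp measurable_fst).ennreal_ofReal
  unfold gauss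
  rw [prod_withDensity_left continuous_gaussDensity.measurable.ennreal_ofReal,
    integral_withDensity_eq_integral_toReal_smul hm (by simp)]
  congr 1; ext z
  rw [ENNReal.toReal_ofReal (gaussDensity_pos _).le, smul_eq_mul]

theorem gaussDensity_collV_mul (p : Coll) :
    gaussDensity (collV p) * gaussDensity (collU p) =
      gaussDensity p.2.1 * gaussDensity p.2.2 := by
  have h := norm_sq_collV_add p
  unfold gaussDensity
  rw [mul_mul_mul_comm, mul_mul_mul_comm _ (Real.exp _), ← Real.exp_add, ← Real.exp_add]
  congr 2
  linarith

/-- Galilean invariance: kernel and collision rule depend only on relative velocities. -/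
theorem Q_add_left (γ : ℝ) (q₀ : ℝ → ℝ) (F₁ F₂ : V3 → ℝ) (a w : V3) :
    Q γ q₀ F₁ F₂ (a + w) = Q γ q₀ (fun y => F₁ (a + y)) (fun y => F₂ (a + y)) w := by
  have hmp : MeasurePreserving (Prod.map (fun y : V3 => a + y) (id : S2 → S2))
      ((volume : Measure V3).prod sphereMeasure) ((volume : Measure V3).prod sphereMeasure) :=
    (measurePreserving_add_left volume a).prod (MeasurePreserving.id _)
  have hme : MeasurableEmbedding (Prod.map (fun y : V3 => a + y) (id : S2 → S2)) :=
    (measurableEmbedding_addLeft a).prodMap MeasurableEmbedding.id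
  unfold Q
  rw [← hmp.integral_comp hme]
  congr 1; ext z
  have h1 : a + w - (a + z.1) = w - z.1 := by abel
  have h2 : a + z.1 - (a + w) = z.1 - w := by abel
  simp only [Prod.map, id, collisionKernel, postU, postV, h1, h2, add_sub_assoc, add_assoc]

/-- Conservation of energy makes the product of the Gaussians the same before and after collision,
so it factors out and leaves `h(u') - h(u)`. -/
theorem Q_gauss_left (γ : ℝ) (q₀ : ℝ → ℝ) (E : ℝ) (h : V3 → ℝ) (w : V3) :
    Q γ q₀ (fun y => E * gaussDensity y) (fun y => gaussDensity y * h y) w =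
      E * gaussDensity w * gainDiffU γ q₀ h w := by
  rw [gainDiffU, integral_gauss_prod_sphere, ← integral_const_mul, Q]
  congr 1; ext z
  have h1 : gaussDensity (postV z.1 w z.2) * gaussDensity (postU z.1 w z.2) =
    gaussDensity w * gaussDensity z.1 := gaussDensity_collV_mul (config (w, z))
  have h2 : collU (config (w, z)) = postU z.1 w z.2 := rfl
  have h3 : kernel γ q₀ (config (w, z)) = collisionKernel γ q₀ z.1 w z.2 := rfl
  rw [h2, h3]
  linear_combination collisionKernel γ q₀ z.1 w z.2 * E * h (postU z.1 w z.2) * h1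

theorem Q_gauss_right (γ : ℝ) (q₀ : ℝ → ℝ) (E : ℝ) (h : V3 → ℝ) (w : V3) :
    Q γ q₀ (fun y => gaussDensity y * h y) (fun y => E * gaussDensity y) w =
      E * gaussDensity w * gainDiffV γ q₀ h w := by
  rw [gainDiffV, integral_gauss_prod_sphere, ← integral_const_mul, Q]
  congr 1; ext z
  have h1 : gaussDensity (postV z.1 w z.2) * gaussDensity (postU z.1 w z.2) =
    gaussDensity w * gaussDensity z.1 := gaussDensity_collV_mul (config (w, z))
  have h2 : collV (config (w, z)) = postV z.1 w z.2 := rfl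
  have h3 : kernel γ q₀ (config (w, z)) = collisionKernel γ q₀ z.1 w z.2 := rfl
  rw [h2, h3]
  linear_combination collisionKernel γ q₀ z.1 w z.2 * E * h (postV z.1 w z.2) * h1

theorem mMaxwellian_cross_add (ϖ x w : V3) : mMaxwellian ϖ x (cross ϖ x + w) = gaussDensity w := by
  rw [mMaxwellian, add_sub_cancel_left, gaussDensity]

/-- The function `f(x, ·)` in the Gaussian gauge. -/
def gauge (ϖ : V3) (f : V3 → V3 → ℝ) (x w : V3) : ℝ :=
  f x (cross ϖ x + w) / Real.sqrt (gaussDensity w)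

theorem sqrt_gaussDensity_pos (w : V3) : 0 < Real.sqrt (gaussDensity w) :=
  Real.sqrt_pos.2 (gaussDensity_pos w)

theorem sqrt_gaussDensity_mul_self (w : V3) :
    Real.sqrt (gaussDensity w) * Real.sqrt (gaussDensity w) = gaussDensity w :=
  Real.mul_self_sqrt (gaussDensity_pos w).le

theorem apply_cross_add (ϖ : V3) (f : V3 → V3 → ℝ) (x w : V3) :
    f x (cross ϖ x + w) = Real.sqrt (gaussDensity w) * gauge ϖ f x w := by
  rw [gauge, mul_div_cancel₀ _ (sqrt_gaussDensity_pos w).ne']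

/-- Recentring turns `m_ϖ` into the standard Gaussian. Position and rotation then enter only through
the gauge of `f` and the factor relating `μ_ϖ` to `m_ϖ`. -/
theorem linOp_cross_add (γ : ℝ) (q₀ : ℝ → ℝ) (ϖ : V3) (f : V3 → V3 → ℝ) (x w : V3) :
    linOp γ q₀ ϖ f x (cross ϖ x + w) = -(Real.exp (‖cross ϖ x‖ ^ 2 / 2) *
      Real.sqrt (gaussDensity w) *
        (gainDiffU γ q₀ (gauge ϖ f x) w + gainDiffV γ q₀ (gauge ϖ f x) w)) := by
  have e1 : (fun y => muMaxwellian ϖ x (cross ϖ x + y)) =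
      fun y => Real.exp (‖cross ϖ x‖ ^ 2 / 2) * gaussDensity y := by
    ext y; rw [muMaxwellian_eq, mMaxwellian_cross_add]
  have e2 : (fun y => Real.sqrt (mMaxwellian ϖ x (cross ϖ x + y)) * f x (cross ϖ x + y)) =
      fun y => gaussDensity y * gauge ϖ f x y := by
    ext y
    rw [mMaxwellian_cross_add, apply_cross_add ϖ f, ← mul_assoc, sqrt_gaussDensity_mul_self]
  rw [linOp, Q_add_left, Q_add_left, e1, e2, Q_gauss_left, Q_gauss_right, mMaxwellian_cross_add]
  have h1 : gaussDensity w * (1 / Real.sqrt (gaussDensity w)) = Real.sqrt (gaussDensity w) := by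
    rw [mul_one_div, Real.div_sqrt]
  linear_combination (-(Real.exp (‖cross ϖ x‖ ^ 2 / 2) *
    (gainDiffU γ q₀ (gauge ϖ f x) w + gainDiffV γ q₀ (gauge ϖ f x) w))) * h1

theorem nuWeight_cross_add (γ : ℝ) (ϖ x w : V3) :
    nuWeight γ ϖ x (cross ϖ x + w) = speedWeight γ w := by
  rw [nuWeight, add_sub_cancel_left, speedWeight]

theorem macroBasis_cross_add (ϖ x : V3) (i : Fin 5) (w : V3) :
    macroBasis ϖ x i (cross ϖ x + w) = invariant i w * Real.sqrt (gaussDensity w) := by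
  rw [macroBasis, add_sub_cancel_left, mMaxwellian_cross_add, invariant]

theorem integral_eq_of_cross_add {F G : V3 → ℝ} {a : V3} {c : ℝ}
    (h : ∀ w, F (a + w) = c * (gaussDensity w * G w)) : ∫ v, F v = c * ∫ w, G w ∂gauss := by
  rw [← integral_add_left_eq_self F a, integral_gauss, ← integral_const_mul]
  simp_rw [h]

theorem integrable_of_cross_add {F G : V3 → ℝ} {a : V3} {c : ℝ}
    (h : ∀ w, F (a + w) = c * (gaussDensity w * G w)) (hG : Integrable G gauss) :
    Integrable F := by
  have h1 : Integrable fun w => F (a + w) := by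
    simp_rw [h]
    exact (integrable_gauss_iff.1 hG).const_mul c
  have := h1.comp_add_left (-a)
  simpa using this

/-- The gauge is an isometry from `L²(dv)` to `L²(gauss)` carrying `macroBasis` to the invariants,
so it intertwines the two projections. -/
theorem microPart_cross_add (ϖ : V3) (f : V3 → V3 → ℝ) (x w : V3) :
    microPart ϖ f x (cross ϖ x + w) =
      Real.sqrt (gaussDensity w) * gaussMicro (gauge ϖ f x) w := by
  have hc : ∀ i, ∫ v, f x v * macroBasis ϖ x i v =
      ∫ w, gauge ϖ f x w * invariant i w ∂gauss := fun i => by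
    rw [integral_eq_of_cross_add (a := cross ϖ x) (c := 1)
      (G := fun w => gauge ϖ f x w * invariant i w), one_mul]
    intro w
    rw [apply_cross_add ϖ f, macroBasis_cross_add]
    linear_combination (gauge ϖ f x w * invariant i w) * sqrt_gaussDensity_mul_self w
  rw [microPart, macroProj, gaussMicro, mul_sub, ← apply_cross_add ϖ f, Finset.mul_sum]
  congr 1
  refine Finset.sum_congr rfl fun i _ => ?_
  rw [hc, macroBasis_cross_add]
  ring

theorem aestronglyMeasurable_gauge {ϖ : V3} {f : V3 → V3 → ℝ} {x : V3}
    (hf : AEStronglyMeasurable (f x) volume) : AEStronglyMeasurable (gauge ϖ f x) gauss := by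
  have h1 : AEStronglyMeasurable (fun w => f x (cross ϖ x + w)) gauss :=
    (hf.comp_measurePreserving (measurePreserving_add_left volume (cross ϖ x))).mono_ac
      gauss_absolutelyContinuous
  have h2 : Measurable fun w => (Real.sqrt (gaussDensity w))⁻¹ :=
    continuous_gaussDensity.measurable.sqrt.inv
  exact h1.mul h2.aestronglyMeasurable

/-- Boundedness and coercivity of the linearized operator at a fixed position. -/
theorem exists_fiber_bounds {γ : ℝ} (hγ : γ ∈ Icc (0 : ℝ) 1) {q₀ : ℝ → ℝ} (hq : GradCutoff q₀) :
    ∃ C δ : ℝ, 0 < C ∧ 0 < δ ∧ ∀ (ϖ x : V3) (f : V3 → V3 → ℝ),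
      AEStronglyMeasurable (f x) volume → Integrable (fun v => f x v ^ 2 * nuWeight γ ϖ x v) →
      Integrable (fun v => linOp γ q₀ ϖ f x v * f x v) ∧
      ∫ v, ‖linOp γ q₀ ϖ f x v * f x v‖ ≤
        Real.exp (‖cross ϖ x‖ ^ 2 / 2) * (C * ∫ v, f x v ^ 2 * nuWeight γ ϖ x v) ∧
      Integrable (fun v => microPart ϖ f x v ^ 2 * nuWeight γ ϖ x v) ∧
      ∫ v, microPart ϖ f x v ^ 2 * nuWeight γ ϖ x v ≤
        C * ∫ v, f x v ^ 2 * nuWeight γ ϖ x v ∧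
      δ * (Real.exp (‖cross ϖ x‖ ^ 2 / 2) * nuNormSqV γ ϖ x (microPart ϖ f x)) ≤
        ∫ v, linOp γ q₀ ϖ f x v * f x v := by
  obtain ⟨C, δ, hC, hδ, H⟩ := exists_gainDiff_bounds hγ hq
  obtain ⟨C', hC', H'⟩ := exists_gaussMicro_weight_le hγ
  refine ⟨max C C', δ, lt_max_of_lt_left hC, hδ, fun ϖ x f hm hi => ?_⟩
  set a := cross ϖ x with ha
  set E := Real.exp (‖a‖ ^ 2 / 2) with hE
  have hE0 : 0 < E := Real.exp_pos _
  set h := gauge ϖ f x with hh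
  have hhm : AEStronglyMeasurable h gauss := aestronglyMeasurable_gauge hm
  have ef : ∀ w, f x (a + w) ^ 2 * nuWeight γ ϖ x (a + w) =
      1 * (gaussDensity w * (h w ^ 2 * speedWeight γ w)) := fun w => by
    rw [nuWeight_cross_add, apply_cross_add ϖ f]
    linear_combination (h w ^ 2 * speedWeight γ w) * sqrt_gaussDensity_mul_self w
  have em : ∀ w, microPart ϖ f x (a + w) ^ 2 * nuWeight γ ϖ x (a + w) =
      1 * (gaussDensity w * (gaussMicro h w ^ 2 * speedWeight γ w)) := fun w => by
    rw [nuWeight_cross_add, microPart_cross_add]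
    linear_combination (gaussMicro h w ^ 2 * speedWeight γ w) * sqrt_gaussDensity_mul_self w
  have el : ∀ w, linOp γ q₀ ϖ f x (a + w) * f x (a + w) =
      -E * (gaussDensity w * ((gainDiffU γ q₀ h w + gainDiffV γ q₀ h w) * h w)) := fun w => by
    rw [linOp_cross_add, apply_cross_add ϖ f]
    linear_combination (-E * ((gainDiffU γ q₀ h w + gainDiffV γ q₀ h w) * h w)) *
      sqrt_gaussDensity_mul_self w
  have en : ∀ w, ‖linOp γ q₀ ϖ f x (a + w) * f x (a + w)‖ =
      E * (gaussDensity w * ‖(gainDiffU γ q₀ h w + gainDiffV γ q₀ h w) * h w‖) := fun w => by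
    rw [el, norm_mul, norm_neg, Real.norm_of_nonneg hE0.le, norm_mul,
      Real.norm_of_nonneg (gaussDensity_pos w).le]
  have hhi : Integrable (fun w => h w ^ 2 * speedWeight γ w) gauss := by
    rw [integrable_gauss_iff]
    refine (hi.comp_add_left a).congr (Filter.Eventually.of_forall fun w => ?_)
    simp only [ef, one_mul]
  have hX : 0 ≤ ∫ v, h v ^ 2 * speedWeight γ v ∂gauss := integral_nonneg fun v =>
    mul_nonneg (sq_nonneg _) (zero_le_one.trans (one_le_speedWeight hγ v))
  obtain ⟨b1, b2, b3⟩ := H h hhm hhi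
  obtain ⟨m1, m2⟩ := H' h hhm hhi
  refine ⟨integrable_of_cross_add el b1, ?_, integrable_of_cross_add em m1, ?_, ?_⟩
  · rw [integral_eq_of_cross_add en, integral_eq_of_cross_add ef, one_mul]
    exact mul_le_mul_of_nonneg_left
      (b2.trans (mul_le_mul_of_nonneg_right (le_max_left _ _) hX)) hE0.le
  · rw [integral_eq_of_cross_add em, integral_eq_of_cross_add ef, one_mul, one_mul]
    exact m2.trans (mul_le_mul_of_nonneg_right (le_max_right _ _) hX)
  · rw [nuNormSqV, integral_eq_of_cross_add em, integral_eq_of_cross_add el, one_mul]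
    have := mul_le_mul_of_nonneg_left b3 hE0.le
    linarith

/-! ### Measurability in phase space -/

theorem continuous_cross (ϖ : V3) : Continuous (cross ϖ) := by
  have h : Continuous fun x : V3 => crossProduct ϖ.ofLp x.ofLp :=
    (LinearMap.continuous_of_finiteDimensional (crossProduct ϖ.ofLp)).comp
      (PiLp.continuous_ofLp 2 _)
  exact (PiLp.continuous_toLp 2 _).comp h

theorem continuous_mMaxwellian (ϖ : V3) :
    Continuous fun p : V3 × V3 => mMaxwellian ϖ p.1 p.2 := by
  have := continuous_cross ϖ
  unfold mMaxwellian; fun_prop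

theorem continuous_muMaxwellian (ϖ : V3) :
    Continuous fun p : V3 × V3 => muMaxwellian ϖ p.1 p.2 := by
  have := continuous_cross ϖ
  unfold muMaxwellian; fun_prop

theorem measurable_nuWeight (γ : ℝ) (ϖ : V3) :
    Measurable fun p : V3 × V3 => nuWeight γ ϖ p.1 p.2 := by
  have := (continuous_cross ϖ).measurable
  unfold nuWeight; fun_prop

theorem continuous_macroBasis (ϖ : V3) (i : Fin 5) :
    Continuous fun p : V3 × V3 => macroBasis ϖ p.1 i p.2 := by
  have h1 := continuous_cross ϖ
  have h2 := (continuous_mMaxwellian ϖ).sqrt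
  have h3 : Continuous fun p : V3 × V3 => invariant i (p.2 - cross ϖ p.1) :=
    (continuous_invariant i).comp (by fun_prop)
  exact h3.mul h2

theorem measurable_collisionKernel (γ : ℝ) {q₀ : ℝ → ℝ} (hq : Measurable q₀) :
    Measurable fun p : (V3 × V3) × (V3 × S2) => collisionKernel γ q₀ p.2.1 p.1.2 p.2.2 := by
  have h1 : Measurable fun p : (V3 × V3) × (V3 × S2) =>
      InnerProductGeometry.angle (p.2.1 - p.1.2) (p.2.2 : V3) :=
    measurable_angle (by fun_prop) (by fun_prop)
  have h2 : Measurable fun p : (V3 × V3) × (V3 × S2) => ‖p.1.2 - p.2.1‖ ^ γ := by fun_prop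
  exact h2.mul (hq.comp h1)

theorem measurable_Q (γ : ℝ) {q₀ : ℝ → ℝ} (hq : Measurable q₀) {F G : V3 → V3 → ℝ}
    (hF : Measurable fun p : V3 × V3 => F p.1 p.2) (hG : Measurable fun p : V3 × V3 => G p.1 p.2) :
    Measurable fun p : V3 × V3 => Q γ q₀ (F p.1) (G p.1) p.2 := by
  have hV : Measurable fun p : (V3 × V3) × (V3 × S2) => (p.1.1, postV p.2.1 p.1.2 p.2.2) := by
    unfold postV; fun_prop
  have hU : Measurable fun p : (V3 × V3) × (V3 × S2) => (p.1.1, postU p.2.1 p.1.2 p.2.2) := by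
    unfold postU; fun_prop
  have hu : Measurable fun p : (V3 × V3) × (V3 × S2) => (p.1.1, p.2.1) := by fun_prop
  have key : Measurable fun p : (V3 × V3) × (V3 × S2) => collisionKernel γ q₀ p.2.1 p.1.2 p.2.2 *
      (F p.1.1 (postV p.2.1 p.1.2 p.2.2) * G p.1.1 (postU p.2.1 p.1.2 p.2.2) -
        F p.1.1 p.1.2 * G p.1.1 p.2.1) :=
    (measurable_collisionKernel γ hq).mul
      (((hF.comp hV).mul (hG.comp hU)).sub ((hF.comp measurable_fst).mul (hG.comp hu)))
  exact (key.stronglyMeasurable.integral_prod_right'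
    (ν := (volume : Measure V3).prod sphereMeasure)).measurable

theorem measurable_linOp (γ : ℝ) {q₀ : ℝ → ℝ} (hq : Measurable q₀) (ϖ : V3) {f : V3 → V3 → ℝ}
    (hf : Measurable fun p : V3 × V3 => f p.1 p.2) :
    Measurable fun p : V3 × V3 => linOp γ q₀ ϖ f p.1 p.2 := by
  have h1 := (continuous_mMaxwellian ϖ).measurable.sqrt
  have h2 := (continuous_muMaxwellian ϖ).measurable
  have h3 : Measurable fun p : V3 × V3 => Real.sqrt (mMaxwellian ϖ p.1 p.2) * f p.1 p.2 := h1.mul hf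
  have h4 := measurable_Q γ hq (F := muMaxwellian ϖ)
    (G := fun x w => Real.sqrt (mMaxwellian ϖ x w) * f x w) h2 h3
  have h5 := measurable_Q γ hq (F := fun x w => Real.sqrt (mMaxwellian ϖ x w) * f x w)
    (G := muMaxwellian ϖ) h3 h2
  exact (h1.const_div 1).neg.mul (h4.add h5)

theorem quasiMeasurePreserving_config :
    Measure.QuasiMeasurePreserving config
      ((volume : Measure V3).prod ((volume : Measure V3).prod sphereMeasure)) collMeasure :=
  measurePreserving_config.quasiMeasurePreserving.mono_left
    (absolutelyContinuous_gauss.prod (absolutelyContinuous_gauss.prod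
      Measure.AbsolutelyContinuous.rfl))

/-- Each velocity map `T` is nonsingular for the Gaussian, and the Gaussian and Lebesgue null sets
coincide; the position is carried along unchanged. -/
theorem quasiMeasurePreserving_post {T : Coll → V3}
    (hT : Measure.QuasiMeasurePreserving T collMeasure gauss) (μ : Measure V3) [SFinite μ] :
    Measure.QuasiMeasurePreserving
      (fun p : (V3 × V3) × (V3 × S2) => (p.1.1, T (config (p.1.2, p.2))))
      ((μ.prod volume).prod ((volume : Measure V3).prod sphereMeasure)) (μ.prod volume) := by
  have h1 : Measure.QuasiMeasurePreserving (fun z => T (config z))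
      ((volume : Measure V3).prod ((volume : Measure V3).prod sphereMeasure)) volume :=
    (hT.comp quasiMeasurePreserving_config).mono_right gauss_absolutelyContinuous
  have i1 : SFinite ((volume : Measure V3).prod sphereMeasure) := inferInstance
  have i2 : SFinite ((volume : Measure V3).prod ((volume : Measure V3).prod sphereMeasure)) :=
    inferInstance
  have h2 := QuasiMeasurePreserving.prodMap (Measure.QuasiMeasurePreserving.id μ) h1
  exact h2.comp (measurePreserving_prodAssoc μ volume
    ((volume : Measure V3).prod sphereMeasure)).quasiMeasurePreserving

theorem quasiMeasurePreserving_snd_collMeasure :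
    Measure.QuasiMeasurePreserving (fun p : Coll => p.2.2) collMeasure gauss :=
  Measure.quasiMeasurePreserving_snd.comp Measure.quasiMeasurePreserving_snd

/-- The operator evaluates `f` at `u`, `v'` and `u'`. These velocities pull null sets back to null
sets, so for almost every `(x, v)` the integrands change only on a null set. This allows replacing
`f` by a measurable representative. -/
theorem linOp_ae_eq (γ : ℝ) (q₀ : ℝ → ℝ) (ϖ : V3) {f g : V3 → V3 → ℝ} {μ : Measure V3} [SFinite μ]
    (h : (fun p : V3 × V3 => f p.1 p.2) =ᵐ[μ.prod volume] fun p => g p.1 p.2) :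
    (fun p : V3 × V3 => linOp γ q₀ ϖ f p.1 p.2) =ᵐ[μ.prod volume]
      fun p => linOp γ q₀ ϖ g p.1 p.2 := by
  have hc := measurePreserving_collMap.quasiMeasurePreserving
  have hV := (quasiMeasurePreserving_post
    (quasiMeasurePreserving_fst_collMeasure.comp hc) μ).ae_eq_comp h
  have hU := (quasiMeasurePreserving_post
    (quasiMeasurePreserving_snd_collMeasure.comp hc) μ).ae_eq_comp h
  have hu := (quasiMeasurePreserving_post quasiMeasurePreserving_snd_collMeasure μ).ae_eq_comp h
  filter_upwards [h, Measure.ae_ae_of_ae_prod hV, Measure.ae_ae_of_ae_prod hU,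
    Measure.ae_ae_of_ae_prod hu] with p h0 h1 h2 h3
  have e1 : Q γ q₀ (muMaxwellian ϖ p.1) (fun w => Real.sqrt (mMaxwellian ϖ p.1 w) * f p.1 w) p.2 =
      Q γ q₀ (muMaxwellian ϖ p.1) (fun w => Real.sqrt (mMaxwellian ϖ p.1 w) * g p.1 w) p.2 := by
    refine integral_congr_ae ?_
    filter_upwards [h2, h3] with z hz2 hz3
    have hz2 : f p.1 (postU z.1 p.2 z.2) = g p.1 (postU z.1 p.2 z.2) := hz2
    have hz3 : f p.1 z.1 = g p.1 z.1 := hz3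
    simp only [hz2, hz3]
  have e2 : Q γ q₀ (fun w => Real.sqrt (mMaxwellian ϖ p.1 w) * f p.1 w) (muMaxwellian ϖ p.1) p.2 =
      Q γ q₀ (fun w => Real.sqrt (mMaxwellian ϖ p.1 w) * g p.1 w) (muMaxwellian ϖ p.1) p.2 := by
    refine integral_congr_ae ?_
    filter_upwards [h1] with z hz1
    have hz1 : f p.1 (postV z.1 p.2 z.2) = g p.1 (postV z.1 p.2 z.2) := hz1
    simp only [hz1, h0]
  simp only [linOp, e1, e2]

theorem aestronglyMeasurable_linOp (γ : ℝ) {q₀ : ℝ → ℝ} (hq : Measurable q₀) (ϖ : V3)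
    {f : V3 → V3 → ℝ} {μ : Measure V3} [SFinite μ]
    (hf : AEStronglyMeasurable (fun p : V3 × V3 => f p.1 p.2) (μ.prod volume)) :
    AEStronglyMeasurable (fun p : V3 × V3 => linOp γ q₀ ϖ f p.1 p.2) (μ.prod volume) := by
  refine (measurable_linOp γ hq ϖ (f := fun x v => hf.mk _ (x, v))
    hf.stronglyMeasurable_mk.measurable).aestronglyMeasurable.congr ?_
  exact (linOp_ae_eq γ q₀ ϖ hf.ae_eq_mk).symm

theorem aestronglyMeasurable_microPart (ϖ : V3) {f : V3 → V3 → ℝ} {μ : Measure V3} [SFinite μ]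
    (hf : AEStronglyMeasurable (fun p : V3 × V3 => f p.1 p.2) (μ.prod volume)) :
    AEStronglyMeasurable (fun p : V3 × V3 => microPart ϖ f p.1 p.2) (μ.prod volume) := by
  refine hf.sub (Finset.aestronglyMeasurable_fun_sum _ fun i _ => ?_)
  have hb := (continuous_macroBasis ϖ i).aestronglyMeasurable (μ := μ.prod (volume : Measure V3))
  have h1 : AEStronglyMeasurable (fun x => ∫ w : V3, f x w * macroBasis ϖ x i w) μ :=
    (hf.mul hb).integral_prod_right'
  exact h1.comp_fst.mul hb

/-! ### Positivity of the linearized operator -/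

theorem volume_restrict_prod_univ (Ω : Set V3) :
    (volume : Measure (V3 × V3)).restrict (Ω ×ˢ univ) =
      ((volume : Measure V3).restrict Ω).prod volume := by
  rw [Measure.volume_eq_prod, ← Measure.prod_restrict, Measure.restrict_univ]

theorem integrable_prod_of_fiber_le {α β : Type*} [MeasurableSpace α] [MeasurableSpace β]
    {μ : Measure α} {ν : Measure β} [SFinite ν] {F : α × β → ℝ} {B : α → ℝ}
    (hF : AEStronglyMeasurable F (μ.prod ν)) (hB : Integrable B μ)
    (h : ∀ᵐ x ∂μ, Integrable (fun y => F (x, y)) ν ∧ ∫ y, ‖F (x, y)‖ ∂ν ≤ B x) :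
    Integrable F (μ.prod ν) := by
  refine (integrable_prod_iff hF).2 ⟨h.mono fun x hx => hx.1, ?_⟩
  refine hB.mono' hF.norm.integral_prod_right' (h.mono fun x hx => ?_)
  rw [Real.norm_of_nonneg (integral_nonneg fun y => norm_nonneg _)]
  exact hx.2

end RotBoltzmann

end

theorem lemma2p4 (γ : ℝ) (hγ : γ ∈ Set.Icc (0 : ℝ) 1) (q₀ : ℝ → ℝ) (hq₀ : GradCutoff q₀) :
    ∃ δ₀ : ℝ, 0 < δ₀ ∧
      ∀ (Ω : Set V3), IsOpen Ω → Bornology.IsBounded Ω → ∀ (ϖ : V3) (f : V3 → V3 → ℝ),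
        AEStronglyMeasurable (fun p : V3 × V3 => f p.1 p.2) (volume.restrict (Ω ×ˢ Set.univ)) →
        IntegrableXV Ω (fun x v => f x v ^ 2 * nuWeight γ ϖ x v) →
        IntegrableXV Ω (fun x v => linOp γ q₀ ϖ f x v * f x v) ∧
        IntegrableXV Ω (fun x v =>
          Real.exp (‖cross ϖ x‖ ^ 2 / 2) * (microPart ϖ f x v ^ 2 * nuWeight γ ϖ x v)) ∧
        IntegrableXV Ω (fun x v => microPart ϖ f x v ^ 2 * nuWeight γ ϖ x v) ∧
        innerXV Ω (linOp γ q₀ ϖ f) f ≥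
          δ₀ * ∫ x in Ω, Real.exp (‖cross ϖ x‖ ^ 2 / 2) *
            nuNormSqV γ ϖ x (microPart ϖ f x) ∧
        δ₀ * ∫ x in Ω, Real.exp (‖cross ϖ x‖ ^ 2 / 2) *
            nuNormSqV γ ϖ x (microPart ϖ f x) ≥
          δ₀ * nuNormSqXV γ ϖ Ω (microPart ϖ f) := by
  obtain ⟨C, δ, hC, hδ, H⟩ := exists_fiber_bounds hγ hq₀
  refine ⟨δ, hδ, fun Ω hΩ hb ϖ f hf hi => ?_⟩
  unfold IntegrableXV innerXV nuNormSqXV IntegrableOn at *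
  rw [volume_restrict_prod_univ] at *
  set μ := (volume : Measure V3).restrict Ω with hμ
  set E : V3 → ℝ := fun x => Real.exp (‖cross ϖ x‖ ^ 2 / 2) with hE
  have hEc : Continuous E := by
    have := continuous_cross ϖ
    rw [hE]; fun_prop
  have hE1 : ∀ x, 1 ≤ E x := fun x => Real.one_le_exp (by positivity)
  -- Boundedness of `Ω` enters here: `M` is needed only for integrability and does not affect `δ`.
  obtain ⟨M, hM⟩ := hb.isCompact_closure.exists_bound_of_continuousOn hEc.continuousOn
  have hEM : ∀ᵐ x ∂μ, E x ≤ M := (ae_restrict_mem hΩ.measurableSet).mono fun x hx =>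
    (le_abs_self _).trans (hM x (subset_closure hx))
  have hw : ∀ x v, 0 ≤ nuWeight γ ϖ x v := fun x v => Real.rpow_nonneg (by positivity) _
  set N : V3 → ℝ := fun x => ∫ v, f x v ^ 2 * nuWeight γ ϖ x v with hN
  have hNi : Integrable N μ := hi.integral_prod_left
  have hN0 : ∀ x, 0 ≤ N x := fun x => integral_nonneg fun v => mul_nonneg (sq_nonneg _) (hw x v)
  have hfib : ∀ᵐ x ∂μ, AEStronglyMeasurable (f x) volume ∧
      Integrable fun v => f x v ^ 2 * nuWeight γ ϖ x v := by
    filter_upwards [hf.prodMk_left, hi.prod_right_ae] with x h1 h2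
    exact ⟨h1, h2⟩
  have hmm := aestronglyMeasurable_microPart ϖ hf
  have hwm := (measurable_nuWeight γ ϖ).aestronglyMeasurable (μ := μ.prod (volume : Measure V3))
  have hL : Integrable (fun p : V3 × V3 => linOp γ q₀ ϖ f p.1 p.2 * f p.1 p.2)
      (μ.prod volume) := by
    refine integrable_prod_of_fiber_le (B := fun x => M * (C * N x))
      ((aestronglyMeasurable_linOp γ hq₀.measurable ϖ hf).mul hf)
      ((hNi.const_mul C).const_mul M) ?_
    filter_upwards [hfib, hEM] with x hx hx'
    obtain ⟨a1, a2, -⟩ := H ϖ x f hx.1 hx.2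
    exact ⟨a1, a2.trans (mul_le_mul_of_nonneg_right hx' (mul_nonneg hC.le (hN0 x)))⟩
  have hP : Integrable (fun p : V3 × V3 => microPart ϖ f p.1 p.2 ^ 2 * nuWeight γ ϖ p.1 p.2)
      (μ.prod volume) := by
    refine integrable_prod_of_fiber_le (B := fun x => C * N x) ((hmm.pow 2).mul hwm)
      (hNi.const_mul C) ?_
    filter_upwards [hfib] with x hx
    obtain ⟨-, -, a3, a4, -⟩ := H ϖ x f hx.1 hx.2
    refine ⟨a3, ?_⟩
    simp_rw [Real.norm_of_nonneg (mul_nonneg (sq_nonneg (microPart ϖ f x _)) (hw x _))]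
    exact a4
  have hEP : Integrable (fun p : V3 × V3 =>
      E p.1 * (microPart ϖ f p.1 p.2 ^ 2 * nuWeight γ ϖ p.1 p.2)) (μ.prod volume) := by
    refine (hP.const_mul M).mono' ((hEc.comp continuous_fst).aestronglyMeasurable.mul hP.1) ?_
    filter_upwards [Measure.quasiMeasurePreserving_fst.ae hEM] with p hp
    have h0 := mul_nonneg (sq_nonneg (microPart ϖ f p.1 p.2)) (hw p.1 p.2)
    rw [Real.norm_of_nonneg (mul_nonneg (zero_le_one.trans (hE1 _)) h0)]
    exact mul_le_mul_of_nonneg_right hp h0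
  have hn : Integrable (fun x => nuNormSqV γ ϖ x (microPart ϖ f x)) μ := hP.integral_prod_left
  have hEn : Integrable (fun x => E x * nuNormSqV γ ϖ x (microPart ϖ f x)) μ := by
    refine hEP.integral_prod_left.congr (Filter.Eventually.of_forall fun x => ?_)
    simp only [nuNormSqV, integral_const_mul]
  refine ⟨hL, hEP, hP, ?_, ?_⟩
  · rw [ge_iff_le, integral_prod _ hL, ← integral_const_mul]
    refine integral_mono_ae (hEn.const_mul δ) hL.integral_prod_left ?_
    filter_upwards [hfib] with x hx
    exact (H ϖ x f hx.1 hx.2).2.2.2.2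
  · rw [ge_iff_le, integral_prod _ hP]
    refine mul_le_mul_of_nonneg_left (integral_mono hn hEn fun x => ?_) hδ.le
    -- The exponential factor is at least one and the fibre norm is nonnegative.
    exact le_mul_of_one_le_left
      (integral_nonneg fun v => mul_nonneg (sq_nonneg _) (hw x v)) (hE1 x)
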